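/- **Setting.** Let $n\in\{2,3\}$, $Y=(0,1)^n$, let $\mathcal A,\mathcal B$ be nonempty compact metric spaces, and let $A=A^\top:\mathbb R^n\times\mathcal A\times\mathcal B\to\mathbb R^{n\times n}$, $b:\mathbb R^n\times\mathcal A\times\mathcal B\to\mathbb R^n$, $c,f:\mathbb R^n\times\mathcal A\times\mathcal B\to\mathbb R$ be uniformly continuous and $Y$-periodic in the first variable, with $\inf c>0$, with $\zeta_1|\xi|^2\le A\xi\cdot\xi\le\zeta_2|\xi|^2$ for some $\zeta_1,\zeta_2>0$, and with the Cordes condition $$|A|^2+\frac{|b|^2}{2\lambda}+\frac{c^2}{\lambda^2}\le\frac1{n+\delta}\Big(\operatorname{tr}A+\frac c\lambda\Big)^2$$ for some $\lambda>0$, $\delta\in(0,1)$ (where $|A|$ is the Frobenius norm). Put $\gamma=\big(|A|^2+\frac{|b|^2}{2\lambda}+\frac{c^2}{\lambda^2}\big)^{-1}\big(\operatorname{tr}A+\frac c\lambda\big)$ and $$F[u]=\inf_{\alpha\in\mathcal A}\sup_{\beta\in\mathcal B}\{-A^{\alpha\beta}:\nabla^2u-b^{\alpha\beta}\cdot\nabla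 u+c^{\alpha\beta}u-f^{\alpha\beta}\},\qquad F_\gamma[u]=\inf_{\alpha}\sup_{\beta}\{\gamma^{\alpha\beta}(-A^{\alpha\beta}:\nabla^2u-b^{\alpha\beta}\cdot\nabla u+c^{\alpha\beta}u-f^{\alpha\beta})\}.$$ Let $H^k_{\mathrm{per}}(Y)$ be the closure in $H^k(Y)$ of the smooth $Y$-periodic functions. Let $\mathcal T$ be a finite partition of $\bar Y$ into closed simplices whose $Y$-periodic extension is a conforming partition of $\mathbb R^n$, and let $\mathcal F$ be the set of its $(n-1)$-dimensional faces: interior faces, and pairs of opposite boundary faces identified by periodicity. For $F\in\mathcal F$ let $h_F=\mathcal H^{n-1}(F)^{1/(n-1)}$, and let $[\![\cdot]\!]$ be the difference of the traces from the two elements sharing $F$ (up to periodicity). Fix $\bar p\ge2$, let $V^0_{\mathcal T}$ be the space of functions in $L^2(Y)$ that are polynomials of degree at most $\bar p$ on every $K\in\mathcal T$, and let $V^1_{\mathcal T}=V^0_{\mathcal T}\cap H^1_{\mathrm{per}}(Y)$. With derivatives taken elementwise, put $$|w|_{J,\mathcal T}^2=\sum_{F\in\mathcal F}\int_F\big(h_F^{-1}|[\![\nabla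 w]\!]|^2+h_F^{-3}|[\![w]\!]|^2\big),\qquad \|w\|_{\mathcal T,\lambda}^2=\int_Y\big(|\nabla^2w|^2+2\lambda|\nabla w|^2+\lambda^2w^2\big)+|w|_{J,\mathcal T}^2 .$$ **Theorem.** Let $s\in\{0,1\}$ and let $a_{\mathcal T}:V^s_{\mathcal T}\times V^s_{\mathcal T}\to\mathbb R$ satisfy, for all $w,w',v\in V^s_{\mathcal T}$ and some constants $C_M,C_L,C_1,C_2>0$: - (A1) $a_{\mathcal T}(w,\cdot)$ is linear; - (A2) $\|w-v\|_{\mathcal T,\lambda}^2\le C_M\big(a_{\mathcal T}(w,w-v)-a_{\mathcal T}(v,w-v)\big)$; - (A3) $|a_{\mathcal T}(w,v)-a_{\mathcal T}(w',v)|\le C_L\|w-w'\|_{\mathcal T,\lambda}\|v\|_{\mathcal T,\lambda}$; - (A4) there is a linear operator $L_{\mathcal T}:V^s_{\mathcal T}\to L^2(Y)$ with $\|L_{\mathcal T}v\|_{L^2(Y)}\le C_1\|v\|_{\mathcal T,\lambda}$ and $\big|a_{\mathcal T}(w,v)-\int_YF_\gamma[w]\,L_{\mathcal T}v\big|\le C_2|w|_{J,\mathcal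 T}\|v\|_{\mathcal T,\lambda}$. Then there is a unique $u_{\mathcal T}\in V^s_{\mathcal T}$ with $a_{\mathcal T}(u_{\mathcal T},v)=0$ for all $v\in V^s_{\mathcal T}$. Moreover, if $u\in H^2_{\mathrm{per}}(Y)$ is the (unique) periodic strong solution, $F[u]=0$ a.e. in $Y$, then $$\|u-u_{\mathcal T}\|_{\mathcal T,\lambda}\le C_e\inf_{v\in V^s_{\mathcal T}}\|u-v\|_{\mathcal T,\lambda},\qquad C_e=1+C_M\big(C_1(\sqrt{1-\delta}+\sqrt{n+1})+C_2\big).$$ -/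

import Mathlib

open MeasureTheory Filter Topology Set
open scoped ENNReal ContDiff

noncomputable section

namespace PeriodicHJBI

/-! ### The unit cell, periodicity, weak derivatives -/

/-- Euclidean space of dimension `n`. -/
abbrev E (n : ℕ) : Type := EuclideanSpace ℝ (Fin n)

/-- The `i`-th standard unit vector. -/
def unitVec {n : ℕ} (i : Fin n) : E n := EuclideanSpace.single i (1 : ℝ)

/-- An integer vector, seen as a point of Euclidean space. -/
def latticeVec {n : ℕ} (z : Fin n → ℤ) : E n := WithLp.toLp 2 fun i => (z i : ℝ)

/-- The open unit cell `Y = (0,1)^n`. -/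
def Y (n : ℕ) : Set (E n) := {x | ∀ i, 0 < x i ∧ x i < 1}

/-- The closed unit cell. -/
def closedCell (n : ℕ) : Set (E n) := {x | ∀ i, 0 ≤ x i ∧ x i ≤ 1}

/-- `Y`-periodicity of a function on the whole space. -/
def IsPeriodic {n : ℕ} {R : Type*} (φ : E n → R) : Prop :=
  ∀ (x : E n) (z : Fin n → ℤ), φ (x + latticeVec z) = φ x

/-- The Hilbert space `L²(Y)`. -/
abbrev L2 (n : ℕ) : Type := Lp ℝ 2 ((volume : Measure (E n)).restrict (Y n))

/-- The classical partial derivative `∂ᵢφ`. -/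
def partialDeriv {n : ℕ} (i : Fin n) (φ : E n → ℝ) (x : E n) : ℝ := fderiv ℝ φ x (unitVec i)

/-- `g` is the weak partial derivative `∂ᵢw` on the open set `Ω`. -/
def IsWeakPartial {n : ℕ} (Ω : Set (E n)) (i : Fin n) (w g : E n → ℝ) : Prop :=
  LocallyIntegrableOn w Ω ∧ LocallyIntegrableOn g Ω ∧
    ∀ φ : E n → ℝ, ContDiff ℝ ∞ φ → HasCompactSupport φ → tsupport φ ⊆ Ω →
      ∫ x in Ω, w x * partialDeriv i φ x = -∫ x in Ω, g x * φ x

open Classical in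
/-- The weak partial derivative `∂ᵢw` on `Ω` (unique almost everywhere in `Ω`; zero if there
is none). -/
def weakPartial {n : ℕ} (Ω : Set (E n)) (i : Fin n) (w : E n → ℝ) : E n → ℝ :=
  if h : ∃ g, IsWeakPartial Ω i w g then h.choose else 0

/-- The weak gradient on `Ω`. -/
def weakGrad {n : ℕ} (Ω : Set (E n)) (w : E n → ℝ) (x : E n) : Fin n → ℝ :=
  fun i => weakPartial Ω i w x

/-- The weak Hessian on `Ω`. -/
def weakHess {n : ℕ} (Ω : Set (E n)) (w : E n → ℝ) (x : E n) : Matrix (Fin n) (Fin n) ℝ :=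
  Matrix.of fun i j => weakPartial Ω j (weakPartial Ω i w) x

/-! ### The periodic Sobolev spaces -/

/-- `H¹_per(Y)`: the functions in `H¹(Y)` that are limits, in the `H¹`-norm, of smooth
`Y`-periodic functions. -/
def MemH1Per {n : ℕ} (u : L2 n) : Prop :=
  ∃ G : Fin n → L2 n,
    (∀ i, IsWeakPartial (Y n) i u (G i)) ∧
    ∀ ε : ℝ, 0 < ε → ∃ φ : E n → ℝ, ContDiff ℝ ∞ φ ∧ IsPeriodic φ ∧
      eLpNorm (fun x => u x - φ x) 2 (volume.restrict (Y n)) < ENNReal.ofReal ε ∧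
      ∀ i, eLpNorm (fun x => G i x - partialDeriv i φ x) 2 (volume.restrict (Y n)) <
        ENNReal.ofReal ε

/-- `H²_per(Y)`: the functions in `H²(Y)` that are limits, in the `H²`-norm, of smooth
`Y`-periodic functions. -/
def MemH2Per {n : ℕ} (u : L2 n) : Prop :=
  ∃ (G : Fin n → L2 n) (H : Fin n → Fin n → L2 n),
    (∀ i, IsWeakPartial (Y n) i u (G i)) ∧
    (∀ i j, IsWeakPartial (Y n) j (G i) (H i j)) ∧
    ∀ ε : ℝ, 0 < ε → ∃ φ : E n → ℝ, ContDiff ℝ ∞ φ ∧ IsPeriodic φ ∧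
      eLpNorm (fun x => u x - φ x) 2 (volume.restrict (Y n)) < ENNReal.ofReal ε ∧
      (∀ i, eLpNorm (fun x => G i x - partialDeriv i φ x) 2 (volume.restrict (Y n)) <
        ENNReal.ofReal ε) ∧
      ∀ i j, eLpNorm (fun x => H i j x - partialDeriv j (partialDeriv i φ) x) 2
        (volume.restrict (Y n)) < ENNReal.ofReal ε

/-! ### The HJBI problem -/

/-- Coefficients of a Hamilton--Jacobi--Bellman--Isaacs operator. -/
structure Coeffs (n : ℕ) (𝒜 ℬ : Type*) where
  /-- diffusion matrix -/
  A : E n → 𝒜 → ℬ → Matrix (Fin n) (Fin n) ℝ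
  /-- drift -/
  b : E n → 𝒜 → ℬ → Fin n → ℝ
  /-- zeroth-order coefficient -/
  c : E n → 𝒜 → ℬ → ℝ
  /-- right-hand side -/
  f : E n → 𝒜 → ℬ → ℝ

/-- The Frobenius product `M : N`. -/
def frob {n : ℕ} (M N : Matrix (Fin n) (Fin n) ℝ) : ℝ := ∑ i, ∑ j, M i j * N i j

namespace Coeffs

variable {n : ℕ} {𝒜 ℬ : Type*}

/-- `|A|² + |b|²/(2λ) + c²/λ²`. -/
def cordesLhs (P : Coeffs n 𝒜 ℬ) (lam : ℝ) (x : E n) (α : 𝒜) (β : ℬ) : ℝ :=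
  frob (P.A x α β) (P.A x α β) + (∑ i, P.b x α β i ^ 2) / (2 * lam) + P.c x α β ^ 2 / lam ^ 2

/-- `tr A + c/λ`. -/
def cordesTr (P : Coeffs n 𝒜 ℬ) (lam : ℝ) (x : E n) (α : 𝒜) (β : ℬ) : ℝ :=
  (P.A x α β).trace + P.c x α β / lam

/-- The assumptions on the coefficients, with Cordes parameters `lam` and `delta`. -/
structure Admissible [MetricSpace 𝒜] [MetricSpace ℬ] (P : Coeffs n 𝒜 ℬ) (lam delta : ℝ) :
    Prop where
  lam_pos : 0 < lam
  delta_pos : 0 < delta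
  delta_lt_one : delta < 1
  A_symm : ∀ x α β, (P.A x α β).IsSymm
  A_unifCont : UniformContinuous fun q : E n × 𝒜 × ℬ => P.A q.1 q.2.1 q.2.2
  b_unifCont : UniformContinuous fun q : E n × 𝒜 × ℬ => P.b q.1 q.2.1 q.2.2
  c_unifCont : UniformContinuous fun q : E n × 𝒜 × ℬ => P.c q.1 q.2.1 q.2.2
  f_unifCont : UniformContinuous fun q : E n × 𝒜 × ℬ => P.f q.1 q.2.1 q.2.2
  A_periodic : IsPeriodic P.A
  b_periodic : IsPeriodic P.b
  c_periodic : IsPeriodic P.c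
  f_periodic : IsPeriodic P.f
  c_pos : ∃ c₀ : ℝ, 0 < c₀ ∧ ∀ x α β, c₀ ≤ P.c x α β
  elliptic : ∃ ζ₁ ζ₂ : ℝ, 0 < ζ₁ ∧ 0 < ζ₂ ∧ ∀ x α β (ξ : Fin n → ℝ),
    ζ₁ * (∑ i, ξ i ^ 2) ≤ (P.A x α β).mulVec ξ ⬝ᵥ ξ ∧
      (P.A x α β).mulVec ξ ⬝ᵥ ξ ≤ ζ₂ * ∑ i, ξ i ^ 2
  cordes : ∀ x α β,
    P.cordesLhs lam x α β ≤ 1 / ((n : ℝ) + delta) * P.cordesTr lam x α β ^ 2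

/-- `-A:R - b·p + c r - f`, evaluated at the point `x`. -/
def linPart (P : Coeffs n 𝒜 ℬ) (x : E n) (r : ℝ) (p : Fin n → ℝ)
    (R : Matrix (Fin n) (Fin n) ℝ) (α : 𝒜) (β : ℬ) : ℝ :=
  -frob (P.A x α β) R - P.b x α β ⬝ᵥ p + P.c x α β * r - P.f x α β

/-- The HJBI operator `F` at the point `x`, with `r`, `p`, `R` in place of `u`, `∇u`, `∇²u`. -/
def F (P : Coeffs n 𝒜 ℬ) (x : E n) (r : ℝ) (p : Fin n → ℝ)
    (R : Matrix (Fin n) (Fin n) ℝ) : ℝ :=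
  ⨅ α, ⨆ β, P.linPart x r p R α β

/-- The renormalization factor `γ`. -/
def gamma (P : Coeffs n 𝒜 ℬ) (lam : ℝ) (x : E n) (α : 𝒜) (β : ℬ) : ℝ :=
  (P.cordesLhs lam x α β)⁻¹ * P.cordesTr lam x α β

/-- The renormalized operator `F_γ` at the point `x`. -/
def Fgamma (P : Coeffs n 𝒜 ℬ) (lam : ℝ) (x : E n) (r : ℝ) (p : Fin n → ℝ)
    (R : Matrix (Fin n) (Fin n) ℝ) : ℝ :=
  ⨅ α, ⨆ β, P.gamma lam x α β * P.linPart x r p R α β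

/-- `u ∈ H²_per(Y)` is a periodic strong solution: `F[u] = 0` almost everywhere in `Y`. -/
def IsStrongSolution (P : Coeffs n 𝒜 ℬ) (u : L2 n) : Prop :=
  MemH2Per u ∧ ∀ᵐ x ∂(volume.restrict (Y n)),
    P.F x (u x) (weakGrad (Y n) u x) (weakHess (Y n) u x) = 0

end Coeffs

/-! ### Periodic simplicial partitions -/

/-- The closed simplex spanned by a finite set of vertices. -/
def cell {n : ℕ} (s : Finset (E n)) : Set (E n) := convexHull ℝ (s : Set (E n))

/-- The common vertices of the translate by `z` of the simplex with vertex set `s`, and of the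
simplex with vertex set `t`. -/
def sharedVertices {n : ℕ} (s t : Finset (E n)) (z : Fin n → ℤ) : Set (E n) :=
  ((fun x => x + latticeVec z) '' (s : Set (E n))) ∩ (t : Set (E n))

/-- A finite conforming partition of the closed unit cell into closed simplices (given by their
vertex sets) whose `Y`-periodic extension is a conforming partition of the whole space: any two
simplices of the extension meet exactly in the simplex spanned by their common vertices
(possibly empty). -/
structure Mesh (n : ℕ) where
  /-- the vertex sets of the elements -/
  elems : Finset (Finset (E n))
  card_eq : ∀ s ∈ elems, s.card = n + 1
  indep : ∀ s ∈ elems, AffineIndependent ℝ ((↑) : s → E n)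
  cover : ⋃ s ∈ elems, cell s = closedCell n
  conforming : ∀ s ∈ elems, ∀ t ∈ elems, ∀ z : Fin n → ℤ,
    ((fun x => x + latticeVec z) '' cell s) ∩ cell t = convexHull ℝ (sharedVertices s t z)

namespace Mesh

variable {n : ℕ}

/-- The piecewise gradient. -/
def pwGrad (𝒯 : Mesh n) (w : E n → ℝ) (x : E n) : Fin n → ℝ :=
  ∑ s ∈ 𝒯.elems, (interior (cell s)).indicator (weakGrad (interior (cell s)) w) x

/-- The piecewise Hessian. -/
def pwHess (𝒯 : Mesh n) (w : E n → ℝ) (x : E n) : Matrix (Fin n) (Fin n) ℝ :=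
  ∑ s ∈ 𝒯.elems, (interior (cell s)).indicator (weakHess (interior (cell s)) w) x

open Classical in
/-- The faces of the partition, each of them listed with its two orientations. A triple
`(s, t, z)` stands for the `(n-1)`-dimensional face shared by the element `t` and the translate
by `z` of the element `s`; it is an interior face if `z = 0`, and a boundary face-pair
(opposite boundary faces, identified by periodicity) if `z ≠ 0`. The triple `(t, s, -z)` stands
for the same face, with the two sides interchanged. As all elements lie in the closed unit cell,
faces can be shared only if the entries of `z` lie in `{-1, 0, 1}`. -/
def orientedFaces (𝒯 : Mesh n) : Finset (Finset (E n) × Finset (E n) × (Fin n → ℤ)) :=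
  (𝒯.elems ×ˢ 𝒯.elems ×ˢ Fintype.piFinset fun _ => Finset.Icc (-1 : ℤ) 1).filter
    fun q => (sharedVertices q.1 q.2.1 q.2.2).ncard = n

end Mesh

/-- The face given by a triple `(s, t, z)`, as a subset of the element `t`. -/
def facePts {n : ℕ} (q : Finset (E n) × Finset (E n) × (Fin n → ℤ)) : Set (E n) :=
  convexHull ℝ (sharedVertices q.1 q.2.1 q.2.2)

/-- The surface measure on a set `S` of dimension `n - 1`: the normalized `(n-1)`-dimensional
Hausdorff measure, restricted to `S`. -/
def surf {n : ℕ} (S : Set (E n)) : Measure (E n) :=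
  (Measure.euclideanHausdorffMeasure (n - 1) : Measure (E n)).restrict S

/-- The diameter-like size `h_F = (ℋ^{n-1}(F))^{1/(n-1)}` of a face. -/
def faceSize {n : ℕ} (S : Set (E n)) : ℝ := (surf S).real univ ^ (1 / ((n : ℝ) - 1))

/-- `τ` is the trace on `S ⊆ ∂Ω` of the function `w ∈ W^{1,1}(Ω)`: the limit in `L¹(S)` of the
restrictions to `S` of smooth functions that converge to `w` in `W^{1,1}(Ω)`. -/
def IsTrace {n : ℕ} (Ω S : Set (E n)) (w τ : E n → ℝ) : Prop :=
  AEStronglyMeasurable τ (surf S) ∧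
  ∃ g : ℕ → E n → ℝ, (∀ k, ContDiff ℝ ∞ (g k)) ∧
    Tendsto (fun k => eLpNorm (fun x => g k x - w x) 1 (volume.restrict Ω)) atTop (𝓝 0) ∧
    (∀ i, Tendsto (fun k => eLpNorm (fun x => partialDeriv i (g k) x - weakPartial Ω i w x) 1
      (volume.restrict Ω)) atTop (𝓝 0)) ∧
    Tendsto (fun k => eLpNorm (fun x => g k x - τ x) 1 (surf S)) atTop (𝓝 0)

open Classical in
/-- The trace on `S ⊆ ∂Ω` of the function `w` on `Ω` (zero if there is none). -/
def trace {n : ℕ} (Ω S : Set (E n)) (w : E n → ℝ) : E n → ℝ :=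
  if h : ∃ τ, IsTrace Ω S w τ then h.choose else 0

/-- The jump across the face given by `q = (s, t, z)` of a function whose restriction to the
interior of the element `r` is `w r`: the trace from `t` minus the trace from the translate
by `z` of `s`. -/
def jump {n : ℕ} (w : Finset (E n) → E n → ℝ)
    (q : Finset (E n) × Finset (E n) × (Fin n → ℤ)) (x : E n) : ℝ :=
  trace (interior (cell q.2.1)) (facePts q) (w q.2.1) x -
    trace (interior (cell q.1)) ((fun y => y - latticeVec q.2.2) '' facePts q) (w q.1)
      (x - latticeVec q.2.2)

namespace Mesh

variable {n : ℕ}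

/-- The squared jump seminorm `|w|²_{J,𝒯}`. Every face occurs with both orientations in
`orientedFaces`, which accounts for the factor `1/2`; the squared jumps do not depend on the
orientation. -/
def jumpSq (𝒯 : Mesh n) (w : E n → ℝ) : ℝ :=
  (1 / 2) * ∑ q ∈ 𝒯.orientedFaces,
    ((faceSize (facePts q))⁻¹ *
        (∫ x, ∑ i, jump (fun r => weakPartial (interior (cell r)) i w) q x ^ 2
          ∂(surf (facePts q))) +
      (faceSize (facePts q))⁻¹ ^ 3 *
        ∫ x, jump (fun _ => w) q x ^ 2 ∂(surf (facePts q)))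

/-- The jump seminorm `|w|_{J,𝒯}`. -/
def jumpSeminorm (𝒯 : Mesh n) (w : E n → ℝ) : ℝ := Real.sqrt (𝒯.jumpSq w)

/-- The norm `‖w‖_{𝒯,λ}`. -/
def dgNorm (𝒯 : Mesh n) (lam : ℝ) (w : E n → ℝ) : ℝ :=
  Real.sqrt ((∫ x in Y n, (frob (𝒯.pwHess w x) (𝒯.pwHess w x) +
      2 * lam * (∑ i, 𝒯.pwGrad w x i ^ 2) + lam ^ 2 * w x ^ 2)) + 𝒯.jumpSq w)

end Mesh

/-! ### The finite element spaces -/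

/-- The discontinuous Galerkin space `V⁰`: functions in `L²(Y)` whose restriction to every
element is a polynomial of degree at most `p`. -/
def V0 {n : ℕ} (𝒯 : Mesh n) (p : ℕ) : Submodule ℝ (L2 n) where
  carrier := {v | ∀ s ∈ 𝒯.elems, ∃ P : MvPolynomial (Fin n) ℝ, P.totalDegree ≤ p ∧
    ∀ᵐ x ∂(volume.restrict (Y n)), x ∈ cell s → v x = MvPolynomial.eval (fun i => x i) P}
  add_mem' := by
    intro v w hv hw s hs
    obtain ⟨P, hP, hvP⟩ := hv s hs
    obtain ⟨Q, hQ, hwQ⟩ := hw s hs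
    refine ⟨P + Q, (MvPolynomial.totalDegree_add P Q).trans (max_le hP hQ), ?_⟩
    filter_upwards [hvP, hwQ, Lp.coeFn_add v w] with x h1 h2 h3 hx
    rw [h3, Pi.add_apply, h1 hx, h2 hx, map_add]
  zero_mem' := by
    intro s _
    refine ⟨0, by simp, ?_⟩
    filter_upwards [Lp.coeFn_zero ℝ 2 ((volume : Measure (E n)).restrict (Y n))] with x h _
    rw [h]; simp
  smul_mem' := by
    intro r v hv s hs
    obtain ⟨P, hP, hvP⟩ := hv s hs
    refine ⟨r • P, (MvPolynomial.totalDegree_smul_le r P).trans hP, ?_⟩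
    filter_upwards [hvP, Lp.coeFn_smul r v] with x h1 h2 hx
    rw [h2, Pi.smul_apply, h1 hx, MvPolynomial.smul_eval, smul_eq_mul]

theorem L2.integrable_mul_of_hasCompactSupport {n : ℕ} (u : L2 n) {φ : E n → ℝ}
    (hφ : Continuous φ) (hc : HasCompactSupport φ) :
    Integrable (fun x => u x * φ x) (volume.restrict (Y n)) :=
  (Lp.memLp u).integrable_mul
    (hφ.memLp_of_hasCompactSupport (p := 2) (μ := volume.restrict (Y n)) hc)

theorem continuous_partialDeriv {n : ℕ} {φ : E n → ℝ} (hφ : ContDiff ℝ ∞ φ) (i : Fin n) :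
    Continuous (partialDeriv i φ) :=
  (hφ.continuous_fderiv (by simp)).clm_apply continuous_const

theorem hasCompactSupport_partialDeriv {n : ℕ} {φ : E n → ℝ} (hφ : HasCompactSupport φ)
    (i : Fin n) : HasCompactSupport (partialDeriv i φ) :=
  (hφ.fderiv ℝ).comp_left (g := fun L : E n →L[ℝ] ℝ => L (unitVec i)) (by simp)

theorem L2.locallyIntegrableOn {n : ℕ} (u : L2 n) : LocallyIntegrableOn u (Y n) :=
  locallyIntegrableOn_of_locallyIntegrable_restrict
    ((Lp.memLp u).locallyIntegrable (by norm_num))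

theorem IsWeakPartial.add_L2 {n : ℕ} {i : Fin n} {u v g h : L2 n}
    (hu : IsWeakPartial (Y n) i u g) (hv : IsWeakPartial (Y n) i v h) :
    IsWeakPartial (Y n) i (u + v : L2 n) (g + h : L2 n) := by
  refine ⟨L2.locallyIntegrableOn _, L2.locallyIntegrableOn _, fun φ h1 h2 h3 => ?_⟩
  have d1 := continuous_partialDeriv h1 i
  have d2 := hasCompactSupport_partialDeriv h2 i
  have e1 : ∫ x in Y n, (u + v : L2 n) x * partialDeriv i φ x =
      ∫ x in Y n, (u x * partialDeriv i φ x + v x * partialDeriv i φ x) := by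
    refine integral_congr_ae ?_
    filter_upwards [Lp.coeFn_add u v] with x hx
    rw [hx, Pi.add_apply, add_mul]
  have e2 : ∫ x in Y n, (g + h : L2 n) x * φ x = ∫ x in Y n, (g x * φ x + h x * φ x) := by
    refine integral_congr_ae ?_
    filter_upwards [Lp.coeFn_add g h] with x hx
    rw [hx, Pi.add_apply, add_mul]
  rw [e1, e2, integral_add (L2.integrable_mul_of_hasCompactSupport u d1 d2)
    (L2.integrable_mul_of_hasCompactSupport v d1 d2),
    integral_add (L2.integrable_mul_of_hasCompactSupport g h1.continuous h2)
    (L2.integrable_mul_of_hasCompactSupport h h1.continuous h2),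
    hu.2.2 φ h1 h2 h3, hv.2.2 φ h1 h2 h3, neg_add]

theorem IsWeakPartial.smul_L2 {n : ℕ} {i : Fin n} {u g : L2 n} (r : ℝ)
    (hu : IsWeakPartial (Y n) i u g) :
    IsWeakPartial (Y n) i (r • u : L2 n) (r • g : L2 n) := by
  refine ⟨L2.locallyIntegrableOn _, L2.locallyIntegrableOn _, fun φ h1 h2 h3 => ?_⟩
  have e1 : ∫ x in Y n, (r • u : L2 n) x * partialDeriv i φ x =
      ∫ x in Y n, r * (u x * partialDeriv i φ x) := by
    refine integral_congr_ae ?_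
    filter_upwards [Lp.coeFn_smul r u] with x hx
    rw [hx, Pi.smul_apply, smul_eq_mul, mul_assoc]
  have e2 : ∫ x in Y n, (r • g : L2 n) x * φ x = ∫ x in Y n, r * (g x * φ x) := by
    refine integral_congr_ae ?_
    filter_upwards [Lp.coeFn_smul r g] with x hx
    rw [hx, Pi.smul_apply, smul_eq_mul, mul_assoc]
  rw [e1, e2, integral_const_mul, integral_const_mul, hu.2.2 φ h1 h2 h3, mul_neg]

theorem partialDeriv_add {n : ℕ} {φ ψ : E n → ℝ} (hφ : ContDiff ℝ ∞ φ) (hψ : ContDiff ℝ ∞ ψ)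
    (i : Fin n) (x : E n) :
    partialDeriv i (fun y => φ y + ψ y) x = partialDeriv i φ x + partialDeriv i ψ x := by
  have h1 : DifferentiableAt ℝ φ x := (hφ.differentiable (by simp)) x
  have h2 : DifferentiableAt ℝ ψ x := (hψ.differentiable (by simp)) x
  simp only [partialDeriv]
  rw [fderiv_fun_add h1 h2]; rfl

theorem partialDeriv_const_mul {n : ℕ} {φ : E n → ℝ} (hφ : ContDiff ℝ ∞ φ) (r : ℝ)
    (i : Fin n) (x : E n) :
    partialDeriv i (fun y => r * φ y) x = r * partialDeriv i φ x := by
  have h1 : DifferentiableAt ℝ φ x := (hφ.differentiable (by simp)) x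
  simp only [partialDeriv]
  rw [fderiv_const_mul h1]; rfl

theorem L2.eLpNorm_add_sub_lt {n : ℕ} (u v : L2 n) {φ ψ : E n → ℝ} (hφ : Continuous φ)
    (hψ : Continuous ψ) {ε : ℝ} (hε : 0 < ε)
    (h1 : eLpNorm (fun x => u x - φ x) 2 (volume.restrict (Y n)) < ENNReal.ofReal (ε / 2))
    (h2 : eLpNorm (fun x => v x - ψ x) 2 (volume.restrict (Y n)) < ENNReal.ofReal (ε / 2)) :
    eLpNorm (fun x => (u + v : L2 n) x - (φ x + ψ x)) 2 (volume.restrict (Y n)) <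
      ENNReal.ofReal ε := by
  have e : eLpNorm (fun x => (u + v : L2 n) x - (φ x + ψ x)) 2 (volume.restrict (Y n)) =
      eLpNorm ((fun x => u x - φ x) + fun x => v x - ψ x) 2 (volume.restrict (Y n)) := by
    refine eLpNorm_congr_ae ?_
    filter_upwards [Lp.coeFn_add u v] with x hx
    simp only [hx, Pi.add_apply]; ring
  rw [e]
  refine (eLpNorm_add_le ((Lp.aestronglyMeasurable u).sub hφ.aestronglyMeasurable)
    ((Lp.aestronglyMeasurable v).sub hψ.aestronglyMeasurable) (by norm_num)).trans_lt ?_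
  refine (ENNReal.add_lt_add h1 h2).trans_eq ?_
  rw [← ENNReal.ofReal_add (by linarith) (by linarith)]
  congr 1; ring

theorem L2.eLpNorm_smul_sub_lt {n : ℕ} (u : L2 n) {φ : E n → ℝ} (r : ℝ) {ε : ℝ} (hε : 0 < ε)
    (h1 : eLpNorm (fun x => u x - φ x) 2 (volume.restrict (Y n)) <
      ENNReal.ofReal (ε / (|r| + 1))) :
    eLpNorm (fun x => (r • u : L2 n) x - r * φ x) 2 (volume.restrict (Y n)) <
      ENNReal.ofReal ε := by
  have e : eLpNorm (fun x => (r • u : L2 n) x - r * φ x) 2 (volume.restrict (Y n)) =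
      eLpNorm (r • fun x => u x - φ x) 2 (volume.restrict (Y n)) := by
    refine eLpNorm_congr_ae ?_
    filter_upwards [Lp.coeFn_smul r u] with x hx
    simp only [hx, Pi.smul_apply, smul_eq_mul]; ring
  rw [e, eLpNorm_const_smul]
  have hr : (0 : ℝ) < |r| + 1 := by positivity
  calc ‖r‖ₑ * eLpNorm (fun x => u x - φ x) 2 (volume.restrict (Y n))
      ≤ ENNReal.ofReal |r| * ENNReal.ofReal (ε / (|r| + 1)) := by
        rw [← Real.norm_eq_abs r, ofReal_norm]
        exact mul_le_mul' le_rfl (by simpa only [Real.norm_eq_abs] using h1.le)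
    _ = ENNReal.ofReal (|r| * (ε / (|r| + 1))) := by
        rw [ENNReal.ofReal_mul (abs_nonneg r)]
    _ < ENNReal.ofReal ε := by
        rw [ENNReal.ofReal_lt_ofReal_iff hε, mul_div_assoc', div_lt_iff₀ hr]
        nlinarith

theorem L2.isWeakPartial_zero {n : ℕ} (i : Fin n) :
    IsWeakPartial (Y n) i (0 : L2 n) (0 : L2 n) := by
  refine ⟨L2.locallyIntegrableOn _, L2.locallyIntegrableOn _, fun φ _ _ _ => ?_⟩
  have e : ∀ ψ : E n → ℝ, ∫ x in Y n, (0 : L2 n) x * ψ x = 0 := by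
    intro ψ
    rw [← integral_zero (E n) ℝ (μ := volume.restrict (Y n))]
    refine integral_congr_ae ?_
    filter_upwards [Lp.coeFn_zero ℝ 2 ((volume : Measure (E n)).restrict (Y n))] with x hx
    rw [hx]; simp
  rw [e, e, neg_zero]

/-- `H¹_per(Y)` as a linear subspace of `L²(Y)`. -/
def H1Per (n : ℕ) : Submodule ℝ (L2 n) where
  carrier := {u | MemH1Per u}
  add_mem' := by
    rintro u v ⟨G, hG, hu⟩ ⟨H, hH, hv⟩
    refine ⟨fun i => G i + H i, fun i => (hG i).add_L2 (hH i), fun ε hε => ?_⟩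
    obtain ⟨φ, f1, f2, f3, f4⟩ := hu (ε / 2) (by positivity)
    obtain ⟨ψ, g1, g2, g3, g4⟩ := hv (ε / 2) (by positivity)
    refine ⟨fun x => φ x + ψ x, f1.add g1, fun x z => ?_, ?_, fun i => ?_⟩
    · change φ _ + ψ _ = φ _ + ψ _
      rw [f2, g2]
    · exact L2.eLpNorm_add_sub_lt u v f1.continuous g1.continuous hε f3 g3
    · simp only [partialDeriv_add f1 g1]
      exact L2.eLpNorm_add_sub_lt (G i) (H i) (continuous_partialDeriv f1 i)
        (continuous_partialDeriv g1 i) hε (f4 i) (g4 i)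
  zero_mem' := by
    have e : eLpNorm (fun x => (0 : L2 n) x - (0 : ℝ)) 2 (volume.restrict (Y n)) = 0 := by
      rw [← eLpNorm_zero (α := E n) (ε := ℝ) (p := 2) (μ := volume.restrict (Y n))]
      refine eLpNorm_congr_ae ?_
      filter_upwards [Lp.coeFn_zero ℝ 2 ((volume : Measure (E n)).restrict (Y n))] with x hx
      rw [hx]; simp
    refine ⟨fun _ => 0, fun i => L2.isWeakPartial_zero i, fun ε hε => ?_⟩
    refine ⟨fun _ => 0, contDiff_const, fun _ _ => rfl, ?_, fun i => ?_⟩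
    · rw [e]; simpa using hε
    · have : ∀ x : E n, partialDeriv i (fun _ : E n => (0 : ℝ)) x = 0 := by
        intro x; simp [partialDeriv]
      simp only [this]
      rw [e]; simpa using hε
  smul_mem' := by
    rintro r u ⟨G, hG, hu⟩
    refine ⟨fun i => r • G i, fun i => (hG i).smul_L2 r, fun ε hε => ?_⟩
    obtain ⟨φ, f1, f2, f3, f4⟩ := hu (ε / (|r| + 1)) (by positivity)
    refine ⟨fun x => r * φ x, contDiff_const.mul f1, fun x z => ?_, ?_, fun i => ?_⟩
    · change r * φ _ = r * φ _
      rw [f2]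
    · exact L2.eLpNorm_smul_sub_lt u r hε f3
    · simp only [partialDeriv_const_mul f1]
      exact L2.eLpNorm_smul_sub_lt (G i) r hε (f4 i)

/-- The finite element space `Vˢ`: the discontinuous Galerkin space `V⁰` for `s = 0`, and the
`C⁰`-IP space `V¹ = V⁰ ∩ H¹_per(Y)` for `s = 1`. -/
def V {n : ℕ} (𝒯 : Mesh n) (p : ℕ) (s : Fin 2) : Submodule ℝ (L2 n) :=
  if s = 0 then V0 𝒯 p else V0 𝒯 p ⊓ H1Per n

/-- `F_γ[w]` for a piecewise smooth function `w`, with its piecewise derivatives. -/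
def pwFgamma {n : ℕ} {𝒜 ℬ : Type*} (P : Coeffs n 𝒜 ℬ) (lam : ℝ) (𝒯 : Mesh n) (w : E n → ℝ)
    (x : E n) : ℝ :=
  P.Fgamma lam x (w x) (𝒯.pwGrad w x) (𝒯.pwHess w x)

end PeriodicHJBI

end

/-! The argument is a nonlinear Céa lemma whose consistency term is controlled by the Cordes
condition.

Error estimate. For a discrete `v` put `z = v - uT`. Strong monotonicity and `a uT z = 0` bound the
squared norm of `z` by `CM * a v z`, and (A4) compares `a v z` with the integral of `F_γ[v]` against
`LT z`. Multiplying by the positive bounded factor `γ` does not change the vanishing of an inf-sup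
(`iInf_iSup_mul_eq_zero`), so `F_γ[u] = 0`. Hence `F_γ[v]` is a difference of two values of `F_γ`.
Under the Cordes condition `F_γ` is pointwise Lipschitz in the weighted second-order jet with
constant `√(1-δ) + √(n+1)` (`abs_gamma_mul_le`, `abs_Fgamma_sub_le`): the part of the rescaled
linear operators that deviates from `-Δ + λ` contributes `√(1-δ)`, and `-Δ + λ` itself contributes
`√(n+1)`. The remaining term of (A4) contains the jumps of `v`, which are those of `u - v` because
`u` has none. The triangle inequality finishes the estimate.

Existence and uniqueness. On the finite-dimensional space `V`, the `L²`-norm and the mesh norm bound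
each other up to constants (`exists_dgNorm_le`, `sq_mul_norm_sq_le`). Assumptions (A2) and (A3)
therefore become strong monotonicity and Lipschitz continuity in the Hilbert space `L²`, and the
Banach fixed point theorem applies.

What remains is to know that the mesh norm satisfies the triangle inequality on discrete functions
and `H²_per` functions together. Weak derivatives and traces are chosen representatives, so their
linearity has to be derived almost everywhere. For traces this rests on uniqueness, which follows
from a trace inequality in `L¹` on the facets of a simplex (`IsConeBase.trace_inequality`), obtained
by integrating along segments from the facet towards the opposite vertex. The class `IsRegular`
collects what is needed; it is stable under linear combinations and contains the piecewise
polynomials and `H²_per(Y)`. Functions of the latter kind have no jumps, since one sequence of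
smooth periodic functions approximates them on both sides of every face. -/

namespace PeriodicHJBI

/-! ### The trace inequality on a face of a convex body -/

/-- `S` is a compact piece of a hyperplane, contained in the convex set `K`, which also contains
a point `p₀` off the hyperplane. The vector `v` is normal to the hyperplane and points to `p₀`. -/
structure IsConeBase {n : ℕ} (K S : Set (E n)) (p₀ q v : E n) : Prop where
  convex : Convex ℝ K
  isCompact : IsCompact K
  apex_mem : p₀ ∈ K
  base_subset : S ⊆ K
  base_compact : IsCompact S
  normal_ne : v ≠ 0
  base_orth : ∀ y ∈ S, inner ℝ v (y - q) = 0
  apex_inner : inner ℝ v (p₀ - q) = inner ℝ v v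

theorem IsConeBase.hom_mem {n : ℕ} {K S : Set (E n)} {p₀ q v : E n} (h : IsConeBase K S p₀ q v)
    {y : E n} (hy : y ∈ S) {t : ℝ} (ht : t ∈ Icc (0 : ℝ) (1 / 2)) :
    y + t • (p₀ - y) ∈ K :=
  h.convex.add_smul_sub_mem (h.base_subset hy) h.apex_mem ⟨ht.1, by linarith [ht.2]⟩

/-- The homothety with centre `p₀` and ratio `1 - t` carries the base into the slice of `K` at
height `t`. It scales the surface measure by `(1 - t)^(n-1)`, and stopping at `t = 1/2` keeps this
factor above `2^(-(n-1))`. -/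
theorem IsConeBase.measure_slice_le {n : ℕ} {K S : Set (E n)} {p₀ q v : E n}
    (h : IsConeBase K S p₀ q v) {t : ℝ} (ht : t ∈ Icc (0 : ℝ) (1 / 2)) (B : Set (E n)) :
    surf S {y | y + t • (p₀ - y) ∈ B} ≤
      2 ^ (n - 1) * (Measure.euclideanHausdorffMeasure (n - 1) : Measure (E n))
        ((B ∩ K) ∩ AffineSubspace.mk' (t • v +ᵥ q) (Submodule.span ℝ {v})ᗮ) := by
  have hc : (1 - t : ℝ) ≠ 0 := by linarith [ht.2]
  have hc' : (1 / 2 : ℝ) ≤ 1 - t := by linarith [ht.2]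
  have hom : ∀ y : E n, AffineMap.homothety p₀ (1 - t) y = y + t • (p₀ - y) := by
    intro y
    rw [AffineMap.homothety_apply]
    simp only [vsub_eq_sub, vadd_eq_add]
    module
  set μ := (Measure.euclideanHausdorffMeasure (n - 1) : Measure (E n))
  have hS : MeasurableSet S := h.base_compact.measurableSet
  have e1 : surf S {y | y + t • (p₀ - y) ∈ B} = μ ({y | y + t • (p₀ - y) ∈ B} ∩ S) :=
    Measure.restrict_apply' hS
  have e2 : AffineMap.homothety p₀ (1 - t) '' ({y | y + t • (p₀ - y) ∈ B} ∩ S) ⊆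
      (B ∩ K) ∩ AffineSubspace.mk' (t • v +ᵥ q) (Submodule.span ℝ {v})ᗮ := by
    rintro _ ⟨y, ⟨hyB, hyS⟩, rfl⟩
    rw [hom]
    refine ⟨⟨hyB, h.hom_mem hyS ht⟩, ?_⟩
    rw [SetLike.mem_coe, AffineSubspace.mem_mk', Submodule.mem_orthogonal_singleton_iff_inner_right]
    have : y + t • (p₀ - y) -ᵥ (t • v +ᵥ q) = (1 - t) • (y - q) + t • (p₀ - q) - t • v := by
      simp only [vsub_eq_sub, vadd_eq_add]; module
    rw [this, inner_sub_right, inner_add_right, inner_smul_right, inner_smul_right,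
      inner_smul_right, h.base_orth y hyS, h.apex_inner]
    ring
  have e3 := euclideanHausdorffMeasure_homothety_image (n - 1) p₀ hc
    ({y | y + t • (p₀ - y) ∈ B} ∩ S)
  have e4 : μ ({y | y + t • (p₀ - y) ∈ B} ∩ S) ≤ 2 ^ (n - 1) *
      (‖(1 - t : ℝ)‖₊ ^ (n - 1) • μ ({y | y + t • (p₀ - y) ∈ B} ∩ S)) := by
    rw [ENNReal.smul_def, smul_eq_mul, ← mul_assoc]
    refine le_mul_of_one_le_left (by positivity) ?_
    rw [ENNReal.coe_pow, ← mul_pow]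
    refine one_le_pow₀ ?_
    have : (1 : NNReal) ≤ 2 * ‖(1 - t : ℝ)‖₊ := by
      rw [← NNReal.coe_le_coe]
      push_cast
      rw [Real.norm_of_nonneg (by linarith)]
      linarith
    exact_mod_cast this
  rw [e1]
  refine e4.trans ?_
  rw [← e3]
  gcongr

/-- Cavalieri's principle: the volume of `B ∩ K` is `‖v‖` times the integral over `t` of its slices
orthogonal to `v`. -/
theorem IsConeBase.lintegral_slice_le {n : ℕ} {K S : Set (E n)} {p₀ q v : E n}
    (h : IsConeBase K S p₀ q v) {B : Set (E n)} (hB : MeasurableSet B) :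
    ∫⁻ t in Icc (0 : ℝ) (1 / 2), surf S {y | y + t • (p₀ - y) ∈ B} ≤
      2 ^ (n - 1) * ‖v‖ₑ⁻¹ * volume (B ∩ K) := by
  have hK := h.isCompact.measurableSet
  have hv0 : ‖v‖ₑ ≠ 0 := by simpa using h.normal_ne
  have hvt : ‖v‖ₑ ≠ ⊤ := by simp
  have key := EuclideanGeometry.euclideanHausdorffMeasure_eq_lintegral q h.normal_ne
    (hB.inter hK)
  rw [InnerProductSpace.euclideanHausdorffMeasure_eq_volume] at key
  simp only [finrank_euclideanSpace, Fintype.card_fin] at key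
  calc _ ≤ ∫⁻ t in Icc (0 : ℝ) (1 / 2), 2 ^ (n - 1) *
        (Measure.euclideanHausdorffMeasure (n - 1) : Measure (E n))
        ((B ∩ K) ∩ AffineSubspace.mk' (t • v +ᵥ q) (Submodule.span ℝ {v})ᗮ) :=
        setLIntegral_mono' measurableSet_Icc fun t ht => h.measure_slice_le ht B
    _ ≤ ∫⁻ t : ℝ, 2 ^ (n - 1) *
        (Measure.euclideanHausdorffMeasure (n - 1) : Measure (E n))
        ((B ∩ K) ∩ AffineSubspace.mk' (t • v +ᵥ q) (Submodule.span ℝ {v})ᗮ) :=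
        setLIntegral_le_lintegral _ _
    _ = 2 ^ (n - 1) * ‖v‖ₑ⁻¹ * volume (B ∩ K) := by
        rw [lintegral_const_mul' _ _ (by finiteness), key, mul_assoc, ← mul_assoc (‖v‖ₑ⁻¹),
          ENNReal.inv_mul_cancel hv0 hvt, one_mul]

/-- With `B = univ` the slice estimate bounds half of the area of `S` by a multiple of the finite
volume of `K`. -/
theorem IsConeBase.isFiniteMeasure_surf {n : ℕ} {K S : Set (E n)} {p₀ q v : E n}
    (h : IsConeBase K S p₀ q v) : IsFiniteMeasure (surf S) := by
  have h1 := h.lintegral_slice_le MeasurableSet.univ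
  have hv0 : ‖v‖ₑ ≠ 0 := by simpa using h.normal_ne
  simp only [mem_univ, ofPred_true, univ_inter, setLIntegral_const, Real.volume_Icc] at h1
  have h2 : 2 ^ (n - 1) * ‖v‖ₑ⁻¹ * volume K < ⊤ := by
    have := h.isCompact.measure_lt_top (μ := volume)
    have : ‖v‖ₑ⁻¹ < ⊤ := by simpa [ENNReal.inv_lt_top, pos_iff_ne_zero] using hv0
    finiteness
  have h3 := h1.trans_lt h2
  refine ⟨?_⟩
  by_contra hc
  rw [not_lt, top_le_iff] at hc
  rw [hc, ENNReal.top_mul (by norm_num)] at h3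
  exact lt_irrefl _ h3

/-- The slice estimate says that the product of surface and Lebesgue measure, pushed forward along
the segments towards the apex, is dominated by a multiple of the volume on `K`. Tonelli turns this
domination into an inequality of integrals. -/
theorem IsConeBase.lintegral_cone_le {n : ℕ} {K S : Set (E n)} {p₀ q v : E n}
    (h : IsConeBase K S p₀ q v) {G : E n → ℝ≥0∞} (hG : Measurable G) :
    ∫⁻ y, (∫⁻ t in Icc (0 : ℝ) (1 / 2), G (y + t • (p₀ - y))) ∂(surf S) ≤
      2 ^ (n - 1) * ‖v‖ₑ⁻¹ * ∫⁻ x in K, G x := by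
  have := h.isFiniteMeasure_surf
  have hm : Measurable fun z : E n × ℝ => z.1 + z.2 • (p₀ - z.1) := by fun_prop
  have hle : ((surf S).prod (volume.restrict (Icc (0 : ℝ) (1 / 2)))).map
      (fun z : E n × ℝ => z.1 + z.2 • (p₀ - z.1)) ≤
      (2 ^ (n - 1) * ‖v‖ₑ⁻¹) • (volume : Measure (E n)).restrict K := by
    refine Measure.le_iff.2 fun B hB => ?_
    rw [Measure.map_apply hm hB, Measure.prod_apply_symm (hm hB), Measure.smul_apply,
      Measure.restrict_apply hB, smul_eq_mul]
    exact h.lintegral_slice_le hB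
  rw [← smul_eq_mul, ← lintegral_smul_measure]
  calc _ = ∫⁻ z : E n × ℝ, G (z.1 + z.2 • (p₀ - z.1))
        ∂((surf S).prod (volume.restrict (Icc (0 : ℝ) (1 / 2)))) :=
        (lintegral_prod _ (hG.comp hm).aemeasurable).symm
    _ = ∫⁻ x, G x ∂(((surf S).prod (volume.restrict (Icc (0 : ℝ) (1 / 2)))).map
      (fun z : E n × ℝ => z.1 + z.2 • (p₀ - z.1))) := (lintegral_map hG hm).symm
    _ ≤ _ := lintegral_mono' hle le_rfl

theorem unitVec_sum {n : ℕ} (d : E n) : d = ∑ i, d i • unitVec i := by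
  ext j
  simp [unitVec, Finset.sum_apply, Pi.single_apply]

theorem abs_fderiv_le_sum_partialDeriv {n : ℕ} (g : E n → ℝ) (x d : E n) :
    |fderiv ℝ g x d| ≤ ‖d‖ * ∑ i, |partialDeriv i g x| := by
  conv_lhs => rw [unitVec_sum d, map_sum]
  refine (Finset.abs_sum_le_sum_abs _ _).trans ?_
  rw [Finset.mul_sum]
  refine Finset.sum_le_sum fun i _ => ?_
  rw [map_smul, smul_eq_mul, abs_mul]
  exact mul_le_mul_of_nonneg_right (PiLp.norm_apply_le d i) (abs_nonneg _)

/-- The value at the start of a path in terms of the values and derivatives along the path. -/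
theorem abs_zero_le_integral {φ φ' : ℝ → ℝ} (hφ : ∀ t, HasDerivAt φ (φ' t) t)
    (hc : Continuous φ') :
    |φ 0| ≤ ∫ t in (0 : ℝ)..1 / 2, (2 * |φ t| + |φ' t|) := by
  have hφc : Continuous φ := continuous_iff_continuousAt.2 fun t => (hφ t).continuousAt
  have i1 : IntervalIntegrable (fun t => |φ t|) volume 0 (1 / 2) :=
    hφc.abs.intervalIntegrable _ _
  have i2 : IntervalIntegrable (fun t => |φ' t|) volume 0 (1 / 2) :=
    hc.abs.intervalIntegrable _ _
  have h1 : ∀ t ∈ Icc (0 : ℝ) (1 / 2), |φ 0| ≤ |φ t| + ∫ s in (0 : ℝ)..1 / 2, |φ' s| := by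
    intro t ht
    have e := intervalIntegral.integral_eq_sub_of_hasDerivAt (a := 0) (b := t)
      (fun s _ => hφ s) (hc.intervalIntegrable _ _)
    have e1 : |∫ s in (0 : ℝ)..t, φ' s| ≤ ∫ s in (0 : ℝ)..t, |φ' s| :=
      intervalIntegral.abs_integral_le_integral_abs ht.1
    have e2 : ∫ s in (0 : ℝ)..t, |φ' s| ≤ ∫ s in (0 : ℝ)..1 / 2, |φ' s| :=
      intervalIntegral.integral_mono_interval le_rfl ht.1 ht.2
        (Eventually.of_forall fun _ => abs_nonneg _) i2
    have e3 : φ 0 = φ t - ∫ s in (0 : ℝ)..t, φ' s := by rw [e]; ring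
    calc |φ 0| ≤ |φ t| + |∫ s in (0 : ℝ)..t, φ' s| := by rw [e3]; exact abs_sub _ _
      _ ≤ _ := by linarith
  -- Averaging `h1` over an interval of length `1/2` produces the factor `2` in front of `|φ t|`.
  have h2 := intervalIntegral.integral_mono_on (by norm_num : (0 : ℝ) ≤ 1 / 2)
    (continuous_const.intervalIntegrable (μ := volume) _ _)
    (i1.add (continuous_const.intervalIntegrable (μ := volume) _ _)) h1
  rw [intervalIntegral.integral_add i1 (continuous_const.intervalIntegrable _ _),
    intervalIntegral.integral_const, intervalIntegral.integral_const] at h2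
  rw [intervalIntegral.integral_add (i1.const_mul 2) i2, intervalIntegral.integral_const_mul]
  simp only [smul_eq_mul] at h2
  linarith

/-- The trace inequality: the `L¹`-norm on the face is controlled by the `W^{1,1}`-norm. -/
theorem IsConeBase.trace_inequality {n : ℕ} {K S : Set (E n)} {p₀ q v : E n}
    (h : IsConeBase K S p₀ q v) :
    ∃ C : ℝ≥0∞, C ≠ ⊤ ∧ ∀ g : E n → ℝ, ContDiff ℝ ∞ g →
      eLpNorm g 1 (surf S) ≤ C * (eLpNorm g 1 (volume.restrict K) +
        ∑ i, eLpNorm (partialDeriv i g) 1 (volume.restrict K)) := by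
  obtain ⟨R, hR⟩ : ∃ R : ℝ, ∀ y ∈ S, ‖p₀ - y‖ ≤ R := by
    obtain ⟨R, hR⟩ :=
      (h.base_compact.image (f := fun y => p₀ - y) (by fun_prop)).isBounded.exists_norm_le
    exact ⟨R, fun y hy => hR _ ⟨y, hy, rfl⟩⟩
  -- One constant for both terms of `abs_zero_le_integral`: `2` for the values, and a bound on `‖p₀
  -- - y‖` for the derivative along the segment.
  set R' : ℝ := max R 2
  have hR2 : 2 ≤ R' := le_max_right _ _
  have hv0 : ‖v‖ₑ ≠ 0 := by simpa using h.normal_ne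
  have hfin : ‖v‖ₑ⁻¹ < ⊤ := by simpa [ENNReal.inv_lt_top, pos_iff_ne_zero] using hv0
  refine ⟨2 ^ (n - 1) * ‖v‖ₑ⁻¹ * ENNReal.ofReal R', by finiteness, fun g hg => ?_⟩
  have hgc : Continuous g := hg.continuous
  have hpc : ∀ i, Continuous (partialDeriv i g) := continuous_partialDeriv hg
  set G : E n → ℝ := fun x => R' * (|g x| + ∑ i, |partialDeriv i g x|)
  have hGc : Continuous G := by
    refine continuous_const.mul (hgc.abs.add ?_)
    exact continuous_finsetSum _ fun i _ => (hpc i).abs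
  have hG0 : ∀ x, 0 ≤ G x := fun x => by
    have : 0 ≤ ∑ i, |partialDeriv i g x| := Finset.sum_nonneg fun i _ => abs_nonneg _
    have := abs_nonneg (g x)
    positivity
  have hpt : ∀ y ∈ S, ‖g y‖ₑ ≤
      ∫⁻ t in Icc (0 : ℝ) (1 / 2), ENNReal.ofReal (G (y + t • (p₀ - y))) := by
    intro y hy
    have hd : ∀ t : ℝ, HasDerivAt (fun t : ℝ => g (y + t • (p₀ - y)))
        (fderiv ℝ g (y + t • (p₀ - y)) (p₀ - y)) t := by
      intro t
      have h1 : HasDerivAt (fun t : ℝ => y + t • (p₀ - y)) (p₀ - y) t := by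
        simpa using ((hasDerivAt_id t).smul_const (p₀ - y)).const_add y
      exact ((hg.differentiable (by simp)) _).hasFDerivAt.comp_hasDerivAt t h1
    have hdc : Continuous fun t : ℝ => fderiv ℝ g (y + t • (p₀ - y)) (p₀ - y) :=
      ((hg.continuous_fderiv (by simp)).comp (by fun_prop)).clm_apply continuous_const
    have h1 := abs_zero_le_integral hd hdc
    simp only [zero_smul, add_zero] at h1
    have hlc : Continuous fun t : ℝ => y + t • (p₀ - y) := by fun_prop
    have h2 : |g y| ≤ ∫ t in Icc (0 : ℝ) (1 / 2), G (y + t • (p₀ - y)) := by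
      rw [integral_Icc_eq_integral_Ioc, ← intervalIntegral.integral_of_le (by norm_num)]
      refine h1.trans (intervalIntegral.integral_mono_on (by norm_num) ?_ ?_ ?_)
      · exact ((continuous_const.mul (hgc.comp hlc).abs).add hdc.abs).intervalIntegrable _ _
      · exact (hGc.comp hlc).intervalIntegrable _ _
      · intro t _
        have e1 := abs_fderiv_le_sum_partialDeriv g (y + t • (p₀ - y)) (p₀ - y)
        have e2 : ‖p₀ - y‖ ≤ R' := (hR y hy).trans (le_max_left _ _)
        have e3 : 0 ≤ ∑ i, |partialDeriv i g (y + t • (p₀ - y))| :=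
          Finset.sum_nonneg fun i _ => abs_nonneg _
        have e4 := mul_le_mul_of_nonneg_right e2 e3
        have e5 := mul_le_mul_of_nonneg_right hR2 (abs_nonneg (g (y + t • (p₀ - y))))
        simp only [G]
        linarith
    rw [← ofReal_integral_eq_lintegral_ofReal
      (f := fun t => G (y + t • (p₀ - y)))
      (((hGc.comp hlc).continuousOn).integrableOn_Icc) (Eventually.of_forall fun _ => hG0 _),
      ← ofReal_norm]
    exact ENNReal.ofReal_le_ofReal h2
  have hSm : MeasurableSet S := h.base_compact.measurableSet
  rw [eLpNorm_one_eq_lintegral_enorm]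
  calc ∫⁻ y, ‖g y‖ₑ ∂(surf S)
      ≤ ∫⁻ y, (∫⁻ t in Icc (0 : ℝ) (1 / 2), ENNReal.ofReal (G (y + t • (p₀ - y)))) ∂(surf S) :=
        setLIntegral_mono' hSm hpt
    _ ≤ 2 ^ (n - 1) * ‖v‖ₑ⁻¹ * ∫⁻ x in K, ENNReal.ofReal (G x) :=
        h.lintegral_cone_le hGc.measurable.ennreal_ofReal
    _ = 2 ^ (n - 1) * ‖v‖ₑ⁻¹ * ∫⁻ x in K, ENNReal.ofReal R' *
          (‖g x‖ₑ + ∑ i, ‖partialDeriv i g x‖ₑ) := by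
        congr 1
        refine lintegral_congr fun x => ?_
        simp only [G]
        rw [ENNReal.ofReal_mul (by linarith), ENNReal.ofReal_add (abs_nonneg _)
          (Finset.sum_nonneg fun i _ => abs_nonneg _),
          ENNReal.ofReal_sum_of_nonneg fun i _ => abs_nonneg _]
        simp only [Real.enorm_eq_ofReal_abs]
    _ = _ := by
        rw [lintegral_const_mul' _ _ (by finiteness), lintegral_add_left hgc.measurable.enorm,
          lintegral_finsetSum _ fun i _ => (hpc i).measurable.enorm, ← mul_assoc]
        simp only [eLpNorm_one_eq_lintegral_enorm]

end PeriodicHJBI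

namespace PeriodicHJBI

/-! ### Weak partial derivatives -/

variable {n : ℕ}

theorem integrable_mul_of_tsupport_subset {Ω : Set (E n)} {w φ : E n → ℝ}
    (hw : LocallyIntegrableOn w Ω) (hφ : Continuous φ) (hc : HasCompactSupport φ)
    (hs : tsupport φ ⊆ Ω) : Integrable fun x => w x * φ x := by
  have h1 : IntegrableOn w (tsupport φ) := hw.integrableOn_compact_subset hs hc.isCompact
  have h2 : IntegrableOn (fun x => w x * φ x) (tsupport φ) :=
    h1.mul_continuousOn hφ.continuousOn hc.isCompact
  refine (integrableOn_iff_integrable_of_support_subset ?_).1 h2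
  intro x hx
  by_contra hx'
  exact hx (by simp [image_eq_zero_of_notMem_tsupport hx'])

theorem tsupport_partialDeriv_subset (i : Fin n) (φ : E n → ℝ) :
    tsupport (partialDeriv i φ) ⊆ tsupport φ := by
  refine (closure_mono ?_).trans (tsupport_fderiv_subset ℝ (f := φ))
  intro x hx hx'
  exact hx (by simp [partialDeriv, hx'])

theorem setIntegral_mul_eq_integral {Ω : Set (E n)} {w φ : E n → ℝ} (hs : tsupport φ ⊆ Ω) :
    ∫ x in Ω, w x * φ x = ∫ x, w x * φ x :=
  setIntegral_eq_integral_of_forall_compl_eq_zero fun x hx => by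
    simp [image_eq_zero_of_notMem_tsupport fun h => hx (hs h)]

/-- The fundamental lemma of the calculus of variations, applied to `g - g'`. -/
theorem IsWeakPartial.ae_eq {Ω : Set (E n)} (hΩ : IsOpen Ω) {i : Fin n} {w g g' : E n → ℝ}
    (h : IsWeakPartial Ω i w g) (h' : IsWeakPartial Ω i w g') :
    g =ᵐ[volume.restrict Ω] g' := by
  have h0 := hΩ.ae_eq_zero_of_integral_contDiff_smul_eq_zero (μ := volume)
    (h.2.1.sub h'.2.1) (by
      intro φ h1 h2 h3
      have i1 := integrable_mul_of_tsupport_subset h.2.1 h1.continuous h2 h3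
      have i2 := integrable_mul_of_tsupport_subset h'.2.1 h1.continuous h2 h3
      have e1 := h.2.2 φ h1 h2 h3
      have e2 := h'.2.2 φ h1 h2 h3
      rw [e1, neg_inj, setIntegral_mul_eq_integral h3, setIntegral_mul_eq_integral h3] at e2
      calc ∫ x, φ x • (g - g') x = ∫ x, (g x * φ x - g' x * φ x) := by
            refine integral_congr_ae (Eventually.of_forall fun x => ?_)
            simp only [Pi.sub_apply, smul_eq_mul]; ring
        _ = 0 := by rw [integral_sub i1 i2, e2, sub_self])
  rw [Filter.EventuallyEq, ae_restrict_iff' hΩ.measurableSet]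
  filter_upwards [h0] with x hx hxΩ
  exact sub_eq_zero.1 (hx hxΩ)

theorem IsWeakPartial.congr {Ω : Set (E n)} {i : Fin n} {w w' g g' : E n → ℝ}
    (h : IsWeakPartial Ω i w g) (hw : w =ᵐ[volume.restrict Ω] w')
    (hg : g =ᵐ[volume.restrict Ω] g') : IsWeakPartial Ω i w' g' := by
  refine ⟨h.1.congr hw, h.2.1.congr hg, fun φ h1 h2 h3 => ?_⟩
  have e : ∀ {a b : E n → ℝ} (ψ : E n → ℝ), a =ᵐ[volume.restrict Ω] b →
      ∫ x in Ω, a x * ψ x = ∫ x in Ω, b x * ψ x := fun ψ hab =>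
    integral_congr_ae (hab.mono fun x hx => by simp only [hx])
  rw [← e _ hw, ← e _ hg]
  exact h.2.2 φ h1 h2 h3

/-- The equality is literal, not only almost everywhere: the representative is chosen from the
predicate `IsWeakPartial Ω i w`, and this predicate does not see changes of `w` on null sets. -/
theorem weakPartial_congr {Ω : Set (E n)} (i : Fin n) {w w' : E n → ℝ}
    (hw : w =ᵐ[volume.restrict Ω] w') : weakPartial Ω i w = weakPartial Ω i w' := by
  have : IsWeakPartial Ω i w = IsWeakPartial Ω i w' := by
    funext g
    exact propext ⟨fun h => h.congr hw EventuallyEq.rfl, fun h => h.congr hw.symm EventuallyEq.rfl⟩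
  unfold weakPartial
  generalize IsWeakPartial Ω i w = a at this
  subst this
  rfl

theorem IsWeakPartial.isWeakPartial_weakPartial {Ω : Set (E n)} {i : Fin n} {w g : E n → ℝ}
    (h : IsWeakPartial Ω i w g) : IsWeakPartial Ω i w (weakPartial Ω i w) := by
  have : ∃ g, IsWeakPartial Ω i w g := ⟨g, h⟩
  rw [weakPartial, dif_pos this]
  exact this.choose_spec

theorem IsWeakPartial.weakPartial_ae_eq {Ω : Set (E n)} (hΩ : IsOpen Ω) {i : Fin n}
    {w g : E n → ℝ} (h : IsWeakPartial Ω i w g) :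
    weakPartial Ω i w =ᵐ[volume.restrict Ω] g :=
  h.isWeakPartial_weakPartial.ae_eq hΩ h

theorem aestronglyMeasurable_weakPartial {Ω : Set (E n)} (i : Fin n) (w : E n → ℝ) :
    AEStronglyMeasurable (weakPartial Ω i w) (volume.restrict Ω) := by
  by_cases h : ∃ g, IsWeakPartial Ω i w g
  · exact h.choose_spec.isWeakPartial_weakPartial.2.1.aestronglyMeasurable
  · rw [weakPartial, dif_neg h]
    exact aestronglyMeasurable_zero

/-- A test function for `Ω'` is one for `Ω`, and both integrals equal the integral over the whole
space. -/
theorem IsWeakPartial.mono {Ω Ω' : Set (E n)} {i : Fin n} {w g : E n → ℝ} (hsub : Ω' ⊆ Ω)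
    (h : IsWeakPartial Ω i w g) : IsWeakPartial Ω' i w g := by
  refine ⟨h.1.mono_set hsub, h.2.1.mono_set hsub, fun φ h1 h2 h3 => ?_⟩
  have h4 := (tsupport_partialDeriv_subset i φ).trans h3
  have := h.2.2 φ h1 h2 (h3.trans hsub)
  rwa [setIntegral_mul_eq_integral (h4.trans hsub), setIntegral_mul_eq_integral (h3.trans hsub),
    ← setIntegral_mul_eq_integral h4, ← setIntegral_mul_eq_integral h3] at this

theorem IsWeakPartial.comb {Ω : Set (E n)} {i : Fin n} {w w' g g' : E n → ℝ}
    (r r' : ℝ) (h : IsWeakPartial Ω i w g) (h' : IsWeakPartial Ω i w' g') :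
    IsWeakPartial Ω i (fun x => r * w x + r' * w' x) (fun x => r * g x + r' * g' x) := by
  refine ⟨(h.1.smul r).add (h'.1.smul r'), (h.2.1.smul r).add (h'.2.1.smul r'), fun φ h1 h2 h3 => ?_⟩
  have d1 := continuous_partialDeriv h1 i
  have d2 := hasCompactSupport_partialDeriv h2 i
  have d3 := (tsupport_partialDeriv_subset i φ).trans h3
  have key : ∀ (a b ψ : E n → ℝ), LocallyIntegrableOn a Ω → LocallyIntegrableOn b Ω →
      Continuous ψ → HasCompactSupport ψ → tsupport ψ ⊆ Ω →
      ∫ x in Ω, (r * a x + r' * b x) * ψ x = r * (∫ x in Ω, a x * ψ x) + r' * ∫ x in Ω, b x * ψ x := by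
    intro a b ψ ha hb k1 k2 k3
    have i1 := (integrable_mul_of_tsupport_subset ha k1 k2 k3).restrict (s := Ω)
    have i2 := (integrable_mul_of_tsupport_subset hb k1 k2 k3).restrict (s := Ω)
    rw [← integral_const_mul, ← integral_const_mul,
      ← integral_add (i1.const_mul r) (i2.const_mul r')]
    refine integral_congr_ae (Eventually.of_forall fun x => ?_)
    ring
  rw [key w w' _ h.1 h'.1 d1 d2 d3, key g g' _ h.2.1 h'.2.1 h1.continuous h2 h3,
    h.2.2 φ h1 h2 h3, h'.2.2 φ h1 h2 h3]
  ring

theorem isWeakPartial_of_contDiff {Ω : Set (E n)} (i : Fin n) {P : E n → ℝ}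
    (hP : ContDiff ℝ ∞ P) : IsWeakPartial Ω i P (partialDeriv i P) := by
  have hPi := continuous_partialDeriv hP i
  refine ⟨hP.continuous.locallyIntegrable.locallyIntegrableOn _,
    hPi.locallyIntegrable.locallyIntegrableOn _, fun φ h1 h2 h3 => ?_⟩
  rw [setIntegral_mul_eq_integral ((tsupport_partialDeriv_subset i φ).trans h3),
    setIntegral_mul_eq_integral h3]
  have d1 := continuous_partialDeriv h1 i
  have d2 := hasCompactSupport_partialDeriv h2 i
  exact integral_mul_fderiv_eq_neg_fderiv_mul_of_integrable
    ((hPi.mul h1.continuous).integrable_of_hasCompactSupport h2.mul_left)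
    ((hP.continuous.mul d1).integrable_of_hasCompactSupport d2.mul_left)
    ((hP.continuous.mul h1.continuous).integrable_of_hasCompactSupport h2.mul_left)
    (fun x _ => hP.differentiable (by simp) x) (fun x _ => h1.differentiable (by simp) x)

theorem contDiff_partialDeriv {φ : E n → ℝ} (hφ : ContDiff ℝ ∞ φ) (i : Fin n) :
    ContDiff ℝ ∞ (partialDeriv i φ) :=
  (hφ.fderiv_right (m := ∞) (by simp)).clm_apply contDiff_const

theorem IsPeriodic.partialDeriv {φ : E n → ℝ} (hφ : IsPeriodic φ) (i : Fin n) :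
    IsPeriodic (partialDeriv i φ) := by
  intro x z
  have h : (fun y => φ (y + latticeVec z)) = φ := funext fun y => hφ y z
  unfold PeriodicHJBI.partialDeriv
  rw [← fderiv_comp_add_right, h]

/-! ### Traces -/

theorem memLp_surf {S : Set (E n)} (hS : IsCompact S) [IsFiniteMeasure (surf S)] {g : E n → ℝ}
    (hg : Continuous g) (p : ℝ≥0∞) : MemLp g p (surf S) := by
  obtain ⟨C, hC⟩ := hS.exists_bound_of_continuousOn hg.continuousOn
  refine MemLp.of_bound hg.aestronglyMeasurable C ?_
  exact (ae_restrict_iff' hS.measurableSet).2 (Eventually.of_forall hC)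

theorem IsTrace.congr {Ω S : Set (E n)} {w w' τ : E n → ℝ} (h : IsTrace Ω S w τ)
    (hw : w =ᵐ[volume.restrict Ω] w') : IsTrace Ω S w' τ := by
  obtain ⟨m, g, g0, g1, g2, g3⟩ := h
  refine ⟨m, g, g0, g1.congr fun k => eLpNorm_congr_ae ?_, fun i => ?_, g3⟩
  · filter_upwards [hw] with x hx
    rw [hx]
  · rw [← weakPartial_congr i hw]
    exact g2 i

/-- As with weak derivatives, the trace is chosen from a predicate that depends only on the
almost-everywhere class of `w`, so the chosen functions coincide. -/
theorem trace_congr {Ω S : Set (E n)} {w w' : E n → ℝ} (hw : w =ᵐ[volume.restrict Ω] w') :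
    trace Ω S w = trace Ω S w' := by
  have : IsTrace Ω S w = IsTrace Ω S w' :=
    funext fun τ => propext ⟨fun h => h.congr hw, fun h => h.congr hw.symm⟩
  unfold trace
  generalize IsTrace Ω S w = a at this
  subst this
  rfl

theorem IsTrace.isTrace_trace {Ω S : Set (E n)} {w τ : E n → ℝ} (h : IsTrace Ω S w τ) :
    IsTrace Ω S w (trace Ω S w) := by
  have : ∃ τ, IsTrace Ω S w τ := ⟨τ, h⟩
  rw [trace, dif_pos this]
  exact this.choose_spec

theorem eLpNorm_sub_le_sub {μ : Measure (E n)} {a b c : E n → ℝ}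
    (ha : AEStronglyMeasurable a μ) (hb : AEStronglyMeasurable b μ)
    (hc : AEStronglyMeasurable c μ) :
    eLpNorm (fun x => a x - b x) 1 μ ≤
      eLpNorm (fun x => a x - c x) 1 μ + eLpNorm (fun x => b x - c x) 1 μ := by
  have e : (fun x => a x - b x) = (fun x => a x - c x) - fun x => b x - c x := by
    funext x; simp
  rw [e]
  exact eLpNorm_sub_le (ha.sub hc) (hb.sub hc) le_rfl

theorem tendsto_zero_of_le_add {a b c : ℕ → ℝ≥0∞} (h : ∀ k, a k ≤ b k + c k)
    (hb : Tendsto b atTop (𝓝 0)) (hc : Tendsto c atTop (𝓝 0)) : Tendsto a atTop (𝓝 0) :=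
  tendsto_of_tendsto_of_tendsto_of_le_of_le tendsto_const_nhds
    (by simpa using hb.add hc) (fun _ => zero_le) h

theorem partialDeriv_sub {φ ψ : E n → ℝ} (hφ : ContDiff ℝ ∞ φ) (hψ : ContDiff ℝ ∞ ψ)
    (i : Fin n) (x : E n) :
    partialDeriv i (fun y => φ y - ψ y) x = partialDeriv i φ x - partialDeriv i ψ x := by
  have h1 : DifferentiableAt ℝ φ x := (hφ.differentiable (by simp)) x
  have h2 : DifferentiableAt ℝ ψ x := (hψ.differentiable (by simp)) x
  simp only [partialDeriv]
  rw [fderiv_fun_sub h1 h2]; rfl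

/-- The `L¹(S)`-norm of smooth functions is controlled by their `W^{1,1}(Ω)`-norm. -/
def HasTraceInequality (Ω S : Set (E n)) : Prop :=
  ∃ C : ℝ≥0∞, C ≠ ⊤ ∧ ∀ g : E n → ℝ, ContDiff ℝ ∞ g →
    eLpNorm g 1 (surf S) ≤ C * (eLpNorm g 1 (volume.restrict Ω) +
      ∑ i, eLpNorm (partialDeriv i g) 1 (volume.restrict Ω))

/-- Apply the trace inequality to `g k - g' k`. The filter is arbitrary because two uses are
intended: along `ℕ` for uniqueness of traces, along `ℕ × ℕ` for the Cauchy property that gives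
existence. -/
theorem HasTraceInequality.tendsto {Ω S : Set (E n)} (h : HasTraceInequality Ω S)
    {w w' : E n → ℝ} {ι : Type*} {l : Filter ι} {g g' : ι → E n → ℝ}
    (hw : AEStronglyMeasurable w (volume.restrict Ω))
    (hg : ∀ k, ContDiff ℝ ∞ (g k)) (hg' : ∀ k, ContDiff ℝ ∞ (g' k))
    (h0 : Tendsto (fun k => eLpNorm (fun x => g k x - w x) 1 (volume.restrict Ω)) l (𝓝 0))
    (h0' : Tendsto (fun k => eLpNorm (fun x => g' k x - w x) 1 (volume.restrict Ω)) l (𝓝 0))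
    (h1 : ∀ i, Tendsto (fun k => eLpNorm (fun x => partialDeriv i (g k) x - weakPartial Ω i w' x) 1
      (volume.restrict Ω)) l (𝓝 0))
    (h1' : ∀ i, Tendsto (fun k => eLpNorm (fun x => partialDeriv i (g' k) x -
      weakPartial Ω i w' x) 1 (volume.restrict Ω)) l (𝓝 0)) :
    Tendsto (fun k => eLpNorm (fun x => g k x - g' k x) 1 (surf S)) l (𝓝 0) := by
  obtain ⟨C, hC, hineq⟩ := h
  have hlim : Tendsto (fun k => C * ((eLpNorm (fun x => g k x - w x) 1 (volume.restrict Ω) +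
      eLpNorm (fun x => g' k x - w x) 1 (volume.restrict Ω)) +
      ∑ i, (eLpNorm (fun x => partialDeriv i (g k) x - weakPartial Ω i w' x) 1
        (volume.restrict Ω) + eLpNorm (fun x => partialDeriv i (g' k) x -
          weakPartial Ω i w' x) 1 (volume.restrict Ω)))) l (𝓝 0) := by
    have := ENNReal.Tendsto.const_mul (a := C) ((h0.add h0').add
      (tendsto_finsetSum Finset.univ fun i _ => (h1 i).add (h1' i))) (Or.inr hC)
    simpa using this
  refine tendsto_of_tendsto_of_tendsto_of_le_of_le tendsto_const_nhds hlim
    (fun _ => zero_le) fun k => ?_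
  refine (hineq _ ((hg k).sub (hg' k))).trans ?_
  refine mul_le_mul_right (add_le_add (eLpNorm_sub_le_sub
    (hg k).continuous.aestronglyMeasurable (hg' k).continuous.aestronglyMeasurable hw)
    (Finset.sum_le_sum fun i _ => ?_)) _
  have e : partialDeriv i (fun x => g k x - g' k x) =
      fun x => partialDeriv i (g k) x - partialDeriv i (g' k) x :=
    funext fun x => partialDeriv_sub (hg k) (hg' k) i x
  rw [e]
  exact eLpNorm_sub_le_sub (continuous_partialDeriv (hg k) i).aestronglyMeasurable
    (continuous_partialDeriv (hg' k) i).aestronglyMeasurable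
    (aestronglyMeasurable_weakPartial i w')

theorem IsTrace.ae_eq {Ω S : Set (E n)} (h : HasTraceInequality Ω S) {w τ τ' : E n → ℝ}
    (hw : AEStronglyMeasurable w (volume.restrict Ω))
    (hτ : IsTrace Ω S w τ) (hτ' : IsTrace Ω S w τ') : τ =ᵐ[surf S] τ' := by
  obtain ⟨m, g, g0, g1, g2, g3⟩ := hτ
  obtain ⟨m', g', g0', g1', g2', g3'⟩ := hτ'
  have h1 := h.tendsto hw g0 g0' g1 g1' g2 g2'
  have mg : ∀ k, AEStronglyMeasurable (g k) (surf S) := fun k =>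
    (g0 k).continuous.aestronglyMeasurable
  have mg' : ∀ k, AEStronglyMeasurable (g' k) (surf S) := fun k =>
    (g0' k).continuous.aestronglyMeasurable
  have key : ∀ k, eLpNorm (fun x => τ x - τ' x) 1 (surf S) ≤
      eLpNorm (fun x => g k x - τ x) 1 (surf S) +
      (eLpNorm (fun x => g k x - g' k x) 1 (surf S) +
        eLpNorm (fun x => g' k x - τ' x) 1 (surf S)) := by
    intro k
    refine (eLpNorm_sub_le_sub m m' (mg k)).trans (add_le_add (le_of_eq ?_) ?_)
    · rw [← eLpNorm_neg]; congr 1; funext x; simp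
    · have e1 : eLpNorm (fun x => g k x - g' k x) 1 (surf S) =
          eLpNorm (fun x => g' k x - g k x) 1 (surf S) := by
        rw [← eLpNorm_neg]; congr 1; funext x; simp
      have e2 : eLpNorm (fun x => g' k x - τ' x) 1 (surf S) =
          eLpNorm (fun x => τ' x - g' k x) 1 (surf S) := by
        rw [← eLpNorm_neg]; congr 1; funext x; simp
      rw [e1, e2, add_comm]
      have e : (fun x => τ' x - g k x) = (fun x => τ' x - g' k x) + fun x => g' k x - g k x := by
        funext x; simp
      rw [e]
      exact eLpNorm_add_le (m'.sub (mg' k)) ((mg' k).sub (mg k)) le_rfl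
  have hz : eLpNorm (fun x => τ x - τ' x) 1 (surf S) = 0 := by
    have := tendsto_zero_of_le_add key g3 (by simpa using h1.add g3')
    exact tendsto_nhds_unique tendsto_const_nhds this
  have hz := (eLpNorm_eq_zero_iff (m.sub m') (by simp)).1 hz
  filter_upwards [hz] with x hx
  exact sub_eq_zero.1 hx

theorem IsTrace.trace_ae_eq {Ω S : Set (E n)} (h : HasTraceInequality Ω S) {w τ : E n → ℝ}
    (hw : AEStronglyMeasurable w (volume.restrict Ω)) (hτ : IsTrace Ω S w τ) :
    trace Ω S w =ᵐ[surf S] τ :=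
  hτ.isTrace_trace.ae_eq h hw hτ

theorem eLpNorm_comb_le {μ : Measure (E n)} {a b c d : E n → ℝ} (r r' : ℝ)
    (ha : AEStronglyMeasurable a μ) (hb : AEStronglyMeasurable b μ)
    (hc : AEStronglyMeasurable c μ) (hd : AEStronglyMeasurable d μ) :
    eLpNorm (fun x => (r * a x + r' * b x) - (r * c x + r' * d x)) 1 μ ≤
      ‖r‖ₑ * eLpNorm (fun x => a x - c x) 1 μ +
        ‖r'‖ₑ * eLpNorm (fun x => b x - d x) 1 μ := by
  have e : (fun x => (r * a x + r' * b x) - (r * c x + r' * d x)) =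
      r • (fun x => a x - c x) + r' • fun x => b x - d x := by
    funext x; simp only [Pi.add_apply, Pi.smul_apply, smul_eq_mul]; ring
  rw [e, ← eLpNorm_const_smul, ← eLpNorm_const_smul]
  exact eLpNorm_add_le ((ha.sub hc).const_smul r) ((hb.sub hd).const_smul r') le_rfl

/-- The function has weak first derivatives on `Ω`. -/
def HasWeakGrad (Ω : Set (E n)) (w : E n → ℝ) : Prop :=
  LocallyIntegrableOn w Ω ∧ ∀ i, ∃ g, IsWeakPartial Ω i w g

theorem HasWeakGrad.weakPartial_comb {Ω : Set (E n)} (hΩ : IsOpen Ω) {w w' : E n → ℝ}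
    (h : HasWeakGrad Ω w) (h' : HasWeakGrad Ω w') (r r' : ℝ) (i : Fin n) :
    weakPartial Ω i (fun x => r * w x + r' * w' x) =ᵐ[volume.restrict Ω]
      fun x => r * weakPartial Ω i w x + r' * weakPartial Ω i w' x := by
  obtain ⟨g, hg⟩ := h.2 i
  obtain ⟨g', hg'⟩ := h'.2 i
  exact (hg.isWeakPartial_weakPartial.comb r r' hg'.isWeakPartial_weakPartial).weakPartial_ae_eq hΩ

theorem HasWeakGrad.comb {Ω : Set (E n)} {w w' : E n → ℝ}
    (h : HasWeakGrad Ω w) (h' : HasWeakGrad Ω w') (r r' : ℝ) :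
    HasWeakGrad Ω (fun x => r * w x + r' * w' x) := by
  refine ⟨(h.1.smul r).add (h'.1.smul r'), fun i => ?_⟩
  obtain ⟨g, hg⟩ := h.2 i
  obtain ⟨g', hg'⟩ := h'.2 i
  exact ⟨_, hg.comb r r' hg'⟩

theorem HasWeakGrad.congr {Ω : Set (E n)} {w w' : E n → ℝ} (h : HasWeakGrad Ω w)
    (hw : w =ᵐ[volume.restrict Ω] w') : HasWeakGrad Ω w' :=
  ⟨h.1.congr hw, fun i => (h.2 i).imp fun _ hg => hg.congr hw EventuallyEq.rfl⟩

theorem IsTrace.comb {Ω S : Set (E n)} (hΩ : IsOpen Ω) {w w' τ τ' : E n → ℝ}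
    (hw : HasWeakGrad Ω w) (hw' : HasWeakGrad Ω w') (r r' : ℝ)
    (h : IsTrace Ω S w τ) (h' : IsTrace Ω S w' τ') :
    IsTrace Ω S (fun x => r * w x + r' * w' x) (fun x => r * τ x + r' * τ' x) := by
  obtain ⟨m, g, g0, g1, g2, g3⟩ := h
  obtain ⟨m', g', g0', g1', g2', g3'⟩ := h'
  have hmul : ∀ (r : ℝ) {a : ℕ → ℝ≥0∞}, Tendsto a atTop (𝓝 0) →
      Tendsto (fun k => ‖r‖ₑ * a k) atTop (𝓝 0) := by
    intro r a ha
    simpa using ENNReal.Tendsto.const_mul (a := ‖r‖ₑ) ha (Or.inr (by simp))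
  refine ⟨(m.const_mul r).add (m'.const_mul r'), fun k x => r * g k x + r' * g' k x,
    fun k => (contDiff_const.mul (g0 k)).add (contDiff_const.mul (g0' k)), ?_, fun i => ?_, ?_⟩
  · exact tendsto_zero_of_le_add (fun k => eLpNorm_comb_le r r'
      (g0 k).continuous.aestronglyMeasurable (g0' k).continuous.aestronglyMeasurable
      hw.1.aestronglyMeasurable hw'.1.aestronglyMeasurable) (hmul r g1) (hmul r' g1')
  · refine tendsto_zero_of_le_add (fun k => ?_) (hmul r (g2 i)) (hmul r' (g2' i))
    have e : partialDeriv i (fun x => r * g k x + r' * g' k x) =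
        fun x => r * partialDeriv i (g k) x + r' * partialDeriv i (g' k) x := by
      funext x
      rw [partialDeriv_add (contDiff_const.mul (g0 k)) (contDiff_const.mul (g0' k)),
        partialDeriv_const_mul (g0 k), partialDeriv_const_mul (g0' k)]
    rw [e]
    have e2 := hw.weakPartial_comb hΩ hw' r r' i
    rw [eLpNorm_congr_ae (e2.mono fun x hx => by rw [hx] : _ =ᵐ[volume.restrict Ω]
      fun x => (r * partialDeriv i (g k) x + r' * partialDeriv i (g' k) x) -
        (r * weakPartial Ω i w x + r' * weakPartial Ω i w' x))]
    exact eLpNorm_comb_le r r' (continuous_partialDeriv (g0 k) i).aestronglyMeasurable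
      (continuous_partialDeriv (g0' k) i).aestronglyMeasurable
      (aestronglyMeasurable_weakPartial i w) (aestronglyMeasurable_weakPartial i w')
  · exact tendsto_zero_of_le_add (fun k => eLpNorm_comb_le r r'
      (g0 k).continuous.aestronglyMeasurable (g0' k).continuous.aestronglyMeasurable m m')
      (hmul r g3) (hmul r' g3')

theorem isTrace_of_contDiff {Ω S : Set (E n)} (hΩ : IsOpen Ω) {P : E n → ℝ}
    (hP : ContDiff ℝ ∞ P) : IsTrace Ω S P P := by
  refine ⟨hP.continuous.aestronglyMeasurable, fun _ => P, fun _ => hP, by simp, fun i => ?_,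
    by simp⟩
  have e := (isWeakPartial_of_contDiff (Ω := Ω) i hP).weakPartial_ae_eq hΩ
  have e' : eLpNorm (fun x => partialDeriv i P x - weakPartial Ω i P x) 1 (volume.restrict Ω) =
      0 := by
    rw [eLpNorm_congr_ae (e.mono fun x hx => by simp only [hx, sub_self] :
      _ =ᵐ[volume.restrict Ω] fun _ => (0 : ℝ))]
    simp
  simp [e']

/-- Functions that are limits in `W^{1,1}(Ω)` of smooth functions have traces. -/
theorem exists_isTrace {Ω S : Set (E n)} (h : HasTraceInequality Ω S) (hS : IsCompact S)
    [IsFiniteMeasure (surf S)] {w : E n → ℝ}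
    (hw : AEStronglyMeasurable w (volume.restrict Ω)) {g : ℕ → E n → ℝ}
    (g0 : ∀ k, ContDiff ℝ ∞ (g k))
    (g1 : Tendsto (fun k => eLpNorm (fun x => g k x - w x) 1 (volume.restrict Ω)) atTop (𝓝 0))
    (g2 : ∀ i, Tendsto (fun k => eLpNorm (fun x => partialDeriv i (g k) x - weakPartial Ω i w x) 1
      (volume.restrict Ω)) atTop (𝓝 0)) :
    ∃ τ : E n → ℝ, AEStronglyMeasurable τ (surf S) ∧
      Tendsto (fun k => eLpNorm (fun x => g k x - τ x) 1 (surf S)) atTop (𝓝 0) := by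
  have hm : ∀ k, MemLp (g k) 1 (surf S) := fun k => memLp_surf hS (g0 k).continuous 1
  -- Comparing the approximating sequence with itself at two independent indices shows that its
  -- restrictions to `S` are Cauchy in `L¹(S)`.
  have hpair := h.tendsto (l := (atTop : Filter (ℕ × ℕ))) hw (fun k : ℕ × ℕ => g0 k.1)
    (fun k : ℕ × ℕ => g0 k.2)
    (by rw [← prod_atTop_atTop_eq]; exact g1.comp tendsto_fst)
    (by rw [← prod_atTop_atTop_eq]; exact g1.comp tendsto_snd)
    (fun i => by rw [← prod_atTop_atTop_eq]; exact (g2 i).comp tendsto_fst)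
    (fun i => by rw [← prod_atTop_atTop_eq]; exact (g2 i).comp tendsto_snd)
  have hcau : CauchySeq fun k => (hm k).toLp (g k) := by
    rw [Lp.cauchySeq_Lp_iff_cauchySeq_eLpNorm]
    refine hpair.congr fun k => eLpNorm_congr_ae ?_
    filter_upwards [(hm k.1).coeFn_toLp, (hm k.2).coeFn_toLp] with x h1 h2
    simp only [Pi.sub_apply, h1, h2]
  obtain ⟨τ, hτ⟩ := cauchySeq_tendsto_of_complete hcau
  refine ⟨τ, Lp.aestronglyMeasurable τ, ?_⟩
  rw [Lp.tendsto_Lp_iff_tendsto_eLpNorm'] at hτ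
  refine hτ.congr fun k => eLpNorm_congr_ae ?_
  filter_upwards [(hm k).coeFn_toLp] with x h1
  simp only [Pi.sub_apply, h1]

end PeriodicHJBI

namespace PeriodicHJBI

variable {n : ℕ}

/-! ### Faces of simplices -/

/-- `S` is spanned by `n` of the vertices `t`. -/
def IsFacet (t : Finset (E n)) (S : Set (E n)) : Prop :=
  ∃ r : Set (E n), r ⊆ t ∧ r.ncard = n ∧ S = convexHull ℝ r

theorem isCompact_cell (t : Finset (E n)) : IsCompact (cell t) :=
  t.finite_toSet.isCompact_convexHull ℝ

theorem volume_frontier_cell (t : Finset (E n)) : volume (frontier (cell t)) = 0 :=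
  (convex_convexHull ℝ _).addHaar_frontier volume

theorem restrict_interior_cell (t : Finset (E n)) :
    (volume : Measure (E n)).restrict (interior (cell t)) = volume.restrict (cell t) :=
  Measure.restrict_congr_set (interior_ae_eq_of_null_frontier (volume_frontier_cell t))

instance isFiniteMeasure_restrict_interior_cell (t : Finset (E n)) :
    IsFiniteMeasure ((volume : Measure (E n)).restrict (interior (cell t))) := by
  rw [restrict_interior_cell]
  exact ⟨by simpa using (isCompact_cell t).measure_lt_top⟩

/-- The apex is the vertex missing from the facet, and `v` is the component of `p₀ - q` orthogonal
to the directions of the facet. It is nonzero because affine independence keeps the apex out of the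
affine span of the other vertices. -/
theorem IsFacet.exists_isConeBase (hn : n ≠ 0) {t : Finset (E n)} (hc : t.card = n + 1)
    (hi : AffineIndependent ℝ ((↑) : t → E n)) {S : Set (E n)} (hS : IsFacet t S) :
    ∃ p₀ q v, IsConeBase (cell t) S p₀ q v := by
  obtain ⟨r, hr, hrn, rfl⟩ := hS
  have hrf : r.Finite := t.finite_toSet.subset hr
  obtain ⟨q, hq⟩ : r.Nonempty := by
    rw [← Set.ncard_pos hrf]; omega
  obtain ⟨p₀, hp₀, hp₀r⟩ : ∃ p ∈ (t : Set (E n)), p ∉ r := by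
    refine Set.exists_mem_notMem_of_ncard_lt_ncard ?_ hrf
    rw [Set.ncard_coe_finset]; omega
  have hnot : p₀ ∉ affineSpan ℝ r := by
    have h1 := hi.notMem_affineSpan_sdiff ⟨p₀, hp₀⟩ univ
    have h2 : r ⊆ (↑) '' ((univ : Set t) \ {⟨p₀, hp₀⟩}) := by
      intro x hx
      refine ⟨⟨x, hr hx⟩, ⟨mem_univ _, ?_⟩, rfl⟩
      simp only [mem_singleton_iff, Subtype.mk.injEq]
      rintro rfl
      exact hp₀r hx
    exact fun h => h1 (affineSpan_mono ℝ h2 h)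
  set D := vectorSpan ℝ r
  have hdec := D.starProjection_add_starProjection_orthogonal (p₀ - q)
  have hv : Dᗮ.starProjection (p₀ - q) ∈ Dᗮ := Submodule.starProjection_apply_mem _ _
  refine ⟨p₀, q, Dᗮ.starProjection (p₀ - q), convex_convexHull ℝ _, isCompact_cell t,
    subset_convexHull ℝ _ hp₀, convexHull_mono hr, hrf.isCompact_convexHull ℝ, ?_, ?_, ?_⟩
  · intro h0
    rw [h0, add_zero] at hdec
    have h1 : p₀ - q ∈ D := hdec ▸ Submodule.starProjection_apply_mem _ _
    have h2 := AffineSubspace.vadd_mem_of_mem_direction (s := affineSpan ℝ r)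
      (by rw [direction_affineSpan]; exact h1) (subset_affineSpan ℝ r hq)
    rw [vadd_eq_add, sub_add_cancel] at h2
    exact hnot h2
  · intro y hy
    have h1 : y - q ∈ D := by
      rw [← vsub_eq_sub, show D = (affineSpan ℝ r).direction from (direction_affineSpan ℝ r).symm]
      exact AffineSubspace.vsub_mem_direction (convexHull_subset_affineSpan r hy)
        (subset_affineSpan ℝ r hq)
    exact Submodule.inner_left_of_mem_orthogonal h1 hv
  · have h1 := congrArg (inner ℝ (Dᗮ.starProjection (p₀ - q))) hdec
    rw [← h1, inner_add_right,
      Submodule.inner_left_of_mem_orthogonal (Submodule.starProjection_apply_mem D _) hv, zero_add]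

theorem IsFacet.hasTraceInequality (hn : n ≠ 0) {t : Finset (E n)} (hc : t.card = n + 1)
    (hi : AffineIndependent ℝ ((↑) : t → E n)) {S : Set (E n)} (hS : IsFacet t S) :
    HasTraceInequality (interior (cell t)) S := by
  obtain ⟨p₀, q, v, h⟩ := hS.exists_isConeBase hn hc hi
  unfold HasTraceInequality
  rw [restrict_interior_cell]
  exact h.trace_inequality

theorem IsFacet.isFiniteMeasure_surf (hn : n ≠ 0) {t : Finset (E n)} (hc : t.card = n + 1)
    (hi : AffineIndependent ℝ ((↑) : t → E n)) {S : Set (E n)} (hS : IsFacet t S) :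
    IsFiniteMeasure (surf S) := by
  obtain ⟨p₀, q, v, h⟩ := hS.exists_isConeBase hn hc hi
  exact h.isFiniteMeasure_surf

theorem IsFacet.isCompact {t : Finset (E n)} {S : Set (E n)} (hS : IsFacet t S) :
    IsCompact S := by
  obtain ⟨r, hr, -, rfl⟩ := hS
  exact (t.finite_toSet.subset hr).isCompact_convexHull ℝ

theorem measurePreserving_sub_surf {S : Set (E n)} (hS : IsCompact S) (c : E n) :
    MeasurePreserving (fun x => x - c) (surf S) (surf ((fun x => x - c) '' S)) := by
  have h := (IsometryEquiv.subRight c).measurePreserving_euclideanHausdorffMeasure (n - 1)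
  have hm : MeasurableSet ((fun x => x - c) '' S) :=
    (hS.image (by fun_prop)).measurableSet
  have h2 := h.restrict_preimage hm
  have e : (IsometryEquiv.subRight c) ⁻¹' ((fun x => x - c) '' S) = S :=
    preimage_image_eq S (sub_left_injective)
  rw [e] at h2
  exact h2

namespace Mesh

theorem isFacet_snd (𝒯 : Mesh n) {q : Finset (E n) × Finset (E n) × (Fin n → ℤ)}
    (hq : q ∈ 𝒯.orientedFaces) : q.2.1 ∈ 𝒯.elems ∧ IsFacet q.2.1 (facePts q) := by
  classical
  simp only [orientedFaces, Finset.mem_filter, Finset.mem_product] at hq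
  exact ⟨hq.1.2.1, _, inter_subset_right, hq.2, rfl⟩

/-- The face is stored on the side of `q.2.1`; its copy on `q.1` is obtained by undoing the lattice
translation, which maps shared vertices back to vertices of `q.1`. -/
theorem isFacet_fst (𝒯 : Mesh n) {q : Finset (E n) × Finset (E n) × (Fin n → ℤ)}
    (hq : q ∈ 𝒯.orientedFaces) :
    q.1 ∈ 𝒯.elems ∧ IsFacet q.1 ((fun y => y - latticeVec q.2.2) '' facePts q) := by
  classical
  simp only [orientedFaces, Finset.mem_filter, Finset.mem_product] at hq
  refine ⟨hq.1.1, (fun y => y - latticeVec q.2.2) '' sharedVertices q.1 q.2.1 q.2.2, ?_, ?_, ?_⟩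
  · rintro _ ⟨_, ⟨⟨x, hx, rfl⟩, -⟩, rfl⟩
    simpa using hx
  · rw [Set.ncard_image_of_injective _ sub_left_injective]
    exact hq.2
  · have h := (AffineEquiv.constVAdd ℝ (E n) (-latticeVec q.2.2)).toAffineMap.image_convexHull
      (sharedVertices q.1 q.2.1 q.2.2)
    have e : ((AffineEquiv.constVAdd ℝ (E n) (-latticeVec q.2.2)).toAffineMap : E n → E n) =
        fun y => y - latticeVec q.2.2 := by
      funext y
      simp [sub_eq_neg_add]
    rw [e] at h
    exact h

/-! ### The elements cover the unit cell up to a null set -/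

theorem affineSpan_ne_top {s : Finset (E n)} (hs : s.card ≤ n) :
    affineSpan ℝ (s : Set (E n)) ≠ ⊤ := by
  classical
  intro h
  obtain hc | ⟨m, hm⟩ : s.card = 0 ∨ ∃ m, s.card = m + 1 := by
    cases s.card <;> simp
  · rw [Finset.card_eq_zero] at hc
    subst hc
    rw [Finset.coe_empty, AffineSubspace.span_empty] at h
    exact AffineSubspace.bot_ne_top ℝ (E n) (E n) h
  · have h1 := finrank_vectorSpan_image_finset_le ℝ (id : E n → E n) s hm
    rw [Finset.image_id, ← direction_affineSpan, h, AffineSubspace.direction_top, finrank_top,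
      finrank_euclideanSpace_fin] at h1
    omega

/-- By conformity with `z = 0` the intersection is spanned by the common vertices. Two distinct sets
of `n + 1` vertices share at most `n` points, whose convex hull is flat and has no interior. -/
theorem disjoint_interior (𝒯 : Mesh n) {s t : Finset (E n)} (hs : s ∈ 𝒯.elems)
    (ht : t ∈ 𝒯.elems) (hst : s ≠ t) : Disjoint (interior (cell s)) (interior (cell t)) := by
  classical
  rw [Set.disjoint_iff_inter_eq_empty, ← Set.not_nonempty_iff_eq_empty]
  intro hne
  have h0 : latticeVec (0 : Fin n → ℤ) = 0 := by ext i; simp [latticeVec]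
  have hc := 𝒯.conforming s hs t ht 0
  simp only [sharedVertices, h0, add_zero, image_id'] at hc
  rw [← interior_inter, hc, ← Finset.coe_inter,
    interior_convexHull_nonempty_iff_affineSpan_eq_top] at hne
  refine affineSpan_ne_top ?_ hne
  have h1 : (s ∩ t).card < s.card := by
    refine Finset.card_lt_card (Finset.inter_subset_left.ssubset_of_ne fun h => hst ?_)
    exact Finset.eq_of_subset_of_card_le (Finset.inter_eq_left.1 h)
      (by rw [𝒯.card_eq s hs, 𝒯.card_eq t ht])
  rw [𝒯.card_eq s hs] at h1
  omega

theorem cell_subset_closedCell (𝒯 : Mesh n) {s : Finset (E n)} (hs : s ∈ 𝒯.elems) :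
    cell s ⊆ closedCell n := by
  rw [← 𝒯.cover]
  exact subset_biUnion_of_mem (u := fun s => cell s) hs

/-- Coordinate projections are open maps, so they send the interior to an open subset of `[0,1]`,
hence into `(0,1)`. -/
theorem interior_cell_subset (𝒯 : Mesh n) {s : Finset (E n)} (hs : s ∈ 𝒯.elems) :
    interior (cell s) ⊆ Y n := by
  intro x hx i
  have ho : IsOpenMap (EuclideanSpace.proj i : E n →L[ℝ] ℝ) := by
    refine ContinuousLinearMap.isOpenMap _ fun r => ⟨EuclideanSpace.single i r, by simp⟩
  have h1 : (EuclideanSpace.proj i : E n →L[ℝ] ℝ) '' interior (cell s) ⊆ Icc 0 1 := by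
    rintro _ ⟨y, hy, rfl⟩
    exact 𝒯.cell_subset_closedCell hs (interior_subset hy) i
  have h2 := interior_maximal h1 (ho _ isOpen_interior) ⟨x, hx, rfl⟩
  rw [interior_Icc] at h2
  exact h2

end Mesh

theorem isOpen_Y (n : ℕ) : IsOpen (Y n) := by
  have : Y n = ⋂ i, {x : E n | 0 < x i ∧ x i < 1} := by
    ext x; simp [Y]
  rw [this]
  refine isOpen_iInter_of_finite fun i => ?_
  have hc : Continuous fun x : E n => x i := by fun_prop
  exact (isOpen_lt continuous_const hc).inter (isOpen_lt hc continuous_const)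

namespace Mesh

theorem Y_subset_closedCell : Y n ⊆ closedCell n := fun _ hx i => ⟨(hx i).1.le, (hx i).2.le⟩

/-- The elements cover the closed cell, and boundaries of convex sets are null sets. -/
theorem ae_mem_interior (𝒯 : Mesh n) :
    ∀ᵐ x ∂((volume : Measure (E n)).restrict (Y n)), ∃ s ∈ 𝒯.elems, x ∈ interior (cell s) := by
  have h : ∀ᵐ x : E n, ∀ s ∈ 𝒯.elems, x ∉ frontier (cell s) := by
    refine (ae_ball_iff 𝒯.elems.countable_toSet).2 ?_
    exact fun s _ => measure_eq_zero_iff_ae_notMem.1 (volume_frontier_cell s)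
  rw [ae_restrict_iff' (isOpen_Y n).measurableSet]
  filter_upwards [h] with x hx hxY
  have hxc := Y_subset_closedCell hxY
  rw [← 𝒯.cover] at hxc
  obtain ⟨s, hs, hxs⟩ := mem_iUnion₂.1 hxc
  refine ⟨s, hs, ?_⟩
  by_contra hxi
  exact hx s hs ⟨subset_closure hxs, hxi⟩

theorem ae_of_forall_elems (𝒯 : Mesh n) {p : E n → Prop}
    (h : ∀ s ∈ 𝒯.elems, ∀ᵐ x ∂((volume : Measure (E n)).restrict (interior (cell s))), p x) :
    ∀ᵐ x ∂((volume : Measure (E n)).restrict (Y n)), p x := by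
  have h2 : ∀ᵐ x : E n, ∀ s ∈ 𝒯.elems, x ∈ interior (cell s) → p x := by
    refine (ae_ball_iff 𝒯.elems.countable_toSet).2 ?_
    exact fun s hs => (ae_restrict_iff' isOpen_interior.measurableSet).1 (h s hs)
  filter_upwards [𝒯.ae_mem_interior, ae_restrict_of_ae h2] with x ⟨s, hs, hx⟩ hx2
  exact hx2 s hs hx

theorem ae_interior_of_ae (𝒯 : Mesh n) {s : Finset (E n)} (hs : s ∈ 𝒯.elems) {p : E n → Prop}
    (h : ∀ᵐ x ∂((volume : Measure (E n)).restrict (Y n)), p x) :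
    ∀ᵐ x ∂((volume : Measure (E n)).restrict (interior (cell s))), p x :=
  ae_restrict_of_ae_restrict_of_subset (𝒯.interior_cell_subset hs) h

theorem pwGrad_eq (𝒯 : Mesh n) {s : Finset (E n)} (hs : s ∈ 𝒯.elems) (w : E n → ℝ) {x : E n}
    (hx : x ∈ interior (cell s)) : 𝒯.pwGrad w x = weakGrad (interior (cell s)) w x := by
  unfold pwGrad
  rw [Finset.sum_eq_single_of_mem s hs, indicator_of_mem hx]
  intro t ht hts
  exact indicator_of_notMem (fun hxt =>
    (disjoint_left.1 (𝒯.disjoint_interior ht hs hts) hxt hx)) _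

theorem pwHess_eq (𝒯 : Mesh n) {s : Finset (E n)} (hs : s ∈ 𝒯.elems) (w : E n → ℝ) {x : E n}
    (hx : x ∈ interior (cell s)) : 𝒯.pwHess w x = weakHess (interior (cell s)) w x := by
  unfold pwHess
  rw [Finset.sum_eq_single_of_mem s hs, indicator_of_mem hx]
  intro t ht hts
  exact indicator_of_notMem (fun hxt =>
    (disjoint_left.1 (𝒯.disjoint_interior ht hs hts) hxt hx)) _

end Mesh

end PeriodicHJBI

namespace PeriodicHJBI

/-! ### Inf-sup of bounded families -/

section InfSup

variable {ι κ : Type*} {f g : ι → κ → ℝ} {M : ℝ}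

theorem bddAbove_of_abs_le (hf : ∀ a b, |f a b| ≤ M) (a : ι) : BddAbove (range (f a)) :=
  ⟨M, by rintro _ ⟨b, rfl⟩; exact (abs_le.1 (hf a b)).2⟩

variable [Nonempty κ]

theorem bddBelow_iSup_of_abs_le (hf : ∀ a b, |f a b| ≤ M) :
    BddBelow (range fun a => ⨆ b, f a b) := by
  refine ⟨-M, ?_⟩
  rintro _ ⟨a, rfl⟩
  obtain ⟨b⟩ := ‹Nonempty κ›
  exact (abs_le.1 (hf a b)).1.trans (le_ciSup (bddAbove_of_abs_le hf a) b)

variable [Nonempty ι]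

theorem iInf_iSup_le_add {D : ℝ} (hf : ∀ a b, |f a b| ≤ M) (hg : ∀ a b, |g a b| ≤ M)
    (h : ∀ a b, f a b ≤ g a b + D) : ⨅ a, ⨆ b, f a b ≤ (⨅ a, ⨆ b, g a b) + D := by
  rw [← sub_le_iff_le_add]
  refine le_ciInf fun a => ?_
  rw [sub_le_iff_le_add]
  refine (ciInf_le (bddBelow_iSup_of_abs_le hf) a).trans (ciSup_le fun b => (h a b).trans ?_)
  gcongr
  exact le_ciSup (bddAbove_of_abs_le hg a) b

/-- An inf-sup is monotone and commutes with adding constants, so it is nonexpansive in the supremum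
norm. This carries Lipschitz bounds from the linear operators over to `F_γ`. -/
theorem abs_iInf_iSup_sub_le {D : ℝ} (hf : ∀ a b, |f a b| ≤ M) (hg : ∀ a b, |g a b| ≤ M)
    (h : ∀ a b, |f a b - g a b| ≤ D) : |(⨅ a, ⨆ b, f a b) - ⨅ a, ⨆ b, g a b| ≤ D := by
  have h1 := iInf_iSup_le_add hf hg fun a b => by linarith [(abs_le.1 (h a b)).2]
  have h2 := iInf_iSup_le_add hg hf fun a b => by linarith [(abs_le.1 (h a b)).1]
  rw [abs_le]
  constructor <;> linarith

/-- Multiplication by positive bounded factors does not change the vanishing of an inf-sup. -/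
theorem iInf_iSup_mul_eq_zero {Γ M' : ℝ} (hg : ∀ a b, 0 < g a b) (hgΓ : ∀ a b, g a b ≤ Γ)
    (hf : ∀ a b, |f a b| ≤ M) (hgf : ∀ a b, |g a b * f a b| ≤ M')
    (h : ⨅ a, ⨆ b, f a b = 0) : ⨅ a, ⨆ b, g a b * f a b = 0 := by
  have hΓ : 0 < Γ := by
    obtain ⟨a⟩ := ‹Nonempty ι›
    obtain ⟨b⟩ := ‹Nonempty κ›
    exact (hg a b).trans_le (hgΓ a b)
  refine le_antisymm (le_of_forall_pos_le_add fun ε hε => ?_) (le_ciInf fun a => ?_)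
  -- Neither the infimum nor the supremum need be attained. The tolerance `ε / Γ` becomes at most
  -- `ε` after multiplication by a factor bounded by `Γ`.
  · obtain ⟨a, ha⟩ := exists_lt_of_ciInf_lt (h.trans_lt (div_pos hε hΓ))
    refine (ciInf_le (bddBelow_iSup_of_abs_le hgf) a).trans (ciSup_le fun b => ?_)
    have h1 : f a b ≤ ε / Γ := (le_ciSup (bddAbove_of_abs_le hf a) b).trans ha.le
    calc g a b * f a b ≤ g a b * (ε / Γ) := mul_le_mul_of_nonneg_left h1 (hg a b).le
      _ ≤ Γ * (ε / Γ) := mul_le_mul_of_nonneg_right (hgΓ a b) (by positivity)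
      _ = 0 + ε := by field_simp; ring
  · refine le_of_forall_pos_le_add fun ε hε => ?_
    have h0 : (0 : ℝ) ≤ ⨆ b, f a b := h ▸ ciInf_le (bddBelow_iSup_of_abs_le hf) a
    have h1 : -(ε / Γ) < ⨆ b, f a b := lt_of_lt_of_le (neg_lt_zero.2 (div_pos hε hΓ)) h0
    obtain ⟨b, hb⟩ := exists_lt_of_lt_ciSup h1
    have h2 := le_ciSup (bddAbove_of_abs_le hgf a) b
    have h3 : -(g a b * (ε / Γ)) ≤ g a b * f a b := by
      rw [← mul_neg]
      exact mul_le_mul_of_nonneg_left hb.le (hg a b).le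
    have h4 : g a b * (ε / Γ) ≤ Γ * (ε / Γ) :=
      mul_le_mul_of_nonneg_right (hgΓ a b) (by positivity)
    have h5 : Γ * (ε / Γ) = ε := by field_simp
    linarith

end InfSup

/-! ### The renormalized operator under the Cordes condition -/

/-- The square of the norm `(|R|² + 2λ|p|² + λ²r²)^{1/2}`. -/
def jetSq {n : ℕ} (lam r : ℝ) (p : Fin n → ℝ) (R : Matrix (Fin n) (Fin n) ℝ) : ℝ :=
  frob R R + 2 * lam * (∑ i, p i ^ 2) + lam ^ 2 * r ^ 2

theorem frob_self_nonneg {n : ℕ} (R : Matrix (Fin n) (Fin n) ℝ) : 0 ≤ frob R R :=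
  Finset.sum_nonneg fun _ _ => Finset.sum_nonneg fun _ _ => mul_self_nonneg _

theorem jetSq_nonneg {n : ℕ} {lam : ℝ} (hlam : 0 < lam) (r : ℝ) (p : Fin n → ℝ)
    (R : Matrix (Fin n) (Fin n) ℝ) : 0 ≤ jetSq lam r p R := by
  have := frob_self_nonneg R
  have : 0 ≤ ∑ i, p i ^ 2 := Finset.sum_nonneg fun _ _ => sq_nonneg _
  unfold jetSq
  positivity

/-- The Cauchy-Schwarz inequality for second-order jets, in weighted form. -/
theorem abs_jet_mul_le {n : ℕ} {lam : ℝ} (hlam : 0 < lam) (M : Matrix (Fin n) (Fin n) ℝ)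
    (q : Fin n → ℝ) (c r : ℝ) (p : Fin n → ℝ) (R : Matrix (Fin n) (Fin n) ℝ) :
    |frob M R + q ⬝ᵥ p + c * (lam * r)| ≤
      Real.sqrt (frob M M + (∑ i, q i ^ 2) / (2 * lam) + c ^ 2) *
        Real.sqrt (jetSq lam r p R) := by
  have hs : Real.sqrt (2 * lam) ^ 2 = 2 * lam := Real.sq_sqrt (by positivity)
  have hs0 : Real.sqrt (2 * lam) ≠ 0 := (Real.sqrt_pos.2 (by positivity)).ne'
  -- Cauchy-Schwarz for vectors with `n² + n + 1` entries. The gradient entries are rescaled by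
  -- `√(2λ)`, which produces the weights of `jetSq`.
  have key := Finset.sum_mul_sq_le_sq_mul_sq
    (Finset.univ : Finset ((Fin n × Fin n) ⊕ (Fin n ⊕ Unit)))
    (Sum.elim (fun ij => M ij.1 ij.2) (Sum.elim (fun i => q i / Real.sqrt (2 * lam)) fun _ => c))
    (Sum.elim (fun ij => R ij.1 ij.2) (Sum.elim (fun i => Real.sqrt (2 * lam) * p i)
      fun _ => lam * r))
  simp only [Fintype.sum_sum_type, Fintype.sum_prod_type, Sum.elim_inl, Sum.elim_inr,
    Finset.univ_unique, Finset.sum_singleton, div_pow, mul_pow, hs] at key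
  have e1 : ∀ i, q i / Real.sqrt (2 * lam) * (Real.sqrt (2 * lam) * p i) = q i * p i := by
    intro i; field_simp
  simp only [e1, ← Finset.mul_sum, ← Finset.sum_div] at key
  have e2 : (frob M R + q ⬝ᵥ p + c * (lam * r)) ^ 2 ≤
      (frob M M + (∑ i, q i ^ 2) / (2 * lam) + c ^ 2) * jetSq lam r p R := by
    simp only [frob, jetSq, dotProduct, ← sq]
    rw [add_assoc, add_assoc, add_assoc]
    exact key
  have h0 : 0 ≤ frob M M + (∑ i, q i ^ 2) / (2 * lam) + c ^ 2 := by
    have := frob_self_nonneg M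
    have : 0 ≤ ∑ i, q i ^ 2 := Finset.sum_nonneg fun _ _ => sq_nonneg _
    positivity
  rw [← Real.sqrt_mul h0]
  exact Real.abs_le_sqrt e2

theorem frob_smul_sub_one {n : ℕ} (g : ℝ) (M : Matrix (Fin n) (Fin n) ℝ) :
    frob (g • M - 1) (g • M - 1) = g ^ 2 * frob M M - 2 * g * M.trace + n := by
  have h1 : ∀ i j, (g • M - 1) i j * (g • M - 1) i j = g ^ 2 * (M i j * M i j) -
      2 * g * (if i = j then M i j else 0) + if i = j then 1 else 0 := by
    intro i j
    by_cases h : i = j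
    · simp only [h, Matrix.sub_apply, Matrix.smul_apply, smul_eq_mul, Matrix.one_apply_eq,
        if_true]
      ring
    · simp only [h, Matrix.sub_apply, Matrix.smul_apply, smul_eq_mul, Matrix.one_apply_ne h,
        if_false]
      ring
  simp only [frob, h1, Finset.sum_add_distrib, Finset.sum_sub_distrib, ← Finset.mul_sum,
    Finset.sum_ite_eq, Finset.mem_univ, if_true, Matrix.trace, Matrix.diag]
  simp

theorem frob_one_left {n : ℕ} (R : Matrix (Fin n) (Fin n) ℝ) :
    frob (1 : Matrix (Fin n) (Fin n) ℝ) R = R.trace := by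
  simp [frob, Matrix.one_apply, Matrix.trace]

theorem frob_sub_left {n : ℕ} (M N R : Matrix (Fin n) (Fin n) ℝ) :
    frob (M - N) R = frob M R - frob N R := by
  simp only [frob, Matrix.sub_apply, sub_mul, Finset.sum_sub_distrib]

theorem frob_sub_right {n : ℕ} (M N R : Matrix (Fin n) (Fin n) ℝ) :
    frob R (M - N) = frob R M - frob R N := by
  simp only [frob, Matrix.sub_apply, mul_sub, Finset.sum_sub_distrib]

theorem frob_smul_left {n : ℕ} (g : ℝ) (M R : Matrix (Fin n) (Fin n) ℝ) :
    frob (g • M) R = g * frob M R := by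
  simp only [frob, Matrix.smul_apply, smul_eq_mul, mul_assoc, Finset.mul_sum]

theorem exists_abs_le {𝒜 ℬ : Type*} [TopologicalSpace 𝒜] [TopologicalSpace ℬ] [CompactSpace 𝒜]
    [CompactSpace ℬ] {g : 𝒜 × ℬ → ℝ} (hg : Continuous g) : ∃ M, ∀ α β, |g (α, β)| ≤ M := by
  obtain ⟨M, hM⟩ := isCompact_univ.exists_bound_of_continuousOn hg.continuousOn
  exact ⟨M, fun α β => hM (α, β) (mem_univ _)⟩

namespace Coeffs.Admissible

variable {n : ℕ} {𝒜 ℬ : Type*} [MetricSpace 𝒜] [MetricSpace ℬ] {P : Coeffs n 𝒜 ℬ}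
  {lam delta : ℝ}

theorem c_pos' (hP : P.Admissible lam delta) (x : E n) (α : 𝒜) (β : ℬ) : 0 < P.c x α β := by
  obtain ⟨c₀, h0, h⟩ := hP.c_pos
  exact h0.trans_le (h x α β)

theorem cordesLhs_pos (hP : P.Admissible lam delta)
    (x : E n) (α : 𝒜) (β : ℬ) : 0 < P.cordesLhs lam x α β := by
  have h1 := hP.c_pos' x α β
  have h2 := hP.lam_pos
  have h3 := frob_self_nonneg (P.A x α β)
  have h4 : 0 ≤ ∑ i, P.b x α β i ^ 2 := Finset.sum_nonneg fun _ _ => sq_nonneg _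
  unfold Coeffs.cordesLhs
  positivity

/-- Ellipticity tested with the unit vectors makes the diagonal of `A` nonnegative; strict
positivity comes from `c / λ`. -/
theorem cordesTr_pos (hP : P.Admissible lam delta)
    (x : E n) (α : 𝒜) (β : ℬ) : 0 < P.cordesTr lam x α β := by
  obtain ⟨ζ₁, ζ₂, h1, -, h⟩ := hP.elliptic
  have hd : ∀ i, 0 ≤ P.A x α β i i := by
    intro i
    have h2 := (h x α β (Pi.single i 1)).1
    have h3 : (P.A x α β).mulVec (Pi.single i 1) ⬝ᵥ Pi.single i 1 = P.A x α β i i := by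
      simp
    rw [h3] at h2
    refine le_trans ?_ h2
    exact mul_nonneg h1.le (Finset.sum_nonneg fun _ _ => sq_nonneg _)
  have h4 : 0 ≤ (P.A x α β).trace := Finset.sum_nonneg fun i _ => hd i
  have h5 := div_pos (hP.c_pos' x α β) hP.lam_pos
  unfold Coeffs.cordesTr
  linarith

theorem gamma_pos (hP : P.Admissible lam delta) (x : E n) (α : 𝒜) (β : ℬ) : 0 < P.gamma lam x α β :=
  mul_pos (inv_pos.2 (hP.cordesLhs_pos x α β)) (hP.cordesTr_pos x α β)

/-- The pointwise estimate that follows from the Cordes condition. -/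
theorem abs_gamma_mul_le (hP : P.Admissible lam delta)
    (x : E n) (α : 𝒜) (β : ℬ) (r : ℝ) (p : Fin n → ℝ)
    (R : Matrix (Fin n) (Fin n) ℝ) :
    |P.gamma lam x α β * (-frob (P.A x α β) R - P.b x α β ⬝ᵥ p + P.c x α β * r)| ≤
      (Real.sqrt (1 - delta) + Real.sqrt ((n : ℝ) + 1)) * Real.sqrt (jetSq lam r p R) := by
  set g := P.gamma lam x α β with hg
  set A := P.A x α β
  set b := P.b x α β
  set c := P.c x α β
  have hlam := hP.lam_pos
  have hL := hP.cordesLhs_pos x α β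
  have hT := hP.cordesTr_pos x α β
  have hcord := hP.cordes x α β
  have hdel := hP.delta_pos
  have hgL : g * P.cordesLhs lam x α β = P.cordesTr lam x α β := by
    rw [hg, Coeffs.gamma]; field_simp
  have hnd : (0 : ℝ) < n + delta := by positivity
  -- Here `g * cordesTr` is `cordesTr² / cordesLhs`, so this is the Cordes condition rearranged.
  have hgT : (n : ℝ) + delta ≤ g * P.cordesTr lam x α β := by
    rw [hg, Coeffs.gamma, mul_assoc, ← sq, inv_mul_eq_div, le_div_iff₀ hL]
    rw [one_div, inv_mul_eq_div, le_div_iff₀ hnd] at hcord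
    linarith
  -- The rescaled operator is split into `-Δ + λ`, represented up to sign by the jet `(1, 0, -1)`,
  -- and the deviation from it.
  have h1 := abs_jet_mul_le hlam (g • A - 1) (g • b) (1 - g * (c / lam)) r p R
  have h2 := abs_jet_mul_le hlam (1 : Matrix (Fin n) (Fin n) ℝ) 0 (-1) r p R
  have e1 : frob (g • A - 1) (g • A - 1) + (∑ i, (g • b) i ^ 2) / (2 * lam) +
      (1 - g * (c / lam)) ^ 2 ≤ 1 - delta := by
    have e3 : (∑ i, (g • b) i ^ 2) = g ^ 2 * ∑ i, b i ^ 2 := by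
      simp only [Pi.smul_apply, smul_eq_mul, mul_pow, Finset.mul_sum]
    -- The squared size of the deviation is a quadratic polynomial in `g`, and `γ` is its minimizer.
    -- As `g * cordesLhs = cordesTr`, the minimum is `n + 1 - g * cordesTr`, at most `1 - δ`.
    have e4 : frob (g • A - 1) (g • A - 1) + (∑ i, (g • b) i ^ 2) / (2 * lam) +
        (1 - g * (c / lam)) ^ 2 = g * (g * P.cordesLhs lam x α β) -
          2 * (g * P.cordesTr lam x α β) + (n + 1) := by
      rw [frob_smul_sub_one, e3, Coeffs.cordesLhs, Coeffs.cordesTr]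
      ring
    rw [e4, hgL]
    linarith
  have e2 : frob (1 : Matrix (Fin n) (Fin n) ℝ) 1 + (∑ i, (0 : Fin n → ℝ) i ^ 2) / (2 * lam) +
      (-1) ^ 2 = (n : ℝ) + 1 := by
    rw [frob_one_left]; simp
  rw [e2] at h2
  have h1' := h1.trans (mul_le_mul_of_nonneg_right (Real.sqrt_le_sqrt e1) (Real.sqrt_nonneg _))
  have e5 : g * (-frob A R - b ⬝ᵥ p + c * r) =
      -(frob (g • A - 1) R + (g • b) ⬝ᵥ p + (1 - g * (c / lam)) * (lam * r)) -
        (frob 1 R + (0 : Fin n → ℝ) ⬝ᵥ p + -1 * (lam * r)) := by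
    rw [frob_sub_left, frob_smul_left, smul_dotProduct, zero_dotProduct, smul_eq_mul]
    have : c / lam * (lam * r) = c * r := by field_simp
    linear_combination (-g) * this
  rw [e5, add_mul]
  refine (abs_sub _ _).trans ?_
  rw [abs_neg]
  exact add_le_add h1' h2

theorem continuous_linPart (hP : P.Admissible lam delta)
    (x : E n) (r : ℝ) (p : Fin n → ℝ) (R : Matrix (Fin n) (Fin n) ℝ) :
    Continuous fun q : 𝒜 × ℬ => P.linPart x r p R q.1 q.2 := by
  have hi : Continuous fun q : 𝒜 × ℬ => ((x, q.1, q.2) : E n × 𝒜 × ℬ) := by fun_prop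
  have hA : Continuous fun q : 𝒜 × ℬ => P.A x q.1 q.2 := hP.A_unifCont.continuous.comp hi
  have hb : Continuous fun q : 𝒜 × ℬ => P.b x q.1 q.2 := hP.b_unifCont.continuous.comp hi
  have hc : Continuous fun q : 𝒜 × ℬ => P.c x q.1 q.2 := hP.c_unifCont.continuous.comp hi
  have hf : Continuous fun q : 𝒜 × ℬ => P.f x q.1 q.2 := hP.f_unifCont.continuous.comp hi
  unfold Coeffs.linPart frob dotProduct
  refine (((continuous_finsetSum _ fun i _ => continuous_finsetSum _ fun j _ =>
    (hA.matrix_elem i j).mul continuous_const).neg.sub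
    (continuous_finsetSum _ fun i _ => ((continuous_apply i).comp hb).mul continuous_const)).add
    (hc.mul continuous_const)).sub hf

theorem continuous_gamma (hP : P.Admissible lam delta) (x : E n) :
    Continuous fun q : 𝒜 × ℬ => P.gamma lam x q.1 q.2 := by
  have hi : Continuous fun q : 𝒜 × ℬ => ((x, q.1, q.2) : E n × 𝒜 × ℬ) := by fun_prop
  have hA : Continuous fun q : 𝒜 × ℬ => P.A x q.1 q.2 := hP.A_unifCont.continuous.comp hi
  have hb : Continuous fun q : 𝒜 × ℬ => P.b x q.1 q.2 := hP.b_unifCont.continuous.comp hi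
  have hc : Continuous fun q : 𝒜 × ℬ => P.c x q.1 q.2 := hP.c_unifCont.continuous.comp hi
  have hL : Continuous fun q : 𝒜 × ℬ => P.cordesLhs lam x q.1 q.2 := by
    unfold Coeffs.cordesLhs frob
    exact ((continuous_finsetSum _ fun i _ => continuous_finsetSum _ fun j _ =>
      (hA.matrix_elem i j).mul (hA.matrix_elem i j)).add
      ((continuous_finsetSum _ fun i _ => ((continuous_apply i).comp hb).pow 2).div_const _)).add
      ((hc.pow 2).div_const _)
  have hT : Continuous fun q : 𝒜 × ℬ => P.cordesTr lam x q.1 q.2 := by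
    unfold Coeffs.cordesTr
    exact hA.matrix_trace.add (hc.div_const _)
  exact (hL.inv₀ fun q => (hP.cordesLhs_pos x q.1 q.2).ne').mul hT

variable [CompactSpace 𝒜] [CompactSpace ℬ] [Nonempty 𝒜] [Nonempty ℬ]

/-- For fixed `α, β` the source term cancels in the difference and the pointwise Cordes estimate
applies. Compactness of `𝒜` and `ℬ` supplies the bounds required by the inf-sup comparison. -/
theorem abs_Fgamma_sub_le (hP : P.Admissible lam delta) (x : E n) (r r' : ℝ) (p p' : Fin n → ℝ)
    (R R' : Matrix (Fin n) (Fin n) ℝ) :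
    |P.Fgamma lam x r p R - P.Fgamma lam x r' p' R'| ≤
      (Real.sqrt (1 - delta) + Real.sqrt ((n : ℝ) + 1)) *
        Real.sqrt (jetSq lam (r - r') (p - p') (R - R')) := by
  obtain ⟨M, hM⟩ := exists_abs_le ((hP.continuous_gamma x).mul (hP.continuous_linPart x r p R))
  obtain ⟨M', hM'⟩ :=
    exists_abs_le ((hP.continuous_gamma x).mul (hP.continuous_linPart x r' p' R'))
  refine abs_iInf_iSup_sub_le (M := max M M') (fun α β => (hM α β).trans (le_max_left _ _))
    (fun α β => (hM' α β).trans (le_max_right _ _)) fun α β => ?_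
  have e : P.gamma lam x α β * P.linPart x r p R α β -
      P.gamma lam x α β * P.linPart x r' p' R' α β =
      P.gamma lam x α β * (-frob (P.A x α β) (R - R') - P.b x α β ⬝ᵥ (p - p') +
        P.c x α β * (r - r')) := by
    rw [frob_sub_right, dotProduct_sub, Coeffs.linPart, Coeffs.linPart]
    ring
  rw [e]
  exact hP.abs_gamma_mul_le x α β _ _ _

theorem Fgamma_eq_zero (hP : P.Admissible lam delta)
    {x : E n} {r : ℝ} {p : Fin n → ℝ} {R : Matrix (Fin n) (Fin n) ℝ}
    (h : P.F x r p R = 0) : P.Fgamma lam x r p R = 0 := by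
  obtain ⟨M, hM⟩ := exists_abs_le (hP.continuous_linPart x r p R)
  obtain ⟨M', hM'⟩ := exists_abs_le ((hP.continuous_gamma x).mul (hP.continuous_linPart x r p R))
  obtain ⟨Γ, hΓ⟩ := exists_abs_le (hP.continuous_gamma x)
  exact iInf_iSup_mul_eq_zero (hP.gamma_pos x) (fun α β => (le_abs_self _).trans (hΓ α β)) hM hM' h

end Coeffs.Admissible

end PeriodicHJBI

namespace PeriodicHJBI

/-! ### Strongly monotone problems in finite dimension -/

/-- Zarantonello's theorem in finite dimension: a strongly monotone and Lipschitz continuous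
operator has a zero. -/
theorem exists_forall_eq_zero_of_strongMono {H : Type*} [NormedAddCommGroup H]
    [InnerProductSpace ℝ H] [FiniteDimensional ℝ H] (a : H → H → ℝ) {m L : ℝ}
    (hlin : ∀ w, IsLinearMap ℝ (a w)) (hm : 0 < m)
    (hmono : ∀ w v, m * ‖w - v‖ ^ 2 ≤ a w (w - v) - a v (w - v))
    (hlip : ∀ w w' v, |a w v - a w' v| ≤ L * ‖w - w'‖ * ‖v‖) :
    ∃ u, ∀ v, a u v = 0 := by
  have : CompleteSpace H := FiniteDimensional.complete ℝ H
  -- Enlarging the Lipschitz constant makes it positive and at least `m`, so that the contraction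
  -- factor below is the root of a nonnegative number.
  set L' := max L m
  have hL' : 0 < L' := hm.trans_le (le_max_right _ _)
  set T : H → H := fun w =>
    (InnerProductSpace.toDual ℝ H).symm ((hlin w).mk' (a w)).toContinuousLinearMap
  have hT : ∀ w v, inner ℝ (T w) v = a w v := fun w v => by
    simp only [T, InnerProductSpace.toDual_symm_apply]
    rfl
  have hTlip : ∀ w w', ‖T w - T w'‖ ≤ L' * ‖w - w'‖ := by
    intro w w'
    have h1 := hlip w w' (T w - T w')
    rw [← hT, ← hT, ← inner_sub_left, real_inner_self_eq_norm_sq, abs_of_nonneg (sq_nonneg _)] at h1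
    have h2 : L * ‖w - w'‖ ≤ L' * ‖w - w'‖ :=
      mul_le_mul_of_nonneg_right (le_max_left _ _) (norm_nonneg _)
    by_contra! hc
    have h3 : 0 < ‖T w - T w'‖ := lt_of_le_of_lt (by positivity) hc
    nlinarith
  -- This step size minimizes `1 - 2ρm + ρ²L'²`, the bound for the squared Lipschitz constant of `w
  -- ↦ w - ρ T w`; the minimum is `c`.
  set ρ := m / L' ^ 2
  set c := 1 - m ^ 2 / L' ^ 2
  have hc0 : 0 ≤ c := by
    have : m ^ 2 / L' ^ 2 ≤ 1 := by
      rw [div_le_one (by positivity)]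
      exact pow_le_pow_left₀ hm.le (le_max_right _ _) 2
    simp only [c]; linarith
  have hc1 : c < 1 := by
    have : 0 < m ^ 2 / L' ^ 2 := by positivity
    simp only [c]; linarith
  have hcontr : ∀ w w', ‖(w - ρ • T w) - (w' - ρ • T w')‖ ≤ Real.sqrt c * ‖w - w'‖ := by
    intro w w'
    have e : (w - ρ • T w) - (w' - ρ • T w') = (w - w') - ρ • (T w - T w') := by
      rw [smul_sub]; abel
    have h1 : ‖(w - ρ • T w) - (w' - ρ • T w')‖ ^ 2 ≤ c * ‖w - w'‖ ^ 2 := by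
      rw [e, norm_sub_sq_real, inner_smul_right, norm_smul, mul_pow, Real.norm_eq_abs, sq_abs]
      have h2 : m * ‖w - w'‖ ^ 2 ≤ inner ℝ (w - w') (T w - T w') := by
        rw [real_inner_comm, inner_sub_left, hT, hT]
        exact hmono w w'
      have h3 : ‖T w - T w'‖ ^ 2 ≤ L' ^ 2 * ‖w - w'‖ ^ 2 := by
        rw [← mul_pow]
        exact pow_le_pow_left₀ (norm_nonneg _) (hTlip w w') 2
      have hρ : 0 ≤ ρ := by positivity
      have h4 := mul_le_mul_of_nonneg_left h2 hρ
      have h5 := mul_le_mul_of_nonneg_left h3 (sq_nonneg ρ)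
      have h6 : ρ * m = m ^ 2 / L' ^ 2 := by simp only [ρ]; ring
      have h7 : ρ ^ 2 * L' ^ 2 = m ^ 2 / L' ^ 2 := by simp only [ρ]; field_simp
      have h8 : ρ * (m * ‖w - w'‖ ^ 2) = m ^ 2 / L' ^ 2 * ‖w - w'‖ ^ 2 := by
        rw [← mul_assoc, h6]
      have h9 : ρ ^ 2 * (L' ^ 2 * ‖w - w'‖ ^ 2) = m ^ 2 / L' ^ 2 * ‖w - w'‖ ^ 2 := by
        rw [← mul_assoc, h7]
      simp only [c]
      linarith
    calc _ = Real.sqrt (‖(w - ρ • T w) - (w' - ρ • T w')‖ ^ 2) :=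
          (Real.sqrt_sq (norm_nonneg _)).symm
      _ ≤ Real.sqrt (c * ‖w - w'‖ ^ 2) := Real.sqrt_le_sqrt h1
      _ = _ := by rw [Real.sqrt_mul hc0, Real.sqrt_sq (norm_nonneg _)]
  have hK : ContractingWith (Real.sqrt c).toNNReal fun w => w - ρ • T w := by
    constructor
    · rw [Real.toNNReal_lt_one]
      exact (Real.sqrt_lt' one_pos).2 (by simpa using hc1)
    · refine LipschitzWith.of_dist_le_mul fun w w' => ?_
      rw [dist_eq_norm, dist_eq_norm, Real.coe_toNNReal _ (Real.sqrt_nonneg _)]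
      exact hcontr w w'
  have hfix := hK.fixedPoint_isFixedPt
  set u := hK.fixedPoint
  refine ⟨u, fun v => ?_⟩
  have h0 : ρ • T u = 0 := by
    have : u - ρ • T u = u := hfix
    simpa using this
  have hρ0 : ρ ≠ 0 := by positivity
  rw [← hT, (smul_eq_zero.1 h0).resolve_left hρ0, inner_zero_left]

/-- Optimizing Young's inequality over `ε` recovers Minkowski's inequality. In this form the
triangle inequality for the mesh norm follows from pointwise estimates alone. -/
theorem sqrt_le_sqrt_add_sqrt {X A B : ℝ} (hA : 0 ≤ A) (hB : 0 ≤ B)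
    (h : ∀ ε : ℝ, 0 < ε → X ≤ (1 + ε) * A + (1 + ε⁻¹) * B) :
    Real.sqrt X ≤ Real.sqrt A + Real.sqrt B := by
  set a := Real.sqrt A with ha
  set b := Real.sqrt B with hb
  have ha0 : 0 ≤ a := Real.sqrt_nonneg _
  have hb0 : 0 ≤ b := Real.sqrt_nonneg _
  have hA2 : A = a ^ 2 := (Real.sq_sqrt hA).symm
  have hB2 : B = b ^ 2 := (Real.sq_sqrt hB).symm
  rw [Real.sqrt_le_left (by positivity)]
  have key : ∀ d : ℝ, 0 < d → X ≤ (a + b) ^ 2 + d * (a + b) := by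
    intro d hd
    -- The optimal choice is `ε = b / a`; the shift by `d` covers the cases `a = 0` and `b = 0` and
    -- costs `d * (a + b)`.
    have h1 := h ((b + d) / (a + d)) (by positivity)
    have h2 : (b + d) / (a + d) * a ^ 2 ≤ (b + d) * a := by
      rw [div_mul_eq_mul_div, div_le_iff₀ (by positivity)]
      nlinarith [mul_nonneg (mul_nonneg ha0 (by positivity : 0 ≤ b + d)) hd.le]
    have h3 : ((b + d) / (a + d))⁻¹ * b ^ 2 ≤ (a + d) * b := by
      rw [inv_div, div_mul_eq_mul_div, div_le_iff₀ (by positivity)]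
      nlinarith [mul_nonneg (mul_nonneg hb0 (by positivity : 0 ≤ a + d)) hd.le]
    rw [hA2, hB2] at h1
    nlinarith
  refine le_of_forall_pos_le_add fun e he => ?_
  refine (key (e / (a + b + 1)) (by positivity)).trans ?_
  have : e / (a + b + 1) * (a + b) ≤ e := by
    rw [div_mul_eq_mul_div, div_le_iff₀ (by positivity)]
    nlinarith
  linarith

end PeriodicHJBI

namespace PeriodicHJBI

variable {n : ℕ}

/-! ### Jumps -/

namespace Mesh

theorem hasTraceInequality (𝒯 : Mesh n) (hn : n ≠ 0) {s : Finset (E n)} (hs : s ∈ 𝒯.elems)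
    {S : Set (E n)} (hS : IsFacet s S) : HasTraceInequality (interior (cell s)) S :=
  hS.hasTraceInequality hn (𝒯.card_eq s hs) (𝒯.indep s hs)

theorem isFiniteMeasure_surf (𝒯 : Mesh n) (hn : n ≠ 0) {s : Finset (E n)} (hs : s ∈ 𝒯.elems)
    {S : Set (E n)} (hS : IsFacet s S) : IsFiniteMeasure (surf S) :=
  hS.isFiniteMeasure_surf hn (𝒯.card_eq s hs) (𝒯.indep s hs)

/-- By uniqueness of traces, any trace on either side may replace the chosen one. The null set on
the side of `q.1` is moved to the face by the measure-preserving translation. -/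
theorem jump_ae_eq (𝒯 : Mesh n) (hn : n ≠ 0)
    {q : Finset (E n) × Finset (E n) × (Fin n → ℤ)} (hq : q ∈ 𝒯.orientedFaces)
    {W : Finset (E n) → E n → ℝ} {τ σ : E n → ℝ}
    (hW : ∀ s ∈ 𝒯.elems, AEStronglyMeasurable (W s) (volume.restrict (interior (cell s))))
    (hτ : IsTrace (interior (cell q.2.1)) (facePts q) (W q.2.1) τ)
    (hσ : IsTrace (interior (cell q.1)) ((fun y => y - latticeVec q.2.2) '' facePts q) (W q.1) σ) :
    jump W q =ᵐ[surf (facePts q)] fun x => τ x - σ (x - latticeVec q.2.2) := by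
  obtain ⟨h1, f1⟩ := 𝒯.isFacet_fst hq
  obtain ⟨h2, f2⟩ := 𝒯.isFacet_snd hq
  have e2 := hτ.trace_ae_eq (𝒯.hasTraceInequality hn h2 f2) (hW _ h2)
  have e1 := hσ.trace_ae_eq (𝒯.hasTraceInequality hn h1 f1) (hW _ h1)
  have e1' := (measurePreserving_sub_surf f2.isCompact (latticeVec q.2.2)).quasiMeasurePreserving.ae
    e1
  filter_upwards [e2, e1'] with x hx hx'
  simp only [jump, hx, hx']

/-- Traces are linear because they are unique. The functions are families indexed by elements so
that elementwise derivatives are covered. `W''` is only almost everywhere a combination, as is the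
case for chosen weak derivatives. -/
theorem jump_comb (𝒯 : Mesh n) (hn : n ≠ 0)
    {q : Finset (E n) × Finset (E n) × (Fin n → ℤ)} (hq : q ∈ 𝒯.orientedFaces)
    {W W' W'' : Finset (E n) → E n → ℝ} (r r' : ℝ)
    (hW : ∀ s ∈ 𝒯.elems, HasWeakGrad (interior (cell s)) (W s))
    (hW' : ∀ s ∈ 𝒯.elems, HasWeakGrad (interior (cell s)) (W' s))
    (hW'' : ∀ s ∈ 𝒯.elems, W'' s =ᵐ[volume.restrict (interior (cell s))]
      fun x => r * W s x + r' * W' s x)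
    (ht : ∀ s ∈ 𝒯.elems, ∀ S, IsFacet s S → ∃ τ, IsTrace (interior (cell s)) S (W s) τ)
    (ht' : ∀ s ∈ 𝒯.elems, ∀ S, IsFacet s S → ∃ τ, IsTrace (interior (cell s)) S (W' s) τ) :
    jump W'' q =ᵐ[surf (facePts q)] fun x => r * jump W q x + r' * jump W' q x := by
  obtain ⟨h1, f1⟩ := 𝒯.isFacet_fst hq
  obtain ⟨h2, f2⟩ := 𝒯.isFacet_snd hq
  have key : ∀ s ∈ 𝒯.elems, ∀ S, IsFacet s S →
      trace (interior (cell s)) S (W'' s) =ᵐ[surf S] fun x =>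
        r * trace (interior (cell s)) S (W s) x + r' * trace (interior (cell s)) S (W' s) x := by
    intro s hs S hS
    obtain ⟨τ, hτ⟩ := ht s hs S hS
    obtain ⟨τ', hτ'⟩ := ht' s hs S hS
    have hc := hτ.isTrace_trace.comb isOpen_interior (hW s hs) (hW' s hs) r r' hτ'.isTrace_trace
    rw [trace_congr (hW'' s hs)]
    exact hc.trace_ae_eq (𝒯.hasTraceInequality hn hs hS)
      ((hW s hs).comb (hW' s hs) r r').1.aestronglyMeasurable
  have e1 := (measurePreserving_sub_surf f2.isCompact (latticeVec q.2.2)).quasiMeasurePreserving.ae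
    (key _ h1 _ f1)
  filter_upwards [key _ h2 _ f2, e1] with x hx hx'
  simp only [jump, hx, hx']
  ring

/-! ### Elementwise regular functions -/

/-- Functions with square integrable elementwise weak derivatives up to order two, traces on the
faces of the elements, and square integrable jumps. -/
structure IsRegular (𝒯 : Mesh n) (w : E n → ℝ) : Prop where
  grad : ∀ s ∈ 𝒯.elems, HasWeakGrad (interior (cell s)) w
  hess : ∀ s ∈ 𝒯.elems, ∀ i, HasWeakGrad (interior (cell s)) (weakPartial (interior (cell s)) i w)
  memLp : ∀ s ∈ 𝒯.elems, MemLp w 2 (volume.restrict (interior (cell s)))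
  grad_memLp : ∀ s ∈ 𝒯.elems, ∀ i,
    MemLp (weakPartial (interior (cell s)) i w) 2 (volume.restrict (interior (cell s)))
  hess_memLp : ∀ s ∈ 𝒯.elems, ∀ i j,
    MemLp (weakPartial (interior (cell s)) j (weakPartial (interior (cell s)) i w)) 2
      (volume.restrict (interior (cell s)))
  trace : ∀ s ∈ 𝒯.elems, ∀ S, IsFacet s S → ∃ τ, IsTrace (interior (cell s)) S w τ
  grad_trace : ∀ s ∈ 𝒯.elems, ∀ S, IsFacet s S → ∀ i,
    ∃ τ, IsTrace (interior (cell s)) S (weakPartial (interior (cell s)) i w) τ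
  jump_memLp : ∀ q ∈ 𝒯.orientedFaces, MemLp (jump (fun _ => w) q) 2 (surf (facePts q))
  grad_jump_memLp : ∀ q ∈ 𝒯.orientedFaces, ∀ i,
    MemLp (jump (fun r => weakPartial (interior (cell r)) i w) q) 2 (surf (facePts q))

section Congr

variable (𝒯 : Mesh n) {w w' : E n → ℝ}

theorem weakPartial_congr (hw : w =ᵐ[volume.restrict (Y n)] w') {s : Finset (E n)}
    (hs : s ∈ 𝒯.elems) (i : Fin n) :
    weakPartial (interior (cell s)) i w = weakPartial (interior (cell s)) i w' :=
  PeriodicHJBI.weakPartial_congr i (𝒯.ae_interior_of_ae hs hw)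

theorem jump_congr (hw : w =ᵐ[volume.restrict (Y n)] w')
    {q : Finset (E n) × Finset (E n) × (Fin n → ℤ)} (hq : q ∈ 𝒯.orientedFaces) :
    jump (fun _ => w) q = jump (fun _ => w') q := by
  have h1 := trace_congr (S := (fun y => y - latticeVec q.2.2) '' facePts q)
    (𝒯.ae_interior_of_ae (𝒯.isFacet_fst hq).1 hw)
  have h2 := trace_congr (S := facePts q) (𝒯.ae_interior_of_ae (𝒯.isFacet_snd hq).1 hw)
  funext x
  simp only [jump, h1, h2]

theorem jump_weakPartial_congr (hw : w =ᵐ[volume.restrict (Y n)] w')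
    {q : Finset (E n) × Finset (E n) × (Fin n → ℤ)} (hq : q ∈ 𝒯.orientedFaces) (i : Fin n) :
    jump (fun r => weakPartial (interior (cell r)) i w) q =
      jump (fun r => weakPartial (interior (cell r)) i w') q := by
  funext x
  simp only [jump, 𝒯.weakPartial_congr hw (𝒯.isFacet_fst hq).1,
    𝒯.weakPartial_congr hw (𝒯.isFacet_snd hq).1]

theorem pwGrad_congr (hw : w =ᵐ[volume.restrict (Y n)] w') : 𝒯.pwGrad w = 𝒯.pwGrad w' := by
  funext x
  refine Finset.sum_congr rfl fun s hs => ?_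
  unfold weakGrad
  simp only [𝒯.weakPartial_congr hw hs]

theorem pwHess_congr (hw : w =ᵐ[volume.restrict (Y n)] w') : 𝒯.pwHess w = 𝒯.pwHess w' := by
  funext x
  refine Finset.sum_congr rfl fun s hs => ?_
  unfold weakHess
  simp only [𝒯.weakPartial_congr hw hs]

theorem jumpSq_congr (hw : w =ᵐ[volume.restrict (Y n)] w') : 𝒯.jumpSq w = 𝒯.jumpSq w' := by
  unfold jumpSq
  congr 1
  refine Finset.sum_congr rfl fun q hq => ?_
  simp only [𝒯.jump_congr hw hq, 𝒯.jump_weakPartial_congr hw hq]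

/-- The square of the norm `‖w‖_{𝒯,λ}`. -/
noncomputable def dgSq (𝒯 : Mesh n) (lam : ℝ) (w : E n → ℝ) : ℝ :=
  (∫ x in Y n, jetSq lam (w x) (𝒯.pwGrad w x) (𝒯.pwHess w x)) + 𝒯.jumpSq w

theorem dgNorm_eq (lam : ℝ) (w : E n → ℝ) : 𝒯.dgNorm lam w = Real.sqrt (𝒯.dgSq lam w) := rfl

theorem dgSq_congr (lam : ℝ) (hw : w =ᵐ[volume.restrict (Y n)] w') :
    𝒯.dgSq lam w = 𝒯.dgSq lam w' := by
  unfold dgSq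
  rw [𝒯.jumpSq_congr hw, 𝒯.pwGrad_congr hw, 𝒯.pwHess_congr hw]
  congr 1
  exact integral_congr_ae (hw.mono fun x hx => by simp only [hx])

theorem dgNorm_congr (lam : ℝ) (hw : w =ᵐ[volume.restrict (Y n)] w') :
    𝒯.dgNorm lam w = 𝒯.dgNorm lam w' := by
  rw [dgNorm_eq, dgNorm_eq, 𝒯.dgSq_congr lam hw]

variable {𝒯} in
theorem IsRegular.congr (h : 𝒯.IsRegular w) (hw : w =ᵐ[volume.restrict (Y n)] w') :
    𝒯.IsRegular w' where
  grad s hs := (h.grad s hs).congr (𝒯.ae_interior_of_ae hs hw)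
  hess s hs i := 𝒯.weakPartial_congr hw hs i ▸ h.hess s hs i
  memLp s hs := (h.memLp s hs).ae_eq (𝒯.ae_interior_of_ae hs hw)
  grad_memLp s hs i := 𝒯.weakPartial_congr hw hs i ▸ h.grad_memLp s hs i
  hess_memLp s hs i j := 𝒯.weakPartial_congr hw hs i ▸ h.hess_memLp s hs i j
  trace s hs S hS := (h.trace s hs S hS).imp fun _ hτ => hτ.congr (𝒯.ae_interior_of_ae hs hw)
  grad_trace s hs S hS i := 𝒯.weakPartial_congr hw hs i ▸ h.grad_trace s hs S hS i
  jump_memLp q hq := 𝒯.jump_congr hw hq ▸ h.jump_memLp q hq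
  grad_jump_memLp q hq i := 𝒯.jump_weakPartial_congr hw hq i ▸ h.grad_jump_memLp q hq i

end Congr

namespace IsRegular

variable {𝒯 : Mesh n} {w w' : E n → ℝ}

theorem weakPartial_comb (h : 𝒯.IsRegular w) (h' : 𝒯.IsRegular w') (r r' : ℝ)
    {s : Finset (E n)} (hs : s ∈ 𝒯.elems) (i : Fin n) :
    weakPartial (interior (cell s)) i (fun x => r * w x + r' * w' x)
      =ᵐ[volume.restrict (interior (cell s))] fun x =>
        r * weakPartial (interior (cell s)) i w x + r' * weakPartial (interior (cell s)) i w' x :=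
  (h.grad s hs).weakPartial_comb isOpen_interior (h'.grad s hs) r r' i

theorem weakPartial_weakPartial_comb (h : 𝒯.IsRegular w) (h' : 𝒯.IsRegular w') (r r' : ℝ)
    {s : Finset (E n)} (hs : s ∈ 𝒯.elems) (i j : Fin n) :
    weakPartial (interior (cell s)) j
        (weakPartial (interior (cell s)) i (fun x => r * w x + r' * w' x))
      =ᵐ[volume.restrict (interior (cell s))] fun x =>
        r * weakPartial (interior (cell s)) j (weakPartial (interior (cell s)) i w) x +
        r' * weakPartial (interior (cell s)) j (weakPartial (interior (cell s)) i w') x := by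
  rw [PeriodicHJBI.weakPartial_congr j (h.weakPartial_comb h' r r' hs i)]
  exact (h.hess s hs i).weakPartial_comb isOpen_interior (h'.hess s hs i) r r' j

theorem jump_comb (h : 𝒯.IsRegular w) (h' : 𝒯.IsRegular w') (hn : n ≠ 0) (r r' : ℝ)
    {q : Finset (E n) × Finset (E n) × (Fin n → ℤ)} (hq : q ∈ 𝒯.orientedFaces) :
    jump (fun _ x => r * w x + r' * w' x) q =ᵐ[surf (facePts q)] fun x =>
      r * jump (fun _ => w) q x + r' * jump (fun _ => w') q x :=
  𝒯.jump_comb hn hq r r' h.grad h'.grad (fun _ _ => EventuallyEq.rfl) h.trace h'.trace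

theorem jump_weakPartial_comb (h : 𝒯.IsRegular w) (h' : 𝒯.IsRegular w') (hn : n ≠ 0) (r r' : ℝ)
    {q : Finset (E n) × Finset (E n) × (Fin n → ℤ)} (hq : q ∈ 𝒯.orientedFaces) (i : Fin n) :
    jump (fun s => weakPartial (interior (cell s)) i (fun x => r * w x + r' * w' x)) q
      =ᵐ[surf (facePts q)] fun x =>
      r * jump (fun s => weakPartial (interior (cell s)) i w) q x +
      r' * jump (fun s => weakPartial (interior (cell s)) i w') q x :=
  𝒯.jump_comb hn hq r r' (fun s hs => h.hess s hs i) (fun s hs => h'.hess s hs i)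
    (fun _ hs => h.weakPartial_comb h' r r' hs i) (fun s hs S hS => h.grad_trace s hs S hS i)
    (fun s hs S hS => h'.grad_trace s hs S hS i)

/-- Linear combinations of regular functions are regular. -/
theorem comb (h : 𝒯.IsRegular w) (h' : 𝒯.IsRegular w') (hn : n ≠ 0) (r r' : ℝ) :
    𝒯.IsRegular (fun x => r * w x + r' * w' x) where
  grad s hs := (h.grad s hs).comb (h'.grad s hs) r r'
  hess s hs i := ((h.hess s hs i).comb (h'.hess s hs i) r r').congr
    (h.weakPartial_comb h' r r' hs i).symm
  memLp s hs := ((h.memLp s hs).const_mul r).add ((h'.memLp s hs).const_mul r')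
  grad_memLp s hs i := (((h.grad_memLp s hs i).const_mul r).add
    ((h'.grad_memLp s hs i).const_mul r')).ae_eq (h.weakPartial_comb h' r r' hs i).symm
  hess_memLp s hs i j := (((h.hess_memLp s hs i j).const_mul r).add
    ((h'.hess_memLp s hs i j).const_mul r')).ae_eq
      (h.weakPartial_weakPartial_comb h' r r' hs i j).symm
  trace s hs S hS := by
    obtain ⟨τ, hτ⟩ := h.trace s hs S hS
    obtain ⟨τ', hτ'⟩ := h'.trace s hs S hS
    exact ⟨_, hτ.comb isOpen_interior (h.grad s hs) (h'.grad s hs) r r' hτ'⟩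
  grad_trace s hs S hS i := by
    obtain ⟨τ, hτ⟩ := h.grad_trace s hs S hS i
    obtain ⟨τ', hτ'⟩ := h'.grad_trace s hs S hS i
    have hc := hτ.comb isOpen_interior (h.hess s hs i) (h'.hess s hs i) r r' hτ'
    exact ⟨_, hc.congr (h.weakPartial_comb h' r r' hs i).symm⟩
  jump_memLp q hq := (((h.jump_memLp q hq).const_mul r).add
    ((h'.jump_memLp q hq).const_mul r')).ae_eq (h.jump_comb h' hn r r' hq).symm
  grad_jump_memLp q hq i := (((h.grad_jump_memLp q hq i).const_mul r).add
    ((h'.grad_jump_memLp q hq i).const_mul r')).ae_eq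
      (h.jump_weakPartial_comb h' hn r r' hq i).symm

end IsRegular

end Mesh

end PeriodicHJBI

namespace PeriodicHJBI

variable {n : ℕ}

/-! ### The mesh-dependent norm on regular functions -/

/-- Young's inequality for the mixed term, from the square of `ε r a - r' b`. -/
theorem sq_comb_le {ε : ℝ} (hε : 0 < ε) (r r' a b : ℝ) :
    (r * a + r' * b) ^ 2 ≤ (1 + ε) * r ^ 2 * a ^ 2 + (1 + ε⁻¹) * r' ^ 2 * b ^ 2 := by
  have h1 : 0 ≤ ε⁻¹ * (ε * (r * a) - r' * b) ^ 2 := by positivity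
  have h2 : ε⁻¹ * (ε * (r * a) - r' * b) ^ 2 =
      ε * (r * a) ^ 2 - 2 * (r * a) * (r' * b) + ε⁻¹ * (r' * b) ^ 2 := by
    field_simp
    ring
  nlinarith

theorem jetSq_comb_le {lam ε : ℝ} (hlam : 0 < lam) (hε : 0 < ε) (r r' a a' : ℝ)
    (p p' : Fin n → ℝ) (R R' : Matrix (Fin n) (Fin n) ℝ) :
    jetSq lam (r * a + r' * a') (r • p + r' • p') (r • R + r' • R') ≤
      (1 + ε) * r ^ 2 * jetSq lam a p R + (1 + ε⁻¹) * r' ^ 2 * jetSq lam a' p' R' := by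
  have h1 : frob (r • R + r' • R') (r • R + r' • R') ≤
      (1 + ε) * r ^ 2 * frob R R + (1 + ε⁻¹) * r' ^ 2 * frob R' R' := by
    simp only [frob, Finset.mul_sum, ← Finset.sum_add_distrib]
    refine Finset.sum_le_sum fun i _ => Finset.sum_le_sum fun j _ => ?_
    simp only [← sq]
    exact sq_comb_le hε r r' (R i j) (R' i j)
  have h2 : ∑ i, (r • p + r' • p') i ^ 2 ≤
      (1 + ε) * r ^ 2 * ∑ i, p i ^ 2 + (1 + ε⁻¹) * r' ^ 2 * ∑ i, p' i ^ 2 := by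
    simp only [Finset.mul_sum, ← Finset.sum_add_distrib]
    exact Finset.sum_le_sum fun i _ => sq_comb_le hε r r' (p i) (p' i)
  have h3 := sq_comb_le hε r r' a a'
  have h2' := mul_le_mul_of_nonneg_left h2 (by positivity : 0 ≤ 2 * lam)
  have h3' := mul_le_mul_of_nonneg_left h3 (by positivity : 0 ≤ lam ^ 2)
  unfold jetSq
  linarith

theorem faceSize_nonneg (S : Set (E n)) : 0 ≤ faceSize S :=
  Real.rpow_nonneg measureReal_nonneg _

namespace Mesh

theorem jumpSq_nonneg (𝒯 : Mesh n) (w : E n → ℝ) : 0 ≤ 𝒯.jumpSq w := by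
  refine mul_nonneg (by norm_num) (Finset.sum_nonneg fun q _ => ?_)
  have h := inv_nonneg.2 (faceSize_nonneg (facePts q))
  exact add_nonneg (mul_nonneg h (integral_nonneg fun _ =>
      Finset.sum_nonneg fun i _ => sq_nonneg _))
    (mul_nonneg (pow_nonneg h 3) (integral_nonneg fun _ => sq_nonneg _))

theorem dgSq_nonneg (𝒯 : Mesh n) {lam : ℝ} (hlam : 0 < lam) (w : E n → ℝ) :
    0 ≤ 𝒯.dgSq lam w :=
  add_nonneg (integral_nonneg fun _ => jetSq_nonneg hlam _ _ _) (𝒯.jumpSq_nonneg w)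

namespace IsRegular

variable {𝒯 : Mesh n} {w w' : E n → ℝ}

theorem integrable_jetSq (h : 𝒯.IsRegular w) (lam : ℝ) :
    Integrable (fun x => jetSq lam (w x) (𝒯.pwGrad w x) (𝒯.pwHess w x))
      (volume.restrict (Y n)) := by
  have h1 : IntegrableOn (fun x => jetSq lam (w x) (𝒯.pwGrad w x) (𝒯.pwHess w x))
      (⋃ s ∈ 𝒯.elems, interior (cell s)) := by
    rw [integrableOn_finset_iUnion]
    intro s hs
    have h2 : Integrable (fun x => jetSq lam (w x) (weakGrad (interior (cell s)) w x)
        (weakHess (interior (cell s)) w x)) (volume.restrict (interior (cell s))) := by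
      unfold jetSq frob weakGrad weakHess
      simp only [Matrix.of_apply, ← sq]
      exact ((integrable_finsetSum _ fun i _ => integrable_finsetSum _ fun j _ =>
        (h.hess_memLp s hs i j).integrable_sq).add ((integrable_finsetSum _ fun i _ =>
        (h.grad_memLp s hs i).integrable_sq).const_mul _)).add
        ((h.memLp s hs).integrable_sq.const_mul _)
    refine h2.congr ?_
    filter_upwards [ae_restrict_mem isOpen_interior.measurableSet] with x hx
    rw [𝒯.pwGrad_eq hs w hx, 𝒯.pwHess_eq hs w hx]
  refine h1.mono_set_ae ?_
  have := (ae_restrict_iff' (isOpen_Y n).measurableSet).1 𝒯.ae_mem_interior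
  filter_upwards [this] with x hx hxY
  obtain ⟨s, hs, hxs⟩ := hx hxY
  exact mem_iUnion₂.2 ⟨s, hs, hxs⟩

theorem pwGrad_comb (h : 𝒯.IsRegular w) (h' : 𝒯.IsRegular w') (r r' : ℝ) :
    ∀ᵐ x ∂(volume.restrict (Y n)), 𝒯.pwGrad (fun x => r * w x + r' * w' x) x =
      r • 𝒯.pwGrad w x + r' • 𝒯.pwGrad w' x := by
  refine 𝒯.ae_of_forall_elems fun s hs => ?_
  filter_upwards [ae_restrict_mem isOpen_interior.measurableSet,
    ae_all_iff.2 fun i => h.weakPartial_comb h' r r' hs i] with x hx hxi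
  rw [𝒯.pwGrad_eq hs _ hx, 𝒯.pwGrad_eq hs _ hx, 𝒯.pwGrad_eq hs _ hx]
  funext i
  exact hxi i

theorem pwHess_comb (h : 𝒯.IsRegular w) (h' : 𝒯.IsRegular w') (r r' : ℝ) :
    ∀ᵐ x ∂(volume.restrict (Y n)), 𝒯.pwHess (fun x => r * w x + r' * w' x) x =
      r • 𝒯.pwHess w x + r' • 𝒯.pwHess w' x := by
  refine 𝒯.ae_of_forall_elems fun s hs => ?_
  filter_upwards [ae_restrict_mem isOpen_interior.measurableSet,
    ae_all_iff.2 fun i => ae_all_iff.2 fun j => h.weakPartial_weakPartial_comb h' r r' hs i j]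
    with x hx hxi
  rw [𝒯.pwHess_eq hs _ hx, 𝒯.pwHess_eq hs _ hx, 𝒯.pwHess_eq hs _ hx]
  ext i j
  exact hxi i j

/-- Jumps are linear almost everywhere on each face, so Young's inequality can be integrated there.
Square integrability of the jumps prevents the Bochner integrals on the right from defaulting to
zero. -/
theorem jumpSq_comb_le (h : 𝒯.IsRegular w) (h' : 𝒯.IsRegular w') (hn : n ≠ 0) {ε : ℝ}
    (hε : 0 < ε) (r r' : ℝ) :
    𝒯.jumpSq (fun x => r * w x + r' * w' x) ≤
      (1 + ε) * r ^ 2 * 𝒯.jumpSq w + (1 + ε⁻¹) * r' ^ 2 * 𝒯.jumpSq w' := by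
  have key : ∀ q ∈ 𝒯.orientedFaces, ∀ {f g k : E n → ℝ},
      MemLp f 2 (surf (facePts q)) → MemLp g 2 (surf (facePts q)) →
      k =ᵐ[surf (facePts q)] (fun x => r * f x + r' * g x) →
      ∫ x, k x ^ 2 ∂(surf (facePts q)) ≤ (1 + ε) * r ^ 2 * (∫ x, f x ^ 2 ∂(surf (facePts q))) +
        (1 + ε⁻¹) * r' ^ 2 * ∫ x, g x ^ 2 ∂(surf (facePts q)) := by
    intro q hq f g k hf hg hk
    have i1 := hf.integrable_sq.const_mul ((1 + ε) * r ^ 2)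
    have i2 := hg.integrable_sq.const_mul ((1 + ε⁻¹) * r' ^ 2)
    rw [← integral_const_mul, ← integral_const_mul, ← integral_add i1 i2]
    refine integral_mono_of_nonneg (Eventually.of_forall fun _ => sq_nonneg _) (i1.add i2) ?_
    filter_upwards [hk] with x hx
    rw [hx]
    exact sq_comb_le hε r r' (f x) (g x)
  have hsum : ∀ q ∈ 𝒯.orientedFaces,
      (faceSize (facePts q))⁻¹ *
        (∫ x, ∑ i, jump (fun s => weakPartial (interior (cell s)) i
          (fun x => r * w x + r' * w' x)) q x ^ 2 ∂(surf (facePts q))) +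
      (faceSize (facePts q))⁻¹ ^ 3 *
        ∫ x, jump (fun _ x => r * w x + r' * w' x) q x ^ 2 ∂(surf (facePts q)) ≤
      (1 + ε) * r ^ 2 * ((faceSize (facePts q))⁻¹ *
        (∫ x, ∑ i, jump (fun s => weakPartial (interior (cell s)) i w) q x ^ 2
          ∂(surf (facePts q))) +
      (faceSize (facePts q))⁻¹ ^ 3 *
        ∫ x, jump (fun _ => w) q x ^ 2 ∂(surf (facePts q))) +
      (1 + ε⁻¹) * r' ^ 2 * ((faceSize (facePts q))⁻¹ *
        (∫ x, ∑ i, jump (fun s => weakPartial (interior (cell s)) i w') q x ^ 2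
          ∂(surf (facePts q))) +
      (faceSize (facePts q))⁻¹ ^ 3 *
        ∫ x, jump (fun _ => w') q x ^ 2 ∂(surf (facePts q))) := by
    intro q hq
    have hS := inv_nonneg.2 (faceSize_nonneg (facePts q))
    have hc := (h.comb h' hn r r').grad_jump_memLp q hq
    rw [integral_finsetSum _ fun i _ => (hc i).integrable_sq,
      integral_finsetSum _ fun i _ => (h.grad_jump_memLp q hq i).integrable_sq,
      integral_finsetSum _ fun i _ => (h'.grad_jump_memLp q hq i).integrable_sq]
    have h1 := Finset.sum_le_sum fun (i : Fin n) (_ : i ∈ Finset.univ) =>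
      key q hq (h.grad_jump_memLp q hq i) (h'.grad_jump_memLp q hq i)
        (h.jump_weakPartial_comb h' hn r r' hq i)
    rw [Finset.sum_add_distrib, ← Finset.mul_sum, ← Finset.mul_sum] at h1
    have h2 := key q hq (h.jump_memLp q hq) (h'.jump_memLp q hq) (h.jump_comb h' hn r r' hq)
    have h1' := mul_le_mul_of_nonneg_left h1 hS
    have h2' := mul_le_mul_of_nonneg_left h2 (pow_nonneg hS 3)
    linarith
  have := (Finset.sum_le_sum hsum).trans_eq Finset.sum_add_distrib
  rw [← Finset.mul_sum, ← Finset.mul_sum] at this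
  unfold jumpSq
  linarith

theorem dgSq_comb_le (h : 𝒯.IsRegular w) (h' : 𝒯.IsRegular w') (hn : n ≠ 0) {lam ε : ℝ}
    (hlam : 0 < lam) (hε : 0 < ε) (r r' : ℝ) :
    𝒯.dgSq lam (fun x => r * w x + r' * w' x) ≤
      (1 + ε) * r ^ 2 * 𝒯.dgSq lam w + (1 + ε⁻¹) * r' ^ 2 * 𝒯.dgSq lam w' := by
  have h1 := h.jumpSq_comb_le h' hn hε r r'
  have i1 := (h.integrable_jetSq lam).const_mul ((1 + ε) * r ^ 2)
  have i2 := (h'.integrable_jetSq lam).const_mul ((1 + ε⁻¹) * r' ^ 2)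
  have h2 : ∫ x in Y n, jetSq lam (r * w x + r' * w' x)
      (𝒯.pwGrad (fun x => r * w x + r' * w' x) x) (𝒯.pwHess (fun x => r * w x + r' * w' x) x) ≤
      (1 + ε) * r ^ 2 * (∫ x in Y n, jetSq lam (w x) (𝒯.pwGrad w x) (𝒯.pwHess w x)) +
      (1 + ε⁻¹) * r' ^ 2 * ∫ x in Y n, jetSq lam (w' x) (𝒯.pwGrad w' x) (𝒯.pwHess w' x) := by
    rw [← integral_const_mul, ← integral_const_mul, ← integral_add i1 i2]
    refine integral_mono_of_nonneg (Eventually.of_forall fun _ => jetSq_nonneg hlam _ _ _)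
      (i1.add i2) ?_
    filter_upwards [h.pwGrad_comb h' r r', h.pwHess_comb h' r r'] with x hx hx'
    rw [hx, hx']
    exact jetSq_comb_le hlam hε _ _ _ _ _ _ _ _
  unfold dgSq
  linarith

/-- Homogeneity and the triangle inequality in one: `dgSq_comb_le` holds for every `ε`, and
`sqrt_le_sqrt_add_sqrt` removes `ε`. -/
theorem dgNorm_comb_le (h : 𝒯.IsRegular w) (h' : 𝒯.IsRegular w') (hn : n ≠ 0) {lam : ℝ}
    (hlam : 0 < lam) (r r' : ℝ) :
    𝒯.dgNorm lam (fun x => r * w x + r' * w' x) ≤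
      |r| * 𝒯.dgNorm lam w + |r'| * 𝒯.dgNorm lam w' := by
  have h0 := 𝒯.dgSq_nonneg hlam w
  have h0' := 𝒯.dgSq_nonneg hlam w'
  have := sqrt_le_sqrt_add_sqrt (X := 𝒯.dgSq lam (fun x => r * w x + r' * w' x))
    (mul_nonneg (sq_nonneg r) h0) (mul_nonneg (sq_nonneg r') h0') fun ε hε => by
      have := h.dgSq_comb_le h' hn hlam hε r r'
      linarith
  rwa [Real.sqrt_mul (sq_nonneg r), Real.sqrt_mul (sq_nonneg r'), Real.sqrt_sq_eq_abs,
    Real.sqrt_sq_eq_abs] at this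

end IsRegular

end Mesh

/-! ### Piecewise polynomials are regular -/

/-- Evaluation of a polynomial at a point of Euclidean space. -/
noncomputable def polyFun (P : MvPolynomial (Fin n) ℝ) (x : E n) : ℝ :=
  MvPolynomial.eval (fun i => x i) P

theorem contDiff_polyFun (P : MvPolynomial (Fin n) ℝ) : ContDiff ℝ ∞ (polyFun P) := by
  induction P using MvPolynomial.induction_on with
  | C a =>
    have : polyFun (MvPolynomial.C a) = fun _ : E n => a := by
      funext x; simp [polyFun]
    rw [this]
    exact contDiff_const
  | add p q hp hq =>
    have : polyFun (p + q) = fun x => polyFun p x + polyFun q x := by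
      funext x; simp [polyFun]
    rw [this]
    exact hp.add hq
  | mul_X p i hp =>
    have : polyFun (p * MvPolynomial.X i) = fun x => polyFun p x * x i := by
      funext x; simp [polyFun]
    rw [this]
    exact hp.mul (contDiff_piLp_apply (p := 2) (i := i))

theorem memLp_interior_cell (s : Finset (E n)) {g : E n → ℝ} (hg : Continuous g) (p : ℝ≥0∞) :
    MemLp g p (volume.restrict (interior (cell s))) := by
  obtain ⟨C, hC⟩ := (isCompact_cell s).exists_bound_of_continuousOn hg.continuousOn
  refine MemLp.of_bound hg.aestronglyMeasurable C ?_
  exact (ae_restrict_iff' isOpen_interior.measurableSet).2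
    (Eventually.of_forall fun x hx => hC x (interior_subset hx))

theorem hasWeakGrad_of_contDiff {Ω : Set (E n)} {P : E n → ℝ} (hP : ContDiff ℝ ∞ P) :
    HasWeakGrad Ω P :=
  ⟨hP.continuous.locallyIntegrable.locallyIntegrableOn _,
    fun i => ⟨_, isWeakPartial_of_contDiff i hP⟩⟩

namespace Mesh

/-- The jump is almost everywhere a difference of continuous functions on a compact face of finite
measure. -/
theorem memLp_jump_of_contDiff (𝒯 : Mesh n) (hn : n ≠ 0) {W : Finset (E n) → E n → ℝ}
    (h : ∀ s ∈ 𝒯.elems, ∃ P : E n → ℝ, ContDiff ℝ ∞ P ∧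
      W s =ᵐ[volume.restrict (interior (cell s))] P)
    {q : Finset (E n) × Finset (E n) × (Fin n → ℤ)} (hq : q ∈ 𝒯.orientedFaces) :
    MemLp (jump W q) 2 (surf (facePts q)) := by
  obtain ⟨h1, f1⟩ := 𝒯.isFacet_fst hq
  obtain ⟨h2, f2⟩ := 𝒯.isFacet_snd hq
  obtain ⟨P, hP, hWP⟩ := h _ h2
  obtain ⟨Q, hQ, hWQ⟩ := h _ h1
  have := 𝒯.isFiniteMeasure_surf hn h2 f2
  have hW : ∀ s ∈ 𝒯.elems, AEStronglyMeasurable (W s) (volume.restrict (interior (cell s))) := by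
    intro s hs
    obtain ⟨P, hP, hWP⟩ := h s hs
    exact hP.continuous.aestronglyMeasurable.congr hWP.symm
  have e := 𝒯.jump_ae_eq hn hq hW ((isTrace_of_contDiff isOpen_interior hP).congr hWP.symm)
    ((isTrace_of_contDiff isOpen_interior hQ).congr hWQ.symm)
  refine (memLp_surf f2.isCompact ?_ 2).ae_eq e.symm
  exact hP.continuous.sub (hQ.continuous.comp (by fun_prop))

/-- Elementwise derivatives of piecewise smooth functions are again piecewise smooth, so each
condition need only be checked for one piecewise smooth function at a time. -/
theorem isRegular_of_piecewise_contDiff (𝒯 : Mesh n) (hn : n ≠ 0) {w : E n → ℝ}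
    (h : ∀ s ∈ 𝒯.elems, ∃ P : E n → ℝ, ContDiff ℝ ∞ P ∧
      w =ᵐ[volume.restrict (interior (cell s))] P) : 𝒯.IsRegular w := by
  have h1 : ∀ i, ∀ s ∈ 𝒯.elems, ∃ P : E n → ℝ, ContDiff ℝ ∞ P ∧
      weakPartial (interior (cell s)) i w =ᵐ[volume.restrict (interior (cell s))] P := by
    intro i s hs
    obtain ⟨P, hP, hwP⟩ := h s hs
    refine ⟨partialDeriv i P, contDiff_partialDeriv hP i, ?_⟩
    rw [PeriodicHJBI.weakPartial_congr i hwP]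
    exact (isWeakPartial_of_contDiff i hP).weakPartial_ae_eq isOpen_interior
  have hw : ∀ {s : Finset (E n)} {g : E n → ℝ}, (∃ P : E n → ℝ, ContDiff ℝ ∞ P ∧
      g =ᵐ[volume.restrict (interior (cell s))] P) → HasWeakGrad (interior (cell s)) g := by
    rintro s g ⟨P, hP, hgP⟩
    exact (hasWeakGrad_of_contDiff hP).congr hgP.symm
  have hm : ∀ {s : Finset (E n)} {g : E n → ℝ}, (∃ P : E n → ℝ, ContDiff ℝ ∞ P ∧
      g =ᵐ[volume.restrict (interior (cell s))] P) →
      MemLp g 2 (volume.restrict (interior (cell s))) := by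
    rintro s g ⟨P, hP, hgP⟩
    exact (memLp_interior_cell s hP.continuous 2).ae_eq hgP.symm
  have ht : ∀ {s : Finset (E n)} {g : E n → ℝ} (S : Set (E n)), (∃ P : E n → ℝ, ContDiff ℝ ∞ P ∧
      g =ᵐ[volume.restrict (interior (cell s))] P) →
      ∃ τ, IsTrace (interior (cell s)) S g τ := by
    rintro s g S ⟨P, hP, hgP⟩
    exact ⟨P, (isTrace_of_contDiff isOpen_interior hP).congr hgP.symm⟩
  refine ⟨fun s hs => hw (h s hs), fun s hs i => hw (h1 i s hs), fun s hs => hm (h s hs),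
    fun s hs i => hm (h1 i s hs), fun s hs i j => ?_, fun s hs S _ => ht S (h s hs),
    fun s hs S _ i => ht S (h1 i s hs), fun q hq => 𝒯.memLp_jump_of_contDiff hn h hq,
    fun q hq i => 𝒯.memLp_jump_of_contDiff hn (h1 i) hq⟩
  obtain ⟨P, hP, hwP⟩ := h1 i s hs
  rw [PeriodicHJBI.weakPartial_congr j hwP]
  exact hm ⟨_, contDiff_partialDeriv hP j,
    (isWeakPartial_of_contDiff j hP).weakPartial_ae_eq isOpen_interior⟩

theorem isRegular_of_mem_V0 (𝒯 : Mesh n) (hn : n ≠ 0) {p : ℕ} {v : L2 n} (hv : v ∈ V0 𝒯 p) :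
    𝒯.IsRegular v := by
  refine 𝒯.isRegular_of_piecewise_contDiff hn fun s hs => ?_
  obtain ⟨P, -, hP⟩ := hv s hs
  refine ⟨polyFun P, contDiff_polyFun P, ?_⟩
  filter_upwards [𝒯.ae_interior_of_ae hs hP, ae_restrict_mem isOpen_interior.measurableSet]
    with x hx hxs
  exact hx (interior_subset hxs)

end Mesh

theorem V_le_V0 (𝒯 : Mesh n) (p : ℕ) (s : Fin 2) : V 𝒯 p s ≤ V0 𝒯 p := by
  unfold V
  split_ifs
  · exact le_rfl
  · exact inf_le_left

/-- Extension by zero from each element maps the polynomials of degree at most `p` to `L²(Y)`. The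
finitely many images together span a space containing `V0`, since the interiors are disjoint and
exhaust `Y` up to a null set. -/
theorem finiteDimensional_V0 (𝒯 : Mesh n) (p : ℕ) : FiniteDimensional ℝ (V0 𝒯 p) := by
  classical
  have hmem : ∀ (s : Finset (E n)) (P : MvPolynomial (Fin n) ℝ),
      MemLp ((interior (cell s)).indicator (polyFun P)) 2 (volume.restrict (Y n)) := by
    intro s P
    rw [memLp_indicator_iff_restrict isOpen_interior.measurableSet]
    refine (memLp_interior_cell s (contDiff_polyFun P).continuous 2).mono_measure ?_
    exact Measure.restrict_mono le_rfl Measure.restrict_le_self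
  have hadd : ∀ (P Q : MvPolynomial (Fin n) ℝ) (x : E n),
      polyFun (P + Q) x = polyFun P x + polyFun Q x := fun P Q x => by simp [polyFun]
  have hsmul : ∀ (c : ℝ) (P : MvPolynomial (Fin n) ℝ) (x : E n),
      polyFun (c • P) x = c * polyFun P x := fun c P x => by simp [polyFun]
  let Φ : Finset (E n) → MvPolynomial.restrictTotalDegree (Fin n) ℝ p →ₗ[ℝ] L2 n := fun s =>
    { toFun := fun P => (hmem s P).toLp _
      map_add' := fun P Q => by
        rw [← MemLp.toLp_add]
        congr 1
        funext x
        by_cases hx : x ∈ interior (cell s) <;> simp [hx, hadd]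
      map_smul' := fun c P => by
        rw [RingHom.id_apply, ← MemLp.toLp_const_smul]
        congr 1
        funext x
        by_cases hx : x ∈ interior (cell s) <;> simp [hx, hsmul] }
  have hle : V0 𝒯 p ≤ ⨆ s : 𝒯.elems, LinearMap.range (Φ s) := by
    intro v hv
    choose! P hPd hP using hv
    have e : v = ∑ s : 𝒯.elems, Φ s ⟨P s,
        (MvPolynomial.mem_restrictTotalDegree _ _ _).2 (hPd s s.2)⟩ := by
      refine Lp.ext ?_
      refine EventuallyEq.trans ?_ (Lp.coeFn_finsetSum _ _).symm
      have hall : ∀ᵐ x ∂(volume.restrict (Y n)), ∀ s : 𝒯.elems,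
          (Φ s ⟨P s, (MvPolynomial.mem_restrictTotalDegree _ _ _).2 (hPd s s.2)⟩ : L2 n) x =
            (interior (cell (s : Finset (E n)))).indicator (polyFun (P s)) x :=
        ae_all_iff.2 fun s => (hmem s (P s)).coeFn_toLp
      have hPall : ∀ᵐ x ∂(volume.restrict (Y n)), ∀ s : 𝒯.elems, x ∈ cell (s : Finset (E n)) →
          v x = polyFun (P s) x := ae_all_iff.2 fun s => hP s s.2
      filter_upwards [hall, hPall, 𝒯.ae_mem_interior] with x h1 h2 ⟨s, hs, hxs⟩
      rw [Finset.sum_apply, Finset.sum_eq_single_of_mem (⟨s, hs⟩ : 𝒯.elems) (Finset.mem_univ _),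
        h1, indicator_of_mem hxs]
      · exact h2 ⟨s, hs⟩ (interior_subset hxs)
      · intro t _ hts
        rw [h1]
        refine indicator_of_notMem (fun hxt => ?_) _
        exact disjoint_left.1 (𝒯.disjoint_interior t.2 hs fun h => hts (Subtype.ext h)) hxt hxs
    rw [e]
    exact Submodule.sum_mem _ fun s _ => Submodule.mem_iSup_of_mem s ⟨_, rfl⟩
  exact Submodule.finiteDimensional_of_le hle

end PeriodicHJBI

namespace PeriodicHJBI

variable {n : ℕ}

/-! ### Functions in `H²_per(Y)` are regular and have no jumps -/

/-- Periodic approximants take the same values on `S` and on its lattice translate, so their `L¹`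
limit on `S`, once translated, is the trace on the other copy. Here `Ω` need not touch `S`. -/
theorem isTrace_translate {Ω S : Set (E n)} (hS : IsCompact S) {w τ : E n → ℝ}
    {g : ℕ → E n → ℝ} (g0 : ∀ k, ContDiff ℝ ∞ (g k)) (hp : ∀ k, IsPeriodic (g k))
    (g1 : Tendsto (fun k => eLpNorm (fun x => g k x - w x) 1 (volume.restrict Ω)) atTop (𝓝 0))
    (g2 : ∀ i, Tendsto (fun k => eLpNorm (fun x => partialDeriv i (g k) x - weakPartial Ω i w x)
      1 (volume.restrict Ω)) atTop (𝓝 0))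
    (hτ : AEStronglyMeasurable τ (surf S))
    (g3 : Tendsto (fun k => eLpNorm (fun x => g k x - τ x) 1 (surf S)) atTop (𝓝 0))
    (z : Fin n → ℤ) :
    IsTrace Ω ((fun y => y - latticeVec z) '' S) w (fun y => τ (y + latticeVec z)) := by
  have hmp := measurePreserving_sub_surf hS (latticeVec z)
  have hemb : MeasurableEmbedding fun x : E n => x - latticeVec z :=
    (Homeomorph.subRight (latticeVec z)).measurableEmbedding
  have hm : AEStronglyMeasurable (fun y => τ (y + latticeVec z))
      (surf ((fun y => y - latticeVec z) '' S)) := by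
    rw [← hmp.aestronglyMeasurable_comp_iff hemb]
    simpa [Function.comp_def] using hτ
  refine ⟨hm, g, g0, g1, g2, g3.congr fun k => ?_⟩
  refine Eq.trans ?_ (eLpNorm_comp_measurePreserving
    ((g0 k).continuous.aestronglyMeasurable.sub hm) hmp)
  congr 1
  funext x
  have := hp k (x - latticeVec z) z
  rw [sub_add_cancel] at this
  simp [this]

namespace Mesh

/-- Elementwise limits of periodic smooth functions have no jumps. -/
theorem jump_ae_eq_zero (𝒯 : Mesh n) (hn : n ≠ 0) {W : Finset (E n) → E n → ℝ}
    (hW : ∀ s ∈ 𝒯.elems, AEStronglyMeasurable (W s) (volume.restrict (interior (cell s))))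
    {g : ℕ → E n → ℝ} (g0 : ∀ k, ContDiff ℝ ∞ (g k)) (hp : ∀ k, IsPeriodic (g k))
    (g1 : ∀ s ∈ 𝒯.elems, Tendsto (fun k => eLpNorm (fun x => g k x - W s x) 1
      (volume.restrict (interior (cell s)))) atTop (𝓝 0))
    (g2 : ∀ s ∈ 𝒯.elems, ∀ i, Tendsto (fun k => eLpNorm (fun x => partialDeriv i (g k) x -
      weakPartial (interior (cell s)) i (W s) x) 1 (volume.restrict (interior (cell s))))
      atTop (𝓝 0))
    {q : Finset (E n) × Finset (E n) × (Fin n → ℤ)} (hq : q ∈ 𝒯.orientedFaces) :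
    jump W q =ᵐ[surf (facePts q)] 0 := by
  obtain ⟨h1, f1⟩ := 𝒯.isFacet_fst hq
  obtain ⟨h2, f2⟩ := 𝒯.isFacet_snd hq
  have := 𝒯.isFiniteMeasure_surf hn h2 f2
  obtain ⟨τ, hτ, g3⟩ := exists_isTrace (𝒯.hasTraceInequality hn h2 f2) f2.isCompact (hW _ h2) g0
    (g1 _ h2) (g2 _ h2)
  -- The same limit `τ` serves on both sides, translated on the side of `q.1`, so the two
  -- contributions cancel.
  have e := 𝒯.jump_ae_eq hn hq hW ⟨hτ, g, g0, g1 _ h2, g2 _ h2, g3⟩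
    (isTrace_translate f2.isCompact g0 hp (g1 _ h1)
      (g2 _ h1) hτ g3 q.2.2)
  refine e.trans (Eventually.of_forall fun x => ?_)
  simp

theorem exists_isTrace (𝒯 : Mesh n) (hn : n ≠ 0) {s : Finset (E n)} (hs : s ∈ 𝒯.elems)
    {S : Set (E n)} (hS : IsFacet s S) {w : E n → ℝ}
    (hw : AEStronglyMeasurable w (volume.restrict (interior (cell s))))
    {g : ℕ → E n → ℝ} (g0 : ∀ k, ContDiff ℝ ∞ (g k))
    (g1 : Tendsto (fun k => eLpNorm (fun x => g k x - w x) 1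
      (volume.restrict (interior (cell s)))) atTop (𝓝 0))
    (g2 : ∀ i, Tendsto (fun k => eLpNorm (fun x => partialDeriv i (g k) x -
      weakPartial (interior (cell s)) i w x) 1 (volume.restrict (interior (cell s))))
      atTop (𝓝 0)) : ∃ τ, IsTrace (interior (cell s)) S w τ := by
  have := 𝒯.isFiniteMeasure_surf hn hs hS
  obtain ⟨τ, hτ, g3⟩ := PeriodicHJBI.exists_isTrace (𝒯.hasTraceInequality hn hs hS) hS.isCompact
    hw g0 g1 g2
  exact ⟨τ, hτ, g, g0, g1, g2, g3⟩

/-- Hölder's inequality on an element of finite measure passes from the `L²` approximation in the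
definition of the periodic spaces to the `L¹` approximation in the definition of traces. -/
theorem tendsto_eLpNorm_one (𝒯 : Mesh n) {s : Finset (E n)} (hs : s ∈ 𝒯.elems) (f : L2 n)
    {w : E n → ℝ} (hw : w =ᵐ[volume.restrict (interior (cell s))] f)
    {g : ℕ → E n → ℝ} (g0 : ∀ k, Continuous (g k))
    (h : ∀ k : ℕ, eLpNorm (fun x => f x - g k x) 2 (volume.restrict (Y n)) <
      ENNReal.ofReal (1 / ((k : ℝ) + 1))) :
    Tendsto (fun k => eLpNorm (fun x => g k x - w x) 1 (volume.restrict (interior (cell s))))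
      atTop (𝓝 0) := by
  have hle : (volume : Measure (E n)).restrict (interior (cell s)) ≤ volume.restrict (Y n) :=
    Measure.restrict_mono (𝒯.interior_cell_subset hs) le_rfl
  set C : ℝ≥0∞ := ((volume : Measure (E n)).restrict (interior (cell s))) univ ^
    (1 / (1 : ℝ≥0∞).toReal - 1 / (2 : ℝ≥0∞).toReal)
  have hC : C ≠ ⊤ := ENNReal.rpow_ne_top_of_nonneg (by norm_num) (measure_ne_top _ _)
  have hlim : Tendsto (fun k : ℕ => ENNReal.ofReal (1 / ((k : ℝ) + 1)) * C) atTop (𝓝 0) := by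
    have h1 := ENNReal.tendsto_ofReal (tendsto_one_div_add_atTop_nhds_zero_nat (𝕜 := ℝ))
    rw [ENNReal.ofReal_zero] at h1
    simpa using ENNReal.Tendsto.mul_const h1 (Or.inr hC)
  refine tendsto_of_tendsto_of_tendsto_of_le_of_le tendsto_const_nhds hlim
    (fun _ => zero_le) fun k => ?_
  have e : eLpNorm (fun x => g k x - w x) 1 (volume.restrict (interior (cell s))) =
      eLpNorm (fun x => f x - g k x) 1 (volume.restrict (interior (cell s))) := by
    rw [← eLpNorm_neg]
    refine eLpNorm_congr_ae ?_
    filter_upwards [hw] with x hx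
    simp [hx]
  dsimp only
  rw [e]
  have hm : AEStronglyMeasurable (fun x => f x - g k x)
      (volume.restrict (interior (cell s))) :=
    ((Lp.aestronglyMeasurable f).mono_measure hle).sub (g0 k).aestronglyMeasurable
  refine (eLpNorm_le_eLpNorm_mul_rpow_measure_univ (p := 1) (q := 2) (by norm_num) hm).trans ?_
  exact mul_le_mul_left ((eLpNorm_mono_measure _ hle).trans (h k).le) _

/-- The properties of functions in `H²_per(Y)` that matter for the error estimate. -/
theorem isRegular_of_memH2Per (𝒯 : Mesh n) (hn : n ≠ 0) {u : L2 n} (hu : MemH2Per u) :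
    𝒯.IsRegular u ∧
    (∀ q ∈ 𝒯.orientedFaces, jump (fun _ => u) q =ᵐ[surf (facePts q)] 0) ∧
    (∀ q ∈ 𝒯.orientedFaces, ∀ i, jump (fun r => weakPartial (interior (cell r)) i u) q
      =ᵐ[surf (facePts q)] 0) ∧
    (∀ᵐ x ∂(volume.restrict (Y n)), 𝒯.pwGrad u x = weakGrad (Y n) u x ∧
      𝒯.pwHess u x = weakHess (Y n) u x) := by
  obtain ⟨G, H, hG, hH, happ⟩ := hu
  choose φ φ0 φp φ1 φ2 φ3 using fun k : ℕ =>
    happ (1 / ((k : ℝ) + 1)) (by positivity)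
  have wG : ∀ s ∈ 𝒯.elems, ∀ i, IsWeakPartial (interior (cell s)) i u (G i) :=
    fun s hs i => (hG i).mono (𝒯.interior_cell_subset hs)
  have wH : ∀ s ∈ 𝒯.elems, ∀ i j, IsWeakPartial (interior (cell s)) j (G i) (H i j) :=
    fun s hs i j => (hH i j).mono (𝒯.interior_cell_subset hs)
  have eG : ∀ s ∈ 𝒯.elems, ∀ i, weakPartial (interior (cell s)) i u
      =ᵐ[volume.restrict (interior (cell s))] G i :=
    fun s hs i => (wG s hs i).weakPartial_ae_eq isOpen_interior
  have eH : ∀ s ∈ 𝒯.elems, ∀ i j, weakPartial (interior (cell s)) j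
      (weakPartial (interior (cell s)) i u) =ᵐ[volume.restrict (interior (cell s))] H i j := by
    intro s hs i j
    rw [PeriodicHJBI.weakPartial_congr j (eG s hs i)]
    exact (wH s hs i j).weakPartial_ae_eq isOpen_interior
  have mem : ∀ s ∈ 𝒯.elems, ∀ f : L2 n, MemLp f 2 (volume.restrict (interior (cell s))) :=
    fun s hs f => (Lp.memLp f).mono_measure
      (Measure.restrict_mono (𝒯.interior_cell_subset hs) le_rfl)
  have t0 : ∀ s ∈ 𝒯.elems, Tendsto (fun k => eLpNorm (fun x => φ k x - u x) 1
      (volume.restrict (interior (cell s)))) atTop (𝓝 0) := fun s hs =>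
    𝒯.tendsto_eLpNorm_one hs u EventuallyEq.rfl (fun k => (φ0 k).continuous) φ1
  have t1 : ∀ s ∈ 𝒯.elems, ∀ i, Tendsto (fun k => eLpNorm (fun x => partialDeriv i (φ k) x -
      weakPartial (interior (cell s)) i u x) 1 (volume.restrict (interior (cell s))))
      atTop (𝓝 0) := fun s hs i =>
    𝒯.tendsto_eLpNorm_one hs (G i) (eG s hs i) (fun k => continuous_partialDeriv (φ0 k) i)
      fun k => φ2 k i
  have t2 : ∀ s ∈ 𝒯.elems, ∀ i j, Tendsto (fun k => eLpNorm (fun x =>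
      partialDeriv j (partialDeriv i (φ k)) x -
      weakPartial (interior (cell s)) j (weakPartial (interior (cell s)) i u) x) 1
      (volume.restrict (interior (cell s)))) atTop (𝓝 0) := fun s hs i j =>
    𝒯.tendsto_eLpNorm_one hs (H i j) (eH s hs i j)
      (fun k => continuous_partialDeriv (contDiff_partialDeriv (φ0 k) i) j) fun k => φ3 k i j
  have j0 : ∀ q ∈ 𝒯.orientedFaces, jump (fun _ => u) q =ᵐ[surf (facePts q)] 0 := fun q hq =>
    𝒯.jump_ae_eq_zero hn (fun s hs => (mem s hs u).1) φ0 φp t0 t1 hq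
  -- The derivatives of the approximants are again smooth and periodic, and they converge in
  -- `W^{1,1}` on each element because second derivatives converge too.
  have j1 : ∀ q ∈ 𝒯.orientedFaces, ∀ i, jump (fun r => weakPartial (interior (cell r)) i u) q
      =ᵐ[surf (facePts q)] 0 := fun q hq i =>
    𝒯.jump_ae_eq_zero hn (fun s _ => aestronglyMeasurable_weakPartial i u)
      (fun k => contDiff_partialDeriv (φ0 k) i) (fun k => (φp k).partialDeriv i)
      (fun s hs => t1 s hs i) (fun s hs j => t2 s hs i j) hq
  -- Local integrability of `u` is read off from any one of its weak derivatives; index `0` exists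
  -- because `n ≠ 0`.
  refine ⟨⟨fun s hs => ⟨(wG s hs ⟨0, Nat.pos_of_ne_zero hn⟩).1, fun i => ⟨_, wG s hs i⟩⟩,
    fun s hs i => ?_, fun s hs => mem s hs u, fun s hs i => (mem s hs (G i)).ae_eq (eG s hs i).symm,
    fun s hs i j => (mem s hs (H i j)).ae_eq (eH s hs i j).symm,
    fun s hs S hS => 𝒯.exists_isTrace hn hs hS (mem s hs u).1 φ0 (t0 s hs) (t1 s hs),
    fun s hs S hS i => 𝒯.exists_isTrace hn hs hS (aestronglyMeasurable_weakPartial i u)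
      (fun k => contDiff_partialDeriv (φ0 k) i) (t1 s hs i) (t2 s hs i),
    fun q hq => MemLp.zero.ae_eq (j0 q hq).symm,
    fun q hq i => MemLp.zero.ae_eq (j1 q hq i).symm⟩, j0, j1, ?_⟩
  · exact HasWeakGrad.congr ⟨(wH s hs i i).1, fun j => ⟨_, wH s hs i j⟩⟩ (eG s hs i).symm
  -- Derivatives chosen on `Y` and on the elements are compared through the common representatives
  -- `G` and `H`.
  · have yG : ∀ i, weakPartial (Y n) i u =ᵐ[volume.restrict (Y n)] G i :=
      fun i => (hG i).weakPartial_ae_eq (isOpen_Y n)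
    have yH : ∀ i j, weakPartial (Y n) j (weakPartial (Y n) i u)
        =ᵐ[volume.restrict (Y n)] H i j := by
      intro i j
      rw [PeriodicHJBI.weakPartial_congr j (yG i)]
      exact (hH i j).weakPartial_ae_eq (isOpen_Y n)
    refine 𝒯.ae_of_forall_elems fun s hs => ?_
    filter_upwards [ae_restrict_mem isOpen_interior.measurableSet,
      ae_all_iff.2 fun i => eG s hs i, ae_all_iff.2 fun i => ae_all_iff.2 fun j => eH s hs i j,
      ae_all_iff.2 fun i => 𝒯.ae_interior_of_ae hs (yG i),
      ae_all_iff.2 fun i => ae_all_iff.2 fun j => 𝒯.ae_interior_of_ae hs (yH i j)]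
      with x hx h1 h2 h3 h4
    rw [𝒯.pwGrad_eq hs _ hx, 𝒯.pwHess_eq hs _ hx]
    constructor
    · funext i
      exact (h1 i).trans (h3 i).symm
    · ext i j
      exact (h2 i j).trans (h4 i j).symm

end Mesh

end PeriodicHJBI

namespace PeriodicHJBI

variable {n : ℕ}

/-! ### The norm on subspaces of `L²(Y)` -/

theorem L2.coeFn_sub_eq_comb (f g : L2 n) :
    (fun x => 1 * f x + (-1) * g x) =ᵐ[volume.restrict (Y n)] (f - g : L2 n) := by
  filter_upwards [Lp.coeFn_sub f g] with x hx
  rw [hx, Pi.sub_apply]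
  ring

theorem L2.coeFn_smul_add (r r' : ℝ) (f g : L2 n) :
    (fun x => r * f x + r' * g x) =ᵐ[volume.restrict (Y n)] (r • f + r' • g : L2 n) := by
  filter_upwards [Lp.coeFn_add (r • f) (r' • g), Lp.coeFn_smul r f, Lp.coeFn_smul r' g]
    with x h1 h2 h3
  rw [h1, Pi.add_apply, h2, h3]
  rfl

theorem L2.norm_sq_eq (f : L2 n) : ‖f‖ ^ 2 = ∫ x in Y n, f x ^ 2 := by
  rw [← real_inner_self_eq_norm_sq, L2.inner_def]
  refine integral_congr_ae (Eventually.of_forall fun x => ?_)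
  simp [sq]

namespace Mesh

theorem IsRegular.sub {𝒯 : Mesh n} (hn : n ≠ 0) {f g : L2 n} (hf : 𝒯.IsRegular f)
    (hg : 𝒯.IsRegular g) : 𝒯.IsRegular (f - g : L2 n) :=
  (hf.comb hg hn 1 (-1)).congr (L2.coeFn_sub_eq_comb f g)

theorem IsRegular.dgNorm_smul_add_le {𝒯 : Mesh n} (hn : n ≠ 0) {lam : ℝ} (hlam : 0 < lam)
    {f g : L2 n} (hf : 𝒯.IsRegular f) (hg : 𝒯.IsRegular g) (r r' : ℝ) :
    𝒯.dgNorm lam (r • f + r' • g : L2 n) ≤ |r| * 𝒯.dgNorm lam f + |r'| * 𝒯.dgNorm lam g := by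
  rw [← 𝒯.dgNorm_congr lam (L2.coeFn_smul_add r r' f g)]
  exact hf.dgNorm_comb_le hg hn hlam r r'

theorem IsRegular.dgNorm_sub_le {𝒯 : Mesh n} (hn : n ≠ 0) {lam : ℝ} (hlam : 0 < lam)
    {f g h : L2 n} (hf : 𝒯.IsRegular f) (hg : 𝒯.IsRegular g) (hh : 𝒯.IsRegular h) :
    𝒯.dgNorm lam (f - h : L2 n) ≤ 𝒯.dgNorm lam (f - g : L2 n) + 𝒯.dgNorm lam (g - h : L2 n) := by
  have := (hf.sub hn hg).dgNorm_smul_add_le hn hlam (hg.sub hn hh) 1 1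
  simpa using this

theorem dgNorm_zero (𝒯 : Mesh n) (hn : n ≠ 0) {lam : ℝ} (hlam : 0 < lam)
    (h0 : 𝒯.IsRegular (0 : L2 n)) : 𝒯.dgNorm lam (0 : L2 n) = 0 := by
  have := h0.dgNorm_smul_add_le hn hlam h0 0 0
  simp only [smul_zero, add_zero, abs_zero, zero_mul] at this
  exact le_antisymm this (Real.sqrt_nonneg _)

/-- On a finite-dimensional space of regular functions, the `L²`-norm is the stronger norm up to a
constant. -/
theorem exists_dgNorm_le (𝒯 : Mesh n) (hn : n ≠ 0) {lam : ℝ} (hlam : 0 < lam)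
    (W : Submodule ℝ (L2 n)) [FiniteDimensional ℝ W] (hW : ∀ w ∈ W, 𝒯.IsRegular w) :
    ∃ K, 0 ≤ K ∧ ∀ w : W, 𝒯.dgNorm lam (w : L2 n) ≤ K * ‖w‖ := by
  classical
  set b := Module.finBasis ℝ W
  have hsum : ∀ (c : Fin (Module.finrank ℝ W) → ℝ) (t : Finset (Fin (Module.finrank ℝ W))),
      𝒯.dgNorm lam ((∑ i ∈ t, c i • b i : W) : L2 n) ≤
        ∑ i ∈ t, |c i| * 𝒯.dgNorm lam (b i : L2 n) := by
    intro c t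
    induction t using Finset.induction_on with
    | empty => simpa using (𝒯.dgNorm_zero hn hlam (hW 0 W.zero_mem)).le
    | insert i t hi ih =>
      rw [Finset.sum_insert hi, Finset.sum_insert hi]
      have h1 := (hW _ (b i).2).dgNorm_smul_add_le hn hlam
        (hW _ (∑ i ∈ t, c i • b i : W).2) (c i) 1
      simp only [one_smul, abs_one, one_mul] at h1
      exact h1.trans (add_le_add le_rfl ih)
  set K := ∑ i, ‖(b.coord i).toContinuousLinearMap‖ * 𝒯.dgNorm lam (b i : L2 n)
  refine ⟨K, Finset.sum_nonneg fun i _ => mul_nonneg (ContinuousLinearMap.opNorm_nonneg _)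
    (Real.sqrt_nonneg _), fun w => ?_⟩
  have h1 := hsum (fun i => b.repr w i) Finset.univ
  rw [b.sum_repr] at h1
  refine h1.trans ?_
  rw [Finset.sum_mul]
  refine Finset.sum_le_sum fun i _ => ?_
  have h2 := (b.coord i).toContinuousLinearMap.le_opNorm w
  have h3 : |b.repr w i| ≤ ‖(b.coord i).toContinuousLinearMap‖ * ‖w‖ := h2
  calc _ ≤ ‖(b.coord i).toContinuousLinearMap‖ * ‖w‖ * 𝒯.dgNorm lam (b i : L2 n) :=
        mul_le_mul_of_nonneg_right h3 (Real.sqrt_nonneg _)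
    _ = _ := by ring

theorem integral_jetSq_le {𝒯 : Mesh n} {lam : ℝ} (hlam : 0 < lam) (w : E n → ℝ) :
    ∫ x in Y n, jetSq lam (w x) (𝒯.pwGrad w x) (𝒯.pwHess w x) ≤ 𝒯.dgNorm lam w ^ 2 := by
  rw [dgNorm_eq, Real.sq_sqrt (𝒯.dgSq_nonneg hlam w), dgSq]
  linarith [𝒯.jumpSq_nonneg w]

/-- Only the zeroth-order part of the norm is kept. It turns strong monotonicity in the mesh norm
into strong monotonicity in `L²`. -/
theorem IsRegular.sq_mul_norm_sq_le {𝒯 : Mesh n} {lam : ℝ} (hlam : 0 < lam) {f : L2 n}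
    (hf : 𝒯.IsRegular f) : lam ^ 2 * ‖f‖ ^ 2 ≤ 𝒯.dgNorm lam f ^ 2 := by
  refine le_trans ?_ (integral_jetSq_le hlam f)
  rw [L2.norm_sq_eq, ← integral_const_mul]
  refine integral_mono_of_nonneg (Eventually.of_forall fun x => by positivity)
    (hf.integrable_jetSq lam) (Eventually.of_forall fun x => ?_)
  have h1 := frob_self_nonneg (𝒯.pwHess f x)
  have h2 : 0 ≤ ∑ i, 𝒯.pwGrad f x i ^ 2 := Finset.sum_nonneg fun _ _ => sq_nonneg _
  have h3 : 0 ≤ 2 * lam * ∑ i, 𝒯.pwGrad f x i ^ 2 := by positivity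
  simp only [jetSq]
  linarith

/-- Subtracting a regular function from one without jumps does not change the jump seminorm. -/
theorem jumpSq_sub_eq (𝒯 : Mesh n) (hn : n ≠ 0) {u v : L2 n} (hu : 𝒯.IsRegular u)
    (hv : 𝒯.IsRegular v)
    (j0 : ∀ q ∈ 𝒯.orientedFaces, jump (fun _ => u) q =ᵐ[surf (facePts q)] 0)
    (j1 : ∀ q ∈ 𝒯.orientedFaces, ∀ i, jump (fun r => weakPartial (interior (cell r)) i u) q
      =ᵐ[surf (facePts q)] 0) :
    𝒯.jumpSq (u - v : L2 n) = 𝒯.jumpSq v := by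
  rw [← 𝒯.jumpSq_congr (L2.coeFn_sub_eq_comb u v)]
  unfold jumpSq
  congr 1
  refine Finset.sum_congr rfl fun q hq => ?_
  have e1 : ∫ x, jump (fun _ x => 1 * u x + (-1) * v x) q x ^ 2 ∂(surf (facePts q)) =
      ∫ x, jump (fun _ => v) q x ^ 2 ∂(surf (facePts q)) := by
    refine integral_congr_ae ?_
    filter_upwards [hu.jump_comb hv hn 1 (-1) hq, j0 q hq] with x h1 h2
    rw [h1, h2, Pi.zero_apply]
    ring
  have e2 : ∫ x, ∑ i, jump (fun r => weakPartial (interior (cell r)) i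
        (fun x => 1 * u x + (-1) * v x)) q x ^ 2 ∂(surf (facePts q)) =
      ∫ x, ∑ i, jump (fun r => weakPartial (interior (cell r)) i v) q x ^ 2
        ∂(surf (facePts q)) := by
    refine integral_congr_ae ?_
    filter_upwards [ae_all_iff.2 fun i => hu.jump_weakPartial_comb hv hn 1 (-1) hq i,
      ae_all_iff.2 fun i => j1 q hq i] with x h1 h2
    refine Finset.sum_congr rfl fun i _ => ?_
    rw [h1 i, h2 i, Pi.zero_apply]
    ring
  rw [e1, e2]

end Mesh

/-! ### The consistency of the renormalized operator -/

theorem integral_sqrt_mul_abs_le {μ : Measure (E n)} {J : E n → ℝ} (hJ : Integrable J μ)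
    (hJ0 : ∀ x, 0 ≤ J x) {L : E n → ℝ} (hL : MemLp L 2 μ) :
    Integrable (fun x => Real.sqrt (J x) * |L x|) μ ∧
      ∫ x, Real.sqrt (J x) * |L x| ∂μ ≤
        Real.sqrt (∫ x, J x ∂μ) * Real.sqrt (∫ x, L x ^ 2 ∂μ) := by
  have hm : MemLp (fun x => Real.sqrt (J x)) 2 μ := by
    rw [memLp_two_iff_integrable_sq
      (Real.continuous_sqrt.comp_aestronglyMeasurable hJ.aestronglyMeasurable)]
    simpa only [Real.sq_sqrt (hJ0 _)] using hJ
  refine ⟨hm.integrable_mul hL.abs, ?_⟩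
  have h2 : ENNReal.ofReal 2 = 2 := by simp
  have h := integral_mul_le_Lp_mul_Lq_of_nonneg (μ := μ) (p := 2) (q := 2)
    (Real.holderConjugate_iff.2 ⟨by norm_num, by norm_num⟩)
    (f := fun x => Real.sqrt (J x)) (g := fun x => |L x|)
    (Eventually.of_forall fun x => Real.sqrt_nonneg _) (Eventually.of_forall fun x => abs_nonneg _)
    (by rwa [h2]) (by rw [h2]; exact hL.abs)
  simpa only [Real.rpow_two, Real.sq_sqrt (hJ0 _), sq_abs, ← Real.sqrt_eq_rpow] using h

section Consistency

variable {𝒜 ℬ : Type*} [MetricSpace 𝒜] [CompactSpace 𝒜] [Nonempty 𝒜]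
  [MetricSpace ℬ] [CompactSpace ℬ] [Nonempty ℬ] {P : Coeffs n 𝒜 ℬ} {lam delta : ℝ}

/-- Since `F_γ[u]` vanishes, the Lipschitz estimate bounds `F_γ[v]` pointwise by the jet of `u - v`;
Cauchy-Schwarz does the rest. -/
theorem abs_integral_pwFgamma_mul_le (hP : P.Admissible lam delta) (𝒯 : Mesh n)
    {u v : L2 n} (hu : 𝒯.IsRegular u) (hv : 𝒯.IsRegular v) (hn : n ≠ 0)
    (hsol : ∀ᵐ x ∂(volume.restrict (Y n)), pwFgamma P lam 𝒯 u x = 0) (ℓ : L2 n) :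
    |∫ x in Y n, pwFgamma P lam 𝒯 v x * ℓ x| ≤
      (Real.sqrt (1 - delta) + Real.sqrt ((n : ℝ) + 1)) * 𝒯.dgNorm lam (u - v : L2 n) * ‖ℓ‖ := by
  have hlam := hP.lam_pos
  set κ := Real.sqrt (1 - delta) + Real.sqrt ((n : ℝ) + 1)
  have hκ : 0 ≤ κ := add_nonneg (Real.sqrt_nonneg _) (Real.sqrt_nonneg _)
  set J : E n → ℝ := fun x =>
    jetSq lam ((u - v : L2 n) x) (𝒯.pwGrad (u - v : L2 n) x) (𝒯.pwHess (u - v : L2 n) x)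
  have hJ : Integrable J (volume.restrict (Y n)) := (hu.sub hn hv).integrable_jetSq lam
  obtain ⟨hint, hle⟩ := integral_sqrt_mul_abs_le hJ (fun x => jetSq_nonneg hlam _ _ _)
    (Lp.memLp ℓ)
  have hpt : ∀ᵐ x ∂(volume.restrict (Y n)),
      ‖pwFgamma P lam 𝒯 v x * ℓ x‖ ≤ κ * (Real.sqrt (J x) * |ℓ x|) := by
    have hg := hu.pwGrad_comb hv 1 (-1)
    have hh := hu.pwHess_comb hv 1 (-1)
    rw [𝒯.pwGrad_congr (L2.coeFn_sub_eq_comb u v)] at hg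
    rw [𝒯.pwHess_congr (L2.coeFn_sub_eq_comb u v)] at hh
    filter_upwards [hsol, hg, hh, Lp.coeFn_sub u v] with x h0 h1 h2 h3
    have h4 := hP.abs_Fgamma_sub_le x (u x) (v x) (𝒯.pwGrad u x) (𝒯.pwGrad v x)
      (𝒯.pwHess u x) (𝒯.pwHess v x)
    have h5 : P.Fgamma lam x (u x) (𝒯.pwGrad u x) (𝒯.pwHess u x) = 0 := h0
    have h6 : J x = jetSq lam (u x - v x) (𝒯.pwGrad u x - 𝒯.pwGrad v x)
        (𝒯.pwHess u x - 𝒯.pwHess v x) := by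
      simp only [J, h1, h2, h3, Pi.sub_apply, one_smul, neg_smul, ← sub_eq_add_neg]
    rw [h5, zero_sub, abs_neg, ← h6] at h4
    rw [Real.norm_eq_abs, abs_mul, ← mul_assoc]
    exact mul_le_mul_of_nonneg_right h4 (abs_nonneg _)
  -- Only the majorant has to be integrable, so measurability of `F_γ[v]` is not needed.
  have h1 := norm_integral_le_of_norm_le (hint.const_mul κ) hpt
  rw [integral_const_mul, Real.norm_eq_abs] at h1
  refine h1.trans ?_
  rw [mul_assoc]
  refine mul_le_mul_of_nonneg_left (hle.trans ?_) hκ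
  rw [← L2.norm_sq_eq, Real.sqrt_sq (norm_nonneg _)]
  refine mul_le_mul_of_nonneg_right ?_ (norm_nonneg _)
  exact Real.sqrt_le_left (Real.sqrt_nonneg _) |>.2 (Mesh.integral_jetSq_le hlam _)

end Consistency

end PeriodicHJBI

/-! ### Well-posedness of the discrete problem and quasi-optimality -/

open PeriodicHJBI in
theorem theorem2p5 {n : ℕ} (hn : n = 2 ∨ n = 3)
    {𝒜 ℬ : Type*} [MetricSpace 𝒜] [CompactSpace 𝒜] [Nonempty 𝒜]
    [MetricSpace ℬ] [CompactSpace ℬ] [Nonempty ℬ]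
    (P : Coeffs n 𝒜 ℬ) (lam delta : ℝ) (hP : P.Admissible lam delta)
    (𝒯 : Mesh n) (p : ℕ) (hp : 2 ≤ p) (s : Fin 2)
    (a : V 𝒯 p s → V 𝒯 p s → ℝ) (CM CL C1 C2 : ℝ)
    -- linearity in the second argument
    (hA1 : ∀ w, IsLinearMap ℝ (a w))
    -- strong monotonicity
    (hCM : 0 < CM)
    (hA2 : ∀ w v : V 𝒯 p s,
      𝒯.dgNorm lam (w - v : L2 n) ^ 2 ≤ CM * (a w (w - v) - a v (w - v)))
    -- Lipschitz continuity
    (hCL : 0 < CL)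
    (hA3 : ∀ w w' v : V 𝒯 p s,
      |a w v - a w' v| ≤ CL * 𝒯.dgNorm lam (w - w' : L2 n) * 𝒯.dgNorm lam (v : L2 n))
    -- discrete consistency
    (hC1 : 0 < C1) (hC2 : 0 < C2)
    (LT : V 𝒯 p s →ₗ[ℝ] L2 n)
    (hA4 : ∀ v : V 𝒯 p s, ‖LT v‖ ≤ C1 * 𝒯.dgNorm lam (v : L2 n))
    (hA4' : ∀ w v : V 𝒯 p s,
      |a w v - ∫ x in Y n, pwFgamma P lam 𝒯 (w : L2 n) x * LT v x| ≤
        C2 * 𝒯.jumpSeminorm (w : L2 n) * 𝒯.dgNorm lam (v : L2 n)) :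
    (∃! uT : V 𝒯 p s, ∀ v, a uT v = 0) ∧
    ∀ u : L2 n, P.IsStrongSolution u →
      ∀ uT : V 𝒯 p s, (∀ v, a uT v = 0) →
        𝒯.dgNorm lam (u - uT : L2 n) ≤
          (1 + CM * (C1 * (Real.sqrt (1 - delta) + Real.sqrt ((n : ℝ) + 1)) + C2)) *
            ⨅ v : V 𝒯 p s, 𝒯.dgNorm lam (u - v : L2 n) := by
  have hn0 : n ≠ 0 := by omega
  have hlam := hP.lam_pos
  have hreg : ∀ v ∈ V 𝒯 p s, 𝒯.IsRegular v := fun v hv =>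
    𝒯.isRegular_of_mem_V0 hn0 (V_le_V0 𝒯 p s hv)
  have hfinV0 := finiteDimensional_V0 𝒯 p
  have hfin : FiniteDimensional ℝ (V 𝒯 p s) := Submodule.finiteDimensional_of_le (V_le_V0 𝒯 p s)
  have hnn : ∀ w : E n → ℝ, 0 ≤ 𝒯.dgNorm lam w := fun w => Real.sqrt_nonneg _
  have hlow : ∀ w v : V 𝒯 p s, lam ^ 2 * ‖w - v‖ ^ 2 ≤ CM * (a w (w - v) - a v (w - v)) :=
    fun w v => ((hreg _ (w - v).2).sq_mul_norm_sq_le hlam).trans (hA2 w v)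
  refine ⟨?_, fun u hu uT huT => ?_⟩
  · obtain ⟨K, hK0, hK⟩ := 𝒯.exists_dgNorm_le hn0 hlam (V 𝒯 p s) hreg
    -- The Hilbert structure is that of `L²` restricted to `V`; passing from the mesh norm costs
    -- `λ²` in the monotonicity and one factor `K` per argument in the Lipschitz bound.
    obtain ⟨uT, huT⟩ := exists_forall_eq_zero_of_strongMono a (m := CM⁻¹ * lam ^ 2)
      (L := CL * K * K) hA1 (by positivity)
      (fun w v => by
        rw [mul_assoc, inv_mul_le_iff₀ hCM]
        exact hlow w v)
      (fun w w' v => by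
        refine (hA3 w w' v).trans ?_
        calc CL * 𝒯.dgNorm lam (w - w' : L2 n) * 𝒯.dgNorm lam (v : L2 n)
            ≤ CL * (K * ‖w - w'‖) * (K * ‖v‖) := by
              gcongr
              · exact hnn _
              · exact hK (w - w')
              · exact hK v
          _ = _ := by ring)
    refine ⟨uT, huT, fun v hv => ?_⟩
    have h1 := hlow v uT
    rw [huT, hv, sub_zero, mul_zero] at h1
    have h2 : ‖v - uT‖ ^ 2 = 0 :=
      le_antisymm (nonpos_of_mul_nonpos_right h1 (by positivity)) (sq_nonneg _)
    exact sub_eq_zero.1 (norm_eq_zero.1 (pow_eq_zero_iff two_ne_zero |>.1 h2))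
  · obtain ⟨hur, j0, j1, hder⟩ := 𝒯.isRegular_of_memH2Per hn0 hu.1
    have hsol : ∀ᵐ x ∂(volume.restrict (Y n)), pwFgamma P lam 𝒯 u x = 0 := by
      filter_upwards [hu.2, hder] with x h1 h2
      rw [pwFgamma, h2.1, h2.2]
      exact hP.Fgamma_eq_zero h1
    set κ := Real.sqrt (1 - delta) + Real.sqrt ((n : ℝ) + 1)
    have hκ : 0 ≤ κ := add_nonneg (Real.sqrt_nonneg _) (Real.sqrt_nonneg _)
    -- With the constant inside the infimum, the bound can be proved for each `v` separately.
    rw [Real.mul_iInf_of_nonneg (by positivity)]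
    refine le_ciInf fun v => ?_
    set z : V 𝒯 p s := v - uT
    set D := 𝒯.dgNorm lam (u - v : L2 n)
    have hD : 0 ≤ D := hnn _
    set N := 𝒯.dgNorm lam (z : L2 n)
    have hN : 0 ≤ N := hnn _
    have htri : 𝒯.dgNorm lam (u - uT : L2 n) ≤ D + N :=
      hur.dgNorm_sub_le hn0 hlam (hreg _ v.2) (hreg _ uT.2)
    -- As `u` has no jumps, the jumps of `v` are those of `u - v` up to sign, hence part of `D`.
    have hjump : 𝒯.jumpSeminorm (v : L2 n) ≤ D := by
      rw [Mesh.jumpSeminorm, ← 𝒯.jumpSq_sub_eq hn0 hur (hreg _ v.2) j0 j1]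
      refine Real.sqrt_le_sqrt ?_
      exact le_add_of_nonneg_left (integral_nonneg fun _ => jetSq_nonneg hlam _ _ _)
    have h1 : N ^ 2 ≤ CM * a v z := by
      have := hA2 v uT
      rwa [huT, sub_zero] at this
    have h2 : |∫ x in Y n, pwFgamma P lam 𝒯 (v : L2 n) x * LT z x| ≤ κ * D * (C1 * N) :=
      (abs_integral_pwFgamma_mul_le hP 𝒯 hur (hreg _ v.2) hn0 hsol (LT z)).trans
        (mul_le_mul_of_nonneg_left (hA4 z) (mul_nonneg hκ hD))
    have h3 : C2 * 𝒯.jumpSeminorm (v : L2 n) * N ≤ C2 * D * N :=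
      mul_le_mul_of_nonneg_right (mul_le_mul_of_nonneg_left hjump hC2.le) hN
    have h4 : a v z ≤ (C1 * κ + C2) * D * N := by
      have h5 := (abs_le.1 (hA4' v z)).2
      have h6 := (abs_le.1 h2).2
      linarith
    -- The quadratic bound on `N` is divided by `N`; the case `N = 0` is separate.
    have h7 : N ≤ CM * (C1 * κ + C2) * D := by
      rcases hN.eq_or_lt with h0 | h0
      · rw [← h0]; positivity
      · have h8 : N * N ≤ CM * (C1 * κ + C2) * D * N := by
          rw [← sq]
          refine h1.trans ?_
          calc CM * a v z ≤ CM * ((C1 * κ + C2) * D * N) := mul_le_mul_of_nonneg_left h4 hCM.le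
            _ = _ := by ring
        exact le_of_mul_le_mul_right h8 h0
    linarith
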